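/- **Problem.** An instance of SMTI-Diverse consists of $n\ge 1$ students $U$, $m$ colleges $W$ and $t\ge 0$ types. Every student $u$ has a type vector $\tau_u\in\{0,1\}^t$ and a preference list $\succeq_u$ (a complete transitive relation, so ties are allowed) over a nonempty set $A(u)\subseteq W$ of acceptable colleges. Every college $w$ has a preference list $\succeq_w$ over a nonempty set $A(w)\subseteq U$ of acceptable students, a capacity $q_w\in\{0,\dots,n\}$, and lower and upper quota vectors $\ell_w\le u_w$ in $\{0,\dots,n\}^t$; moreover $u\in A(w)$ if and only if $w\in A(u)$. A matching $M$ assigns to each student $u$ at most one college $M(u)$, which must lie in $A(u)$; let $M(w)$ be the set of students assigned to $w$. A set $S$ of students is feasible for $w$ if $|S|\le q_w$ and $\ell_w\le\sum_{u\in S}\tau_u\le u_w$ componentwise; $M$ is feasible if $M(w)$ is feasible for every college $w$. A student $u$ and a college $w\in A(u)$ with $M(u)\ne w$ block $M$ if $u$ strictly prefers $w$ to $M(u)$ (an unassigned student prefers every acceptable college to being unassigned) and there is a possibly empty set $U'\subseteq M(w)$ such that $w$ strictly prefers $u$ to every student in $U'$ and $(M(w)\setminus U')\cup\{u\}$ is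 feasible for $w$. $M$ is stable if no pair blocks it. The question is whether a feasible and stable matching exists. **Theorem.** There is an algorithm (a random access machine with unit-cost constant, addition, subtraction, memory access and zero-test instructions, and without multiplication; the preference lists are given as tables of positions) that decides SMTI-Diverse in $$\mathcal O\bigl(n^{\,m\cdot 2^t+(2m+1)(t+1)}\cdot m^2\cdot(n^t\cdot t+m)\bigr)$$ steps, with an absolute constant hidden in the $\mathcal O$. In particular, for every constant $k$, the running time of this algorithm on instances with $m+t\le k$ is bounded by a polynomial in the input length. -/

import Mathlib

/-! ### Random access machines, as structured programs with unit-cost steps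

The instruction set is the classical one without multiplication: constants, addition, truncated
subtraction, indirect reading and writing of memory, branching and looping on a test for zero. -/

namespace RAM

/-- A configuration: registers and a memory, both holding natural numbers. -/
structure State where
  reg : ℕ → ℕ
  mem : ℕ → ℕ

/-- Expressions. `load e` reads the memory cell whose address is the value of `e`. -/
inductive Expr where
  | const (k : ℕ)
  | reg (i : ℕ)
  | add (a b : Expr)
  | sub (a b : Expr)
  | load (a : Expr)

/-- The value of an expression. -/
def Expr.eval (s : State) : Expr → ℕ
  | .const k => k
  | .reg i => s.reg i
  | .add a b => a.eval s + b.eval s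
  | .sub a b => a.eval s - b.eval s
  | .load a => s.mem (a.eval s)

/-- The number of steps needed to evaluate an expression: one for each of its nodes. -/
def Expr.cost : Expr → ℕ
  | .const _ => 1
  | .reg _ => 1
  | .add a b => a.cost + b.cost + 1
  | .sub a b => a.cost + b.cost + 1
  | .load a => a.cost + 1

/-- Programs. A test `e` counts as true if its value is nonzero. -/
inductive Prog where
  | skip
  | assign (i : ℕ) (e : Expr)
  | store (addr e : Expr)
  | seq (p q : Prog)
  | ite (e : Expr) (p q : Prog)
  | loop (e : Expr) (p : Prog)

/-- `Exec p s T s'`: started in configuration `s`, the program `p` halts after exactly `T` steps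
in configuration `s'`. -/
inductive Exec : Prog → State → ℕ → State → Prop where
  | skip (s : State) : Exec .skip s 1 s
  | assign (s : State) (i : ℕ) (e : Expr) :
      Exec (.assign i e) s (e.cost + 1) { s with reg := Function.update s.reg i (e.eval s) }
  | store (s : State) (a e : Expr) :
      Exec (.store a e) s (a.cost + e.cost + 1)
        { s with mem := Function.update s.mem (a.eval s) (e.eval s) }
  | seq {p q : Prog} {s s₁ s₂ : State} {T₁ T₂ : ℕ} :
      Exec p s T₁ s₁ → Exec q s₁ T₂ s₂ → Exec (.seq p q) s (T₁ + T₂) s₂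
  | iteTrue {e : Expr} {p q : Prog} {s s₁ : State} {T : ℕ} :
      e.eval s ≠ 0 → Exec p s T s₁ → Exec (.ite e p q) s (e.cost + 1 + T) s₁
  | iteFalse {e : Expr} {p q : Prog} {s s₁ : State} {T : ℕ} :
      e.eval s = 0 → Exec q s T s₁ → Exec (.ite e p q) s (e.cost + 1 + T) s₁
  | loopDone {e : Expr} {p : Prog} {s : State} :
      e.eval s = 0 → Exec (.loop e p) s (e.cost + 1) s
  | loopStep {e : Expr} {p : Prog} {s s₁ s₂ : State} {T₁ T₂ : ℕ} :
      e.eval s ≠ 0 → Exec p s T₁ s₁ → Exec (.loop e p) s₁ T₂ s₂ →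
      Exec (.loop e p) s (e.cost + 1 + T₁ + T₂) s₂

/-- Execution is deterministic. -/
theorem Exec.deterministic {p : Prog} {s s₁ s₂ : State} {T₁ T₂ : ℕ}
    (h₁ : Exec p s T₁ s₁) (h₂ : Exec p s T₂ s₂) : T₁ = T₂ ∧ s₁ = s₂ := by
  induction h₁ generalizing T₂ s₂ with
  | skip s => cases h₂; exact ⟨rfl, rfl⟩
  | assign s i e => cases h₂; exact ⟨rfl, rfl⟩
  | store s a e => cases h₂; exact ⟨rfl, rfl⟩
  | seq _ _ ih₁ ih₂ =>
    cases h₂ with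
    | seq k₁ k₂ =>
      obtain ⟨rfl, rfl⟩ := ih₁ k₁
      obtain ⟨rfl, rfl⟩ := ih₂ k₂
      exact ⟨rfl, rfl⟩
  | iteTrue h _ ih =>
    cases h₂ with
    | iteTrue _ k => obtain ⟨rfl, rfl⟩ := ih k; exact ⟨rfl, rfl⟩
    | iteFalse k _ => exact absurd k h
  | iteFalse h _ ih =>
    cases h₂ with
    | iteTrue k _ => exact absurd h k
    | iteFalse _ k => obtain ⟨rfl, rfl⟩ := ih k; exact ⟨rfl, rfl⟩
  | loopDone h =>
    cases h₂ with
    | loopDone _ => exact ⟨rfl, rfl⟩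
    | loopStep k _ _ => exact absurd h k
  | loopStep h _ _ ih₁ ih₂ =>
    cases h₂ with
    | loopDone k => exact absurd k h
    | loopStep _ k₁ k₂ =>
      obtain ⟨rfl, rfl⟩ := ih₁ k₁
      obtain ⟨rfl, rfl⟩ := ih₂ k₂
      exact ⟨rfl, rfl⟩

/-- The initial configuration: the input occupies the first memory cells, everything else is 0. -/
def initial (input : List ℕ) : State where
  reg := fun _ => 0
  mem := fun a => input.getD a 0

/-- On the given input, the program halts within `T` steps, and register `0` finally holds `1` if
the answer is yes and `0` if the answer is no. -/
def AnswersWithin (p : Prog) (input : List ℕ) (answer : Prop) (T : ℕ) : Prop :=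
  ∃ (T' : ℕ) (s : State), Exec p (initial input) T' s ∧ T' ≤ T ∧
    (answer → s.reg 0 = 1) ∧ (¬ answer → s.reg 0 = 0)

end RAM

/-! ### Stable matching with diversity constraints -/

/-- `r` is a preference list over `A`: a complete, transitive relation on `A`, where `r x y`
means that `x` is weakly preferred to `y`. Values of `r` outside `A` are never used. -/
def IsPrefList {α : Type*} (A : Set α) (r : α → α → Prop) : Prop :=
  (∀ x ∈ A, ∀ y ∈ A, r x y ∨ r y x) ∧
    ∀ x ∈ A, ∀ y ∈ A, ∀ z ∈ A, r x y → r y z → r x z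

/-- Strict preference: the asymmetric part of `r`. -/
def StrictPref {α : Type*} (r : α → α → Prop) (x y : α) : Prop :=
  r x y ∧ ¬ r y x

/-- Instances with `n` students, `m` colleges and `t` types. Acceptability is mutual, hence one
relation. -/
structure SMTIDiverse (n m t : ℕ) where
  /-- student `u` and college `w` accept each other -/
  acc : Fin n → Fin m → Prop
  /-- every student has a nonempty acceptable set -/
  acc_student : ∀ u, ∃ w, acc u w
  /-- every college has a nonempty acceptable set -/
  acc_college : ∀ w, ∃ u, acc u w
  /-- `prefS u w w'`: student `u` weakly prefers `w` to `w'` -/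
  prefS : Fin n → Fin m → Fin m → Prop
  prefS_list : ∀ u, IsPrefList {w | acc u w} (prefS u)
  /-- `prefC w u u'`: college `w` weakly prefers `u` to `u'` -/
  prefC : Fin m → Fin n → Fin n → Prop
  prefC_list : ∀ w, IsPrefList {u | acc u w} (prefC w)
  /-- the type vectors of the students -/
  τ : Fin n → Fin t → Fin 2
  /-- the lower quotas of the colleges -/
  lower : Fin m → Fin t → ℕ
  /-- the upper quotas of the colleges -/
  upper : Fin m → Fin t → ℕ
  lower_le_upper : ∀ w z, lower w z ≤ upper w z
  upper_le : ∀ w z, upper w z ≤ n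
  /-- the capacities of the colleges -/
  cap : Fin m → ℕ
  cap_le : ∀ w, cap w ≤ n

namespace SMTIDiverse

variable {n m t : ℕ} (I : SMTIDiverse n m t)

/-- A matching: every student is assigned to at most one college, which must be acceptable.
`none` means unassigned. -/
structure Matching where
  college : Fin n → Option (Fin m)
  acceptable : ∀ u w, college u = some w → I.acc u w

variable {I}

/-- The set of the students assigned to `w`. -/
def Matching.students (M : I.Matching) (w : Fin m) : Finset (Fin n) :=
  Finset.univ.filter fun u => M.college u = some w

variable (I)

/-- Admitting exactly the students in `S` respects the capacity and all quotas of `w`. -/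
def FeasibleFor (w : Fin m) (S : Finset (Fin n)) : Prop :=
  S.card ≤ I.cap w ∧
    ∀ z, I.lower w z ≤ ∑ u ∈ S, (I.τ u z : ℕ) ∧ ∑ u ∈ S, (I.τ u z : ℕ) ≤ I.upper w z

variable {I}

/-- `M` is feasible. -/
def Matching.Feasible (M : I.Matching) : Prop :=
  ∀ w, I.FeasibleFor w (M.students w)

/-- Student `u` and college `w` block `M`, with some witness `S`. An unassigned student prefers
every acceptable college to being unassigned. -/
def Matching.Blocks (M : I.Matching) (u : Fin n) (w : Fin m) : Prop :=
  I.acc u w ∧ M.college u ≠ some w ∧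
    (∀ w', M.college u = some w' → StrictPref (I.prefS u) w w') ∧
    ∃ S ⊆ M.students w, (∀ u' ∈ S, StrictPref (I.prefC w) u u') ∧
      I.FeasibleFor w (insert u (M.students w \ S))

/-- `M` is stable. -/
def Matching.Stable (M : I.Matching) : Prop :=
  ∀ u w, ¬ M.Blocks u w

variable (I)

/-- The question of the decision problem. -/
def HasFeasibleStableMatching : Prop :=
  ∃ M : I.Matching, M.Feasible ∧ M.Stable

open Classical in
/-- The position of college `w` in the preference list of student `u`: one plus the number of
acceptable colleges that `u` strictly prefers to `w`, or `0` if `w` is not acceptable to `u`. -/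
noncomputable def rankS (u : Fin n) (w : Fin m) : ℕ :=
  if I.acc u w then
    (Finset.univ.filter fun w' => I.acc u w' ∧ StrictPref (I.prefS u) w' w).card + 1
  else 0

open Classical in
/-- The position of student `u` in the preference list of college `w`, likewise. -/
noncomputable def rankC (w : Fin m) (u : Fin n) : ℕ :=
  if I.acc u w then
    (Finset.univ.filter fun u' => I.acc u' w ∧ StrictPref (I.prefC w) u' u).card + 1
  else 0

/-- The entries of an `a × b` table, row by row. -/
def table {a b : ℕ} (f : Fin a → Fin b → ℕ) : List ℕ :=
  (List.finRange a).flatMap fun i => (List.finRange b).map (f i)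

/-- The input of the machine: `n`, `m`, `t`, the type vectors, the preference lists of the students
and of the colleges (as tables of positions), the lower and upper quotas, and the capacities. -/
noncomputable def encode : List ℕ :=
  [n, m, t] ++ table (fun u z => (I.τ u z : ℕ)) ++ table I.rankS ++ table I.rankC ++
    table I.lower ++ table I.upper ++ List.ofFn I.cap

end SMTIDiverse

namespace RAM

/-! ### Bounded executions -/

/-- From `s` the program `p` halts within `c` steps in a configuration satisfying `Q`. -/
def Run (p : Prog) (s : State) (c : ℕ) (Q : State → Prop) : Prop :=
  ∃ T s', Exec p s T s' ∧ T ≤ c ∧ Q s'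

namespace Run

variable {p q : Prog} {s : State} {c c₁ c₂ : ℕ} {Q R : State → Prop} {e : Expr}

theorem mono (h : Run p s c₁ Q) (hc : c₁ ≤ c₂) (hQ : ∀ s', Q s' → R s') : Run p s c₂ R := by
  obtain ⟨T, s', h₁, h₂, h₃⟩ := h
  exact ⟨T, s', h₁, h₂.trans hc, hQ _ h₃⟩

theorem seq (h : Run p s c₁ Q) (h' : ∀ s', Q s' → Run q s' c₂ R) :
    Run (.seq p q) s (c₁ + c₂) R := by
  obtain ⟨T, s', h₁, h₂, h₃⟩ := h
  obtain ⟨T', s'', k₁, k₂, k₃⟩ := h' _ h₃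
  exact ⟨_, _, .seq h₁ k₁, by omega, k₃⟩

theorem assign (i : ℕ) (e : Expr)
    (hQ : Q { s with reg := Function.update s.reg i (e.eval s) }) :
    Run (.assign i e) s (e.cost + 1) Q :=
  ⟨_, _, .assign s i e, le_rfl, hQ⟩

theorem store (a e : Expr)
    (hQ : Q { s with mem := Function.update s.mem (a.eval s) (e.eval s) }) :
    Run (.store a e) s (a.cost + e.cost + 1) Q :=
  ⟨_, _, .store s a e, le_rfl, hQ⟩

theorem ite (h₁ : e.eval s ≠ 0 → Run p s c Q) (h₂ : e.eval s = 0 → Run q s c Q) :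
    Run (.ite e p q) s (e.cost + 1 + c) Q := by
  by_cases h : e.eval s = 0
  · obtain ⟨T, s', k₁, k₂, k₃⟩ := h₂ h
    exact ⟨_, _, .iteFalse h k₁, by omega, k₃⟩
  · obtain ⟨T, s', k₁, k₂, k₃⟩ := h₁ h
    exact ⟨_, _, .iteTrue h k₁, by omega, k₃⟩

/-- A loop with a known number of rounds and an invariant. -/
theorem loop (Inv : ℕ → State → Prop) (c : ℕ → ℕ) (N : ℕ)
    (step : ∀ i < N, ∀ s, Inv i s → e.eval s ≠ 0 ∧ Run p s (c i) (Inv (i + 1)))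
    (done : ∀ s, Inv N s → e.eval s = 0) (h : Inv 0 s) :
    Run (.loop e p) s (∑ i ∈ Finset.range N, (c i + e.cost + 1) + (e.cost + 1)) (Inv N) := by
  have key : ∀ d i s, i + d = N → Inv i s →
      Run (.loop e p) s (∑ r ∈ Finset.Ico i N, (c r + e.cost + 1) + (e.cost + 1)) (Inv N) := by
    intro d
    induction d with
    | zero =>
      rintro i s rfl hs
      exact ⟨_, _, .loopDone (done _ hs), by simp, hs⟩
    | succ d ih =>
      intro i s hi hs
      obtain ⟨h₁, T, s', k₁, k₂, k₃⟩ := step i (by omega) s hs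
      obtain ⟨T', s'', l₁, l₂, l₃⟩ := ih (i + 1) s' (by omega) k₃
      refine ⟨_, _, .loopStep h₁ k₁ l₁, ?_, l₃⟩
      rw [Finset.sum_eq_sum_Ico_succ_bot (by omega)]
      omega
  simpa using key N 0 s (by omega) h

end Run

/-! ### A language of terms

Terms denote natural numbers. They have variables, arrays, bounded sums, and arrays defined by
recursion on the index. -/

/-- In `arr A x N f b` the entry term `f` may read array `A` itself, which at that moment holds the
entries computed so far. This is what expresses tables and dynamic programs without assignments. -/
inductive Term where
  | num (c : ℕ)
  | var (x : ℕ)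
  | add (a b : Term)
  | sub (a b : Term)
  | quo (a b : Term)
  | rem (a b : Term)
  | get (A : ℕ) (i : Term)
  | ite (c a b : Term)
  | bind (x : ℕ) (a b : Term)
  | sum (x : ℕ) (N b : Term)
  | arr (A x : ℕ) (N f b : Term)

/-- The array of length `N` whose entry at `i` is computed by `F i` from the previous entries. -/
def build (F : ℕ → (ℕ → ℕ) → ℕ) : ℕ → ℕ → ℕ
  | 0 => fun _ => 0
  | N + 1 => Function.update (build F N) N (F N (build F N))

/-- An array of length `N`. -/
def clip (N : ℕ) (h : ℕ → ℕ) : ℕ → ℕ := fun i => if i < N then h i else 0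

theorem clip_of_lt {N i : ℕ} (h : ℕ → ℕ) (hi : i < N) : clip N h i = h i := if_pos hi

theorem clip_of_le {N i : ℕ} (h : ℕ → ℕ) (hi : N ≤ i) : clip N h i = 0 := if_neg (by omega)

theorem build_of_le (F : ℕ → (ℕ → ℕ) → ℕ) {N i : ℕ} (h : N ≤ i) : build F N i = 0 := by
  induction N with
  | zero => rfl
  | succ N ih => rw [build, Function.update_of_ne (by omega), ih (by omega)]

/-- Gives recursive arrays a closed form: it is enough that one step reproduces `h` from a correct
prefix. Every array below is evaluated through this. -/
theorem build_eq_clip {F : ℕ → (ℕ → ℕ) → ℕ} {h : ℕ → ℕ} {N : ℕ}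
    (H : ∀ i < N, F i (clip i h) = h i) : build F N = clip N h := by
  induction N with
  | zero => funext i; simp [build, clip]
  | succ N ih =>
    rw [build, ih fun i hi => H i (by omega), H N (by omega)]
    funext i
    rcases lt_trichotomy i N with hi | rfl | hi
    · rw [Function.update_of_ne (by omega), clip_of_lt _ hi, clip_of_lt _ (by omega)]
    · rw [Function.update_self, clip_of_lt _ (by omega)]
    · rw [Function.update_of_ne (by omega), clip_of_le _ (by omega), clip_of_le _ (by omega)]

namespace Term

/-- The value of a term. -/
def eval : Term → (ℕ → ℕ) → (ℕ → ℕ → ℕ) → ℕ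
  | num c, _, _ => c
  | var x, ρ, _ => ρ x
  | add a b, ρ, α => a.eval ρ α + b.eval ρ α
  | sub a b, ρ, α => a.eval ρ α - b.eval ρ α
  | quo a b, ρ, α => a.eval ρ α / b.eval ρ α
  | rem a b, ρ, α => a.eval ρ α % b.eval ρ α
  | get A i, ρ, α => α A (i.eval ρ α)
  | ite c a b, ρ, α => if c.eval ρ α ≠ 0 then a.eval ρ α else b.eval ρ α
  | bind x a b, ρ, α => b.eval (Function.update ρ x (a.eval ρ α)) α
  | sum x N b, ρ, α => ∑ i ∈ Finset.range (N.eval ρ α), b.eval (Function.update ρ x i) α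
  | arr A x N f b, ρ, α =>
      b.eval ρ (Function.update α A
        (build (fun i g => f.eval (Function.update ρ x i) (Function.update α A g)) (N.eval ρ α)))

/-- A bound for the number of steps needed to evaluate a term. -/
def cost : Term → (ℕ → ℕ) → (ℕ → ℕ → ℕ) → ℕ
  | num _, _, _ => 2
  | var _, _, _ => 2
  | add a b, ρ, α => a.cost ρ α + b.cost ρ α + 4
  | sub a b, ρ, α => a.cost ρ α + b.cost ρ α + 4
  | quo a b, ρ, α => a.cost ρ α + b.cost ρ α + 14 * (a.eval ρ α / b.eval ρ α) + 14
  | rem a b, ρ, α => a.cost ρ α + b.cost ρ α + 14 * (a.eval ρ α / b.eval ρ α) + 14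
  | get _ i, ρ, α => i.cost ρ α + 80
  | ite c a b, ρ, α => c.cost ρ α + 2 + if c.eval ρ α ≠ 0 then a.cost ρ α else b.cost ρ α
  | bind x a b, ρ, α => a.cost ρ α + b.cost (Function.update ρ x (a.eval ρ α)) α + 8
  | sum x N b, ρ, α => N.cost ρ α +
      ∑ i ∈ Finset.range (N.eval ρ α), (b.cost (Function.update ρ x i) α + 12) + 14
  | arr A x N f b, ρ, α => N.cost ρ α +
      ∑ i ∈ Finset.range (N.eval ρ α), (f.cost (Function.update ρ x i) (Function.update α A
        (build (fun i g => f.eval (Function.update ρ x i) (Function.update α A g)) i)) + 90) +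
      b.cost ρ (Function.update α A
        (build (fun i g => f.eval (Function.update ρ x i) (Function.update α A g)) (N.eval ρ α)))
      + 20

/-- All variables are below 32, and arrays are numbered by their nesting, starting from `j`. -/
def Scoped : Term → ℕ → Prop
  | num _, _ => True
  | var x, _ => x < 32
  | add a b, j => a.Scoped j ∧ b.Scoped j
  | sub a b, j => a.Scoped j ∧ b.Scoped j
  | quo a b, j => a.Scoped j ∧ b.Scoped j
  | rem a b, j => a.Scoped j ∧ b.Scoped j
  | get A i, j => A < j ∧ i.Scoped j
  | ite c a b, j => c.Scoped j ∧ a.Scoped j ∧ b.Scoped j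
  | bind x a b, j => x < 32 ∧ a.Scoped j ∧ b.Scoped j
  | sum x N b, j => x < 32 ∧ N.Scoped j ∧ b.Scoped j
  | arr A x N f b, j => A = j ∧ A < 32 ∧ x < 32 ∧ N.Scoped j ∧ f.Scoped (j + 1) ∧ b.Scoped (j + 1)

end Term

/-! ### Compilation

Variable `x` lives in register `x`, register 32 holds the base address of the arrays, the registers
from 33 on are temporary. Cell `i` of array `A` is found at address `base + A + 32 * i`; cell 0 holds
the length. -/

/-- Five doublings replace the multiplication by 32. Expressions are trees, so the operand is
duplicated each time and the result has 63 nodes; this is where the costs 69 and 80 of array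
accesses come from. -/
def Expr.dbl (e : Expr) : Expr := .add e e

/-- The address of cell `i` of array `c`, or of cell `i + 1` of array `c - 32`. -/
def Expr.cell (c r : ℕ) : Expr :=
  .add (.add (.reg 32) (.const c)) (Expr.reg r).dbl.dbl.dbl.dbl.dbl

@[simp] theorem Expr.eval_cell (c r : ℕ) (s : State) :
    (Expr.cell c r).eval s = s.reg 32 + c + 32 * s.reg r := by
  simp only [Expr.cell, Expr.dbl, Expr.eval]; ring

def Expr.header (A : ℕ) : Expr := .add (.reg 32) (.const A)

@[simp] theorem Expr.eval_header (A : ℕ) (s : State) :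
    (Expr.header A).eval s = s.reg 32 + A := rfl

/-- The program computing the value of a term in register `k`, using only registers from `k` on. -/
def Term.comp : Term → ℕ → Prog
  | num c, k => .assign k (.const c)
  | var x, k => .assign k (.reg x)
  | add a b, k => .seq (a.comp k) (.seq (b.comp (k + 1)) (.assign k (.add (.reg k) (.reg (k + 1)))))
  | sub a b, k => .seq (a.comp k) (.seq (b.comp (k + 1)) (.assign k (.sub (.reg k) (.reg (k + 1)))))
  | quo a b, k => .seq (a.comp k) (.seq (b.comp (k + 1)) (.seq (.assign (k + 2) (.const 0))
      (.seq (.ite (.reg (k + 1))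
        (.loop (.sub (.add (.reg k) (.const 1)) (.reg (k + 1)))
          (.seq (.assign k (.sub (.reg k) (.reg (k + 1))))
            (.assign (k + 2) (.add (.reg (k + 2)) (.const 1))))) .skip)
        (.assign k (.reg (k + 2))))))
  | rem a b, k => .seq (a.comp k) (.seq (b.comp (k + 1)) (.seq (.assign (k + 2) (.const 0))
      (.ite (.reg (k + 1))
        (.loop (.sub (.add (.reg k) (.const 1)) (.reg (k + 1)))
          (.seq (.assign k (.sub (.reg k) (.reg (k + 1))))
            (.assign (k + 2) (.add (.reg (k + 2)) (.const 1))))) .skip)))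
  | get A i, k => .seq (i.comp k) (.ite (.sub (.load (.header A)) (.reg k))
      (.assign k (.load (.cell (A + 32) k))) (.assign k (.const 0)))
  | ite c a b, k => .seq (c.comp k) (.ite (.reg k) (a.comp k) (b.comp k))
  | bind x a b, k => .seq (a.comp k) (.seq (.assign (k + 1) (.reg x)) (.seq (.assign x (.reg k))
      (.seq (b.comp (k + 2)) (.seq (.assign x (.reg (k + 1))) (.assign k (.reg (k + 2)))))))
  | sum x N b, k => .seq (N.comp k) (.seq (.assign (k + 1) (.reg x))
      (.seq (.assign (k + 2) (.const 0)) (.seq (.assign x (.const 0))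
      (.seq (.loop (.sub (.reg k) (.reg x)) (.seq (b.comp (k + 3))
        (.seq (.assign (k + 2) (.add (.reg (k + 2)) (.reg (k + 3))))
          (.assign x (.add (.reg x) (.const 1))))))
      (.seq (.assign x (.reg (k + 1))) (.assign k (.reg (k + 2))))))))
  | arr A x N f b, k => .seq (N.comp k) (.seq (.store (.header A) (.const 0))
      (.seq (.assign (k + 1) (.reg x)) (.seq (.assign x (.const 0))
      (.seq (.loop (.sub (.reg k) (.reg x)) (.seq (f.comp (k + 2))
        (.seq (.store (.cell (A + 32) x) (.reg (k + 2)))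
        (.seq (.assign x (.add (.reg x) (.const 1))) (.store (.header A) (.reg x))))))
      (.seq (.assign x (.reg (k + 1))) (b.comp k))))))

/-- The contents of array `A`; beyond its length it is 0. -/
def State.view (s : State) (A i : ℕ) : ℕ :=
  if i < s.mem (s.reg 32 + A) then s.mem (s.reg 32 + A + 32 * (i + 1)) else 0

/-- The configuration `s` represents the values `ρ` of the variables and `α` of the first `j`
arrays. -/
def Rep (j : ℕ) (s : State) (ρ : ℕ → ℕ) (α : ℕ → ℕ → ℕ) : Prop :=
  (∀ x < 32, s.reg x = ρ x) ∧ ∀ A < j, ∀ i, s.view A i = α A i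

/-- The registers below `k` and the first `j` arrays are the same in `s` and `s'`. -/
def Same (j k : ℕ) (s s' : State) : Prop :=
  (∀ i < k, s'.reg i = s.reg i) ∧
    ∀ A < j, ∀ i, s'.mem (s.reg 32 + A + 32 * i) = s.mem (s.reg 32 + A + 32 * i)

section

variable {j k : ℕ} {s s' s'' : State} {ρ : ℕ → ℕ} {α : ℕ → ℕ → ℕ}

theorem Same.refl : Same j k s s := ⟨fun _ _ => rfl, fun _ _ _ => rfl⟩

theorem Same.trans (hk : 33 ≤ k) (h : Same j k s s') (h' : Same j k s' s'') : Same j k s s'' :=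
  ⟨fun i hi => (h'.1 i hi).trans (h.1 i hi), fun A hA i => by
    have := h'.2 A hA i
    rw [h.1 32 (by omega)] at this
    rw [this, h.2 A hA i]⟩

theorem Same.mono {j' k' : ℕ} (h : Same j k s s') (hj : j' ≤ j) (hk : k' ≤ k) : Same j' k' s s' :=
  ⟨fun i hi => h.1 i (by omega), fun A hA => h.2 A (by omega)⟩

theorem Same.assign {i : ℕ} (h : Same j k s s') (hi : k ≤ i) (v : ℕ) :
    Same j k s { s' with reg := Function.update s'.reg i v } :=
  ⟨fun r hr => by simp [Function.update_of_ne (show r ≠ i by omega), h.1 r hr], h.2⟩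

theorem Rep.same (hk : 33 ≤ k) (h : Rep j s ρ α) (h' : Same j k s s') : Rep j s' ρ α := by
  refine ⟨fun x hx => (h'.1 x (by omega)).trans (h.1 x hx), fun A hA i => ?_⟩
  rw [← h.2 A hA i, State.view, State.view, h'.1 32 (by omega), h'.2 A hA (i + 1)]
  have := h'.2 A hA 0
  simp only [Nat.mul_zero, Nat.add_zero] at this
  rw [this]

theorem Rep.var {x : ℕ} (h : Rep j s ρ α) (hx : x < 32) (v : ℕ) :
    Rep j { s with reg := Function.update s.reg x v } (Function.update ρ x v) α := by
  refine ⟨fun y hy => ?_, fun A hA i => ?_⟩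
  · by_cases hxy : y = x
    · subst hxy; simp
    · simp [Function.update_of_ne hxy, h.1 y hy]
  · rw [← h.2 A hA i]
    simp [State.view, Function.update_of_ne (show 32 ≠ x by omega)]

end

end RAM

/-! ### Correctness and running time of the compiled terms -/

namespace RAM

/-- Changing the value of a register. -/
def State.set (s : State) (i v : ℕ) : State := { s with reg := Function.update s.reg i v }

/-- Changing the value of a memory cell. -/
def State.put (s : State) (a v : ℕ) : State := { s with mem := Function.update s.mem a v }

section

variable {j k : ℕ} {s s' s'' : State} {ρ : ℕ → ℕ} {α : ℕ → ℕ → ℕ}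

@[simp] theorem State.set_reg_self (i v : ℕ) : (s.set i v).reg i = v := by simp [State.set]

theorem State.set_reg_ne {i r : ℕ} (h : r ≠ i) (v : ℕ) : (s.set i v).reg r = s.reg r := by
  simp [State.set, h]

@[simp] theorem State.set_mem (i v : ℕ) : (s.set i v).mem = s.mem := rfl

@[simp] theorem State.put_reg (a v : ℕ) : (s.put a v).reg = s.reg := rfl

@[simp] theorem State.put_mem_self (a v : ℕ) : (s.put a v).mem a = v := by simp [State.put]

theorem State.put_mem_ne {a r : ℕ} (h : r ≠ a) (v : ℕ) : (s.put a v).mem r = s.mem r := by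
  simp [State.put, h]

theorem State.set_set (i v v' : ℕ) : (s.set i v).set i v' = s.set i v' := by
  simp [State.set]

theorem State.set_eq_self {i v : ℕ} (h : v = s.reg i) : s.set i v = s := by
  subst h; simp [State.set]

theorem Same.set_right {i : ℕ} (h : Same j k s s') (hi : k ≤ i) (v : ℕ) :
    Same j k s (s'.set i v) := h.assign hi v

/-- Used when a binder ends: resetting `x` to its saved value undoes the temporary change on both
sides. -/
theorem Same.set_both {x : ℕ} (h : Same j k s s') (hx : x < 32) (v : ℕ) :
    Same j k (s.set x v) (s'.set x v) := by
  refine ⟨fun i hi => ?_, fun A hA i => ?_⟩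
  · by_cases hix : i = x
    · subst hix; simp
    · simp [State.set_reg_ne hix, h.1 i hi]
  · simp only [State.set_reg_ne (show 32 ≠ x by omega), State.set_mem]
    exact h.2 A hA i

/-- Arrays are interleaved with stride 32, so different array numbers below 32 never share an
address, whatever the lengths; no memory has to be allocated. -/
theorem Same.put_right {A c : ℕ} (hk : 33 ≤ k) (h : Same j k s s') (hj : j ≤ A) (hA : A < 32)
    (v : ℕ) : Same j k s (s'.put (s'.reg 32 + A + 32 * c) v) := by
  refine ⟨h.1, fun B hB i => ?_⟩
  rw [State.put_mem_ne (by rw [h.1 32 (by omega)]; omega)]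
  exact h.2 B hB i

theorem Run.set {c : ℕ} {Q : State → Prop} (i : ℕ) (e : Expr) (hQ : Q (s.set i (e.eval s)))
    (hc : e.cost + 1 = c) : Run (.assign i e) s c Q := hc ▸ Run.assign i e hQ

theorem Run.put {c : ℕ} {Q : State → Prop} (a e : Expr) (hQ : Q (s.put (a.eval s) (e.eval s)))
    (hc : a.cost + e.cost + 1 = c) : Run (.store a e) s c Q := hc ▸ Run.store a e hQ

end

/-- What the compiled program achieves. -/
def Term.Correct (e : Term) : Prop :=
  ∀ (j k : ℕ) (s : State) (ρ : ℕ → ℕ) (α : ℕ → ℕ → ℕ), e.Scoped j → 33 ≤ k → Rep j s ρ α →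
    Run (e.comp k) s (e.cost ρ α) fun s' => s'.reg k = e.eval ρ α ∧ Same j k s s'

namespace Term

theorem correct_num (c : ℕ) : (num c).Correct := fun j k s ρ α _ hk _ =>
  Run.set _ _ ⟨by simp [Expr.eval, eval], Same.refl.set_right le_rfl _⟩ rfl

theorem correct_var (x : ℕ) : (var x).Correct := fun j k s ρ α hx hk h =>
  Run.set _ _ ⟨by simpa [Expr.eval, eval] using h.1 x hx, Same.refl.set_right le_rfl _⟩ rfl

theorem correct_binary {a b : Term} (ha : a.Correct) (hb : b.Correct) {j k : ℕ} {s : State}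
    {ρ : ℕ → ℕ} {α : ℕ → ℕ → ℕ} (has : a.Scoped j) (hbs : b.Scoped j) (hk : 33 ≤ k)
    (h : Rep j s ρ α) {p : Prog} {c : ℕ} {Q : State → Prop}
    (H : ∀ s', s'.reg k = a.eval ρ α → s'.reg (k + 1) = b.eval ρ α → Same j k s s' → Run p s' c Q) :
    Run (.seq (a.comp k) (.seq (b.comp (k + 1)) p)) s (a.cost ρ α + (b.cost ρ α + c)) Q := by
  refine Run.seq (ha j k s ρ α has hk h) fun s₁ ⟨h₁, h₁'⟩ => ?_
  refine Run.seq (hb j (k + 1) s₁ ρ α hbs (by omega) (h.same hk h₁')) fun s₂ ⟨h₂, h₂'⟩ => ?_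
  exact H s₂ (by rw [h₂'.1 k (by omega), h₁]) h₂ (h₁'.trans hk (h₂'.mono le_rfl (by omega)))

theorem correct_add {a b : Term} (ha : a.Correct) (hb : b.Correct) : (add a b).Correct := by
  intro j k s ρ α hs hk h
  refine (correct_binary ha hb hs.1 hs.2 hk h (c := 4) fun s' h₁ h₂ h₃ => ?_).mono
    (by simp only [cost]; omega) fun _ h => h
  exact Run.set _ _ ⟨by simp [Expr.eval, eval, h₁, h₂], h₃.set_right le_rfl _⟩ rfl

theorem correct_sub {a b : Term} (ha : a.Correct) (hb : b.Correct) : (sub a b).Correct := by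
  intro j k s ρ α hs hk h
  refine (correct_binary ha hb hs.1 hs.2 hk h (c := 4) fun s' h₁ h₂ h₃ => ?_).mono
    (by simp only [cost]; omega) fun _ h => h
  exact Run.set _ _ ⟨by simp [Expr.eval, eval, h₁, h₂], h₃.set_right le_rfl _⟩ rfl

/-- Division with remainder by repeated subtraction. -/
theorem run_divide {j k : ℕ} {s : State} :
    Run (.seq (.assign (k + 2) (.const 0))
      (.ite (.reg (k + 1))
        (.loop (.sub (.add (.reg k) (.const 1)) (.reg (k + 1)))
          (.seq (.assign k (.sub (.reg k) (.reg (k + 1))))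
            (.assign (k + 2) (.add (.reg (k + 2)) (.const 1))))) .skip)) s
      (14 * (s.reg k / s.reg (k + 1)) + 10) fun s' =>
        s'.reg k = s.reg k % s.reg (k + 1) ∧ s'.reg (k + 2) = s.reg k / s.reg (k + 1) ∧
          Same j k s s' := by
  set a := s.reg k with ha
  set b := s.reg (k + 1) with hb
  refine (Run.seq (c₁ := 2) (c₂ := 1 + 1 + (14 * (a / b) + 6)) (Run.set _ _
    (Q := fun s' => s'.reg k = a ∧ s'.reg (k + 1) = b ∧ s'.reg (k + 2) = 0 ∧ Same j k s s') ?_ rfl)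
    fun s' ⟨h₁, h₂, h₃, h₄⟩ => ?_).mono (by omega) fun _ h => h
  · simp only [Expr.eval]
    exact ⟨by rw [State.set_reg_ne (by omega)], by rw [State.set_reg_ne (by omega)], by simp,
      Same.refl.set_right (by omega) _⟩
  refine Run.ite (fun hne => ?_) (fun h0 => ?_)
  · simp only [Expr.eval, h₂] at hne
    have hb0 : 0 < b := by omega
    -- For a remaining dividend `r` the test `r + 1 - b` is nonzero exactly when `b ≤ r`, so there
    -- are `a / b` rounds. A round costs 8 for the body and 6 for the test, hence the factor 14.
    refine (Run.loop (fun i s' => s'.reg k + b * i = a ∧ s'.reg (k + 1) = b ∧ s'.reg (k + 2) = i ∧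
      Same j k s s') (fun _ => 8) (a / b) ?_ ?_ ⟨by simp [h₁], h₂, h₃, h₄⟩).mono ?_ ?_
    · rintro i hi s₁ ⟨k₁, k₂, k₃, k₄⟩
      have hle : b * i + b ≤ a := by
        have := (Nat.le_div_iff_mul_le hb0).1 (Nat.succ_le_of_lt hi)
        rw [Nat.succ_mul, mul_comm i b] at this
        exact this
      refine ⟨by simp only [Expr.eval, k₂]; omega, ?_⟩
      refine Run.seq (c₁ := 4) (c₂ := 4) (Run.set _ _ (Q := fun s' => s'.reg k + b * (i + 1) = a ∧
        s'.reg (k + 1) = b ∧ s'.reg (k + 2) = i ∧ Same j k s s') ?_ rfl) fun s₂ ⟨l₁, l₂, l₃, l₄⟩ => ?_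
      · simp only [Expr.eval, k₂]
        refine ⟨?_, by rw [State.set_reg_ne (by omega), k₂], by rw [State.set_reg_ne (by omega), k₃],
          k₄.set_right le_rfl _⟩
        rw [State.set_reg_self, mul_add]; omega
      · refine Run.set _ _ ?_ rfl
        simp only [Expr.eval, l₃]
        exact ⟨by rw [State.set_reg_ne (by omega), l₁], by rw [State.set_reg_ne (by omega), l₂],
          by simp, l₄.set_right (by omega) _⟩
    · rintro s₁ ⟨k₁, k₂, -, -⟩
      simp only [Expr.eval, k₂]
      have := Nat.div_add_mod a b
      have := Nat.mod_lt a hb0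
      omega
    · simp [Expr.cost]; omega
    · rintro s₁ ⟨k₁, -, k₃, k₄⟩
      have := Nat.div_add_mod a b
      exact ⟨by omega, k₃, k₄⟩
  -- For divisor 0 the guard skips the loop, which would never end. The untouched dividend and the
  -- quotient 0 agree with the conventions `a % 0 = a` and `a / 0 = 0`.
  · simp only [Expr.eval, h₂] at h0
    exact ⟨_, _, .skip _, by omega, by simp [h₁, h0], by simp [h₃, h0], h₄⟩

theorem correct_rem {a b : Term} (ha : a.Correct) (hb : b.Correct) : (rem a b).Correct := by
  intro j k s ρ α hs hk h
  refine (correct_binary ha hb hs.1 hs.2 hk h (c := 14 * (a.eval ρ α / b.eval ρ α) + 10)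
    fun s' h₁ h₂ h₃ => ?_).mono (by simp only [cost]; omega) fun _ h => h
  refine (run_divide (j := j)).mono (by rw [h₁, h₂]) fun s'' ⟨k₁, _, k₃⟩ => ?_
  exact ⟨by rw [k₁, h₁, h₂, eval], h₃.trans hk k₃⟩

end Term

/-- Compiled programs are nested to the right, whereas `run_divide` treats an initial segment of the
quotient program as a unit. -/
theorem Run.assoc {p q r : Prog} {s : State} {c : ℕ} {Q : State → Prop}
    (h : Run (.seq (.seq p q) r) s c Q) : Run (.seq p (.seq q r)) s c Q := by
  obtain ⟨T, s', h₁, h₂, h₃⟩ := h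
  cases h₁ with
  | seq k₁ k₂ => cases k₁ with
    | seq l₁ l₂ => exact ⟨_, _, .seq l₁ (.seq l₂ k₂), by omega, h₃⟩

namespace Term

theorem correct_quo {a b : Term} (ha : a.Correct) (hb : b.Correct) : (quo a b).Correct := by
  intro j k s ρ α hs hk h
  refine (correct_binary ha hb hs.1 hs.2 hk h (c := 14 * (a.eval ρ α / b.eval ρ α) + 10 + 2)
    fun s' h₁ h₂ h₃ => ?_).mono (by simp only [cost]; omega) fun _ h => h
  refine Run.assoc (Run.seq ((run_divide (j := j)).mono (by rw [h₁, h₂]) fun _ h => h)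
    fun s'' ⟨_, k₂, k₃⟩ => ?_)
  refine Run.set _ _ ⟨?_, (h₃.trans hk k₃).set_right le_rfl _⟩ rfl
  simp [Expr.eval, k₂, h₁, h₂, eval]

theorem correct_get (A : ℕ) {i : Term} (hi : i.Correct) : (get A i).Correct := by
  intro j k s ρ α hs hk h
  refine (Run.seq (hi j k s ρ α hs.2 hk h) (c₂ := 6 + 1 + 73) fun s₁ ⟨h₁, h₁'⟩ => ?_)
  have hv := (h.same hk h₁').2 A hs.1 (i.eval ρ α)
  refine Run.ite (fun hne => ?_) (fun h0 => ?_)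
  · refine (Run.set (c := 69) _ _ ⟨?_, h₁'.set_right le_rfl _⟩ rfl).mono (by omega) fun _ h => h
    simp only [Expr.eval, Expr.eval_header, h₁] at hne
    rw [State.view, if_pos (by omega)] at hv
    rw [State.set_reg_self, eval, ← hv]
    simp only [Expr.eval, Expr.eval_cell, h₁]
    congr 1; ring
  · refine (Run.set (c := 2) _ _ ⟨?_, h₁'.set_right le_rfl _⟩ rfl).mono (by omega) fun _ h => h
    simp only [Expr.eval, Expr.eval_header, h₁] at h0
    rw [State.view, if_neg (by omega)] at hv
    rw [State.set_reg_self, eval, ← hv, Expr.eval]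

theorem correct_ite {c a b : Term} (hc : c.Correct) (ha : a.Correct) (hb : b.Correct) :
    (ite c a b).Correct := by
  intro j k s ρ α hs hk h
  rw [cost, add_assoc]
  refine (Run.seq (hc j k s ρ α hs.1 hk h) fun s₁ ⟨h₁, h₁'⟩ => ?_)
  have hr := h.same hk h₁'
  refine Run.ite (fun hne => ?_) (fun h0 => ?_)
  · simp only [Expr.eval, h₁] at hne
    refine (ha j k s₁ ρ α hs.2.1 hk hr).mono (by simp [hne]) fun s₂ ⟨k₁, k₂⟩ =>
      ⟨by simp [eval, hne, k₁], h₁'.trans hk k₂⟩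
  · simp only [Expr.eval, h₁] at h0
    refine (hb j k s₁ ρ α hs.2.2 hk hr).mono (by simp [h0]) fun s₂ ⟨k₁, k₂⟩ =>
      ⟨by simp [eval, h0, k₁], h₁'.trans hk k₂⟩

theorem correct_bind {x : ℕ} {a b : Term} (ha : a.Correct) (hb : b.Correct) :
    (bind x a b).Correct := by
  intro j k s ρ α ⟨hx, has, hbs⟩ hk h
  set v := a.eval ρ α with hv
  refine (Run.seq (ha j k s ρ α has hk h) (c₂ := 2 + (2 + (b.cost (Function.update ρ x v) α +
    (2 + 2)))) fun s₁ ⟨h₁, h₁'⟩ => ?_).mono (by simp only [cost, ← hv]; omega) fun _ h => h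
  have hr := h.same hk h₁'
  have hrx : s₁.reg x = s.reg x := h₁'.1 x (by omega)
  refine Run.seq (Run.set (Q := (· = s₁.set (k + 1) (s₁.reg x))) _ _ rfl rfl) ?_
  rintro _ rfl
  set s₂ := s₁.set (k + 1) (s₁.reg x) with hs₂
  have hs2 : Same j k s s₂ := h₁'.set_right (by omega) _
  refine Run.seq (Run.set (Q := (· = s₂.set x v)) _ _ ?_ rfl) ?_
  · simp [Expr.eval, hs₂, State.set_reg_ne, h₁, hv]
  rintro _ rfl
  refine Run.seq (hb j (k + 2) _ _ α hbs (by omega) ((h.same hk hs2).var hx v))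
    fun s₃ ⟨h₃, h₃'⟩ => ?_
  have hk1 : s₃.reg (k + 1) = s₂.reg x := by
    rw [h₃'.1 _ (by omega)]
    rw [State.set_reg_ne (by omega), hs₂, State.set_reg_self, State.set_reg_ne (by omega)]
  refine Run.seq (Run.set (Q := (· = s₃.set x (s₂.reg x))) _ _ (by simp [Expr.eval, hk1]) rfl) ?_
  rintro _ rfl
  refine Run.set _ _ ⟨?_, ?_⟩ rfl
  · simp only [Expr.eval, State.set_reg_self, eval, ← hv, ← h₃]
    rw [State.set_reg_ne (by omega)]
  · refine Same.set_right ?_ le_rfl _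
    refine hs2.trans hk ?_
    have := (h₃'.mono (j' := j) (k' := k) le_rfl (by omega)).set_both hx (s₂.reg x)
    rwa [State.set_set, State.set_eq_self rfl] at this

theorem correct_sum {x : ℕ} {N b : Term} (hN : N.Correct) (hb : b.Correct) :
    (sum x N b).Correct := by
  intro j k s ρ α ⟨hx, hNs, hbs⟩ hk h
  set n := N.eval ρ α with hn
  set f := fun i => b.eval (Function.update ρ x i) α with hf
  set c := fun i => b.cost (Function.update ρ x i) α with hc
  refine (Run.seq (hN j k s ρ α hNs hk h) (c₂ := 2 + (2 + (2 + (∑ i ∈ Finset.range n,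
    (c i + 8 + 3 + 1) + (3 + 1) + (2 + 2))))) fun s₁ ⟨h₁, h₁'⟩ => ?_).mono
    (by simp only [cost, ← hn, hc, add_assoc, Nat.reduceAdd]; omega) fun _ h => h
  refine Run.seq (Run.set (Q := (· = s₁.set (k + 1) (s₁.reg x))) _ _ rfl rfl) ?_
  rintro _ rfl
  set s₂ := s₁.set (k + 1) (s₁.reg x) with hs₂
  have hs2 : Same j k s s₂ := h₁'.set_right (by omega) _
  refine Run.seq (Run.set (Q := (· = s₂.set (k + 2) 0)) _ _ rfl rfl) ?_
  rintro _ rfl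
  set s₃ := s₂.set (k + 2) 0 with hs₃
  have hs3 : Same j k s s₃ := hs2.set_right (by omega) _
  have h3k : s₃.reg k = n := by
    rw [hs₃, State.set_reg_ne (by omega), hs₂, State.set_reg_ne (by omega), h₁]
  have h3x : s₃.reg x = s₃.reg (k + 1) := by
    rw [hs₃, State.set_reg_ne (by omega), State.set_reg_ne (by omega), hs₂, State.set_reg_ne
      (by omega), State.set_reg_self]
  refine Run.seq (Run.set (Q := (· = s₃.set x 0)) _ _ rfl rfl) ?_
  rintro _ rfl
  refine Run.seq (Run.loop (fun i s' => Same j (k + 2) (s₃.set x i) s' ∧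
    s'.reg (k + 2) = ∑ r ∈ Finset.range i, f r) (fun i => c i + 8) n ?_ ?_ ⟨Same.refl, ?_⟩) ?_
  · rintro i hi s' ⟨l₁, l₂⟩
    have hx' : s'.reg x = i := by rw [l₁.1 x (by omega), State.set_reg_self]
    have hk' : s'.reg k = n := by rw [l₁.1 k (by omega), State.set_reg_ne (by omega), h3k]
    refine ⟨by simp only [Expr.eval, hx', hk']; omega, ?_⟩
    have hrep : Rep j s' (Function.update ρ x i) α :=
      (((h.same hk hs3).var hx i).same (k := k) hk (l₁.mono le_rfl (by omega)))
    refine Run.seq (c₂ := 8) (hb j (k + 3) s' _ α hbs (by omega) hrep) fun s'' ⟨m₁, m₂⟩ => ?_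
    have hacc : s''.reg (k + 2) = ∑ r ∈ Finset.range i, f r := by rw [m₂.1 _ (by omega), l₂]
    have hsame : Same j (k + 2) (s₃.set x i) s'' := l₁.trans (by omega) (m₂.mono le_rfl (by omega))
    refine Run.seq (c₁ := 4) (c₂ := 4) (Run.set (Q := (· = s''.set (k + 2)
      (∑ r ∈ Finset.range (i + 1), f r))) _ _ ?_ rfl) ?_
    · simp only [Expr.eval, hacc, m₁, Finset.sum_range_succ]; rfl
    rintro _ rfl
    refine Run.set _ _ ⟨?_, ?_⟩ rfl
    · have := (hsame.set_right (i := k + 2) le_rfl (∑ r ∈ Finset.range (i + 1), f r)).set_both hx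
        (i + 1)
      rw [State.set_set] at this
      convert this using 2
      simp only [Expr.eval]
      rw [State.set_reg_ne (by omega), hsame.1 x (by omega), State.set_reg_self]
    · rw [State.set_reg_ne (by omega), State.set_reg_self]
  · rintro s' ⟨l₁, -⟩
    have hx' : s'.reg x = n := by rw [l₁.1 x (by omega), State.set_reg_self]
    have hk' : s'.reg k = n := by rw [l₁.1 k (by omega), State.set_reg_ne (by omega), h3k]
    simp [Expr.eval, hx', hk']
  · rw [State.set_reg_ne (by omega), hs₃, State.set_reg_self]; rfl
  · rintro s' ⟨l₁, l₂⟩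
    refine Run.seq (Run.set (Q := (· = s'.set x (s₃.reg x))) _ _ ?_ rfl) ?_
    · simp only [Expr.eval]
      rw [l₁.1 _ (by omega), State.set_reg_ne (by omega), h3x]
    rintro _ rfl
    refine Run.set _ _ ⟨?_, ?_⟩ rfl
    · simp only [Expr.eval, State.set_reg_self, eval]
      rw [State.set_reg_ne (by omega), l₂]
    · refine Same.set_right (hs3.trans hk ?_) le_rfl _
      have := (l₁.mono (j' := j) (k' := k) le_rfl (by omega)).set_both hx (s₃.reg x)
      rwa [State.set_set, State.set_eq_self rfl] at this

/-- Cell 0 holds the length, and cells beyond the length read as 0. Setting it to 0 thus empties a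
previously used array at once. It is raised only after the new entry is stored, so in round `i` the
term `f` sees array `A` as `build F i`. -/
theorem correct_arr {A x : ℕ} {N f b : Term} (hN : N.Correct) (hf : f.Correct) (hb : b.Correct) :
    (arr A x N f b).Correct := by
  rintro j k s ρ α ⟨rfl, hA, hx, hNs, hfs, hbs⟩ hk h
  set n := N.eval ρ α with hn
  set F := fun i g => f.eval (Function.update ρ x i) (Function.update α A g) with hF
  set c := fun i => f.cost (Function.update ρ x i) (Function.update α A (build F i)) with hc
  refine (Run.seq (hN A k s ρ α hNs hk h) (c₂ := 5 + (2 + (2 + (∑ i ∈ Finset.range n,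
    (c i + 86 + 3 + 1) + (3 + 1) + (2 + b.cost ρ (Function.update α A (build F n))))))) fun s₁
    ⟨h₁, h₁'⟩ => ?_).mono (by simp only [cost, ← hn, hc, hF, add_assoc, Nat.reduceAdd]; omega) fun _ h => h
  refine Run.seq (Run.put (Q := (· = s₁.put (s₁.reg 32 + A + 32 * 0) 0)) _ _ rfl rfl) ?_
  rintro _ rfl
  set s₂ := s₁.put (s₁.reg 32 + A + 32 * 0) 0 with hs₂
  have hs2 : Same A k s s₂ := h₁'.put_right hk le_rfl hA _
  refine Run.seq (Run.set (Q := (· = s₂.set (k + 1) (s₂.reg x))) _ _ rfl rfl) ?_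
  rintro _ rfl
  set s₃ := s₂.set (k + 1) (s₂.reg x) with hs₃
  have hs3 : Same A k s s₃ := hs2.set_right (by omega) _
  have h3k : s₃.reg k = n := by
    rw [hs₃, State.set_reg_ne (by omega), hs₂, State.put_reg, h₁]
  have h3x : s₃.reg x = s₃.reg (k + 1) := by
    rw [hs₃, State.set_reg_self, State.set_reg_ne (by omega)]
  refine Run.seq (Run.set (Q := (· = s₃.set x 0)) _ _ rfl rfl) ?_
  rintro _ rfl
  refine Run.seq (Run.loop (fun i s' => Same A (k + 2) (s₃.set x i) s' ∧
    s'.mem (s'.reg 32 + A) = i ∧ ∀ r < i, s'.mem (s'.reg 32 + A + 32 * (r + 1)) = build F i r)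
    (fun i => c i + 86) n ?_ ?_ ⟨Same.refl, ?_, by simp⟩) ?_
  · rintro i hi s' ⟨l₁, l₂, l₃⟩
    have hx' : s'.reg x = i := by rw [l₁.1 x (by omega), State.set_reg_self]
    have hk' : s'.reg k = n := by rw [l₁.1 k (by omega), State.set_reg_ne (by omega), h3k]
    refine ⟨by simp only [Expr.eval, hx', hk']; omega, ?_⟩
    have hrep₀ : Rep A s' (Function.update ρ x i) α :=
      (((h.same hk hs3).var hx i).same (k := k) hk (l₁.mono le_rfl (by omega)))
    have hrep : Rep (A + 1) s' (Function.update ρ x i) (Function.update α A (build F i)) := by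
      refine ⟨hrep₀.1, fun B hB r => ?_⟩
      by_cases hBA : B = A
      · subst hBA
        rw [Function.update_self, State.view, l₂]
        split_ifs with hr
        · exact l₃ r hr
        · rw [build_of_le _ (by omega)]
      · rw [Function.update_of_ne hBA, hrep₀.2 B (by omega)]
    refine Run.seq (c₂ := 86) (hf (A + 1) (k + 2) s' _ _ hfs (by omega) hrep) fun s'' ⟨m₁, m₂⟩ => ?_
    have hsame : Same A (k + 2) (s₃.set x i) s'' :=
      l₁.trans (by omega) (m₂.mono (by omega) (by omega))
    have hb'' : s''.reg 32 = s'.reg 32 := m₂.1 32 (by omega)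
    have hx'' : s''.reg x = i := by rw [m₂.1 x (by omega), hx']
    have hd := m₂.2 A (by omega)
    have hd0 := hd 0
    simp only [Nat.mul_zero, Nat.add_zero, l₂] at hd0
    set v := F i (build F i) with hv
    set a₁ := s''.reg 32 + A + 32 * (i + 1) with ha₁
    refine Run.seq (c₁ := 69) (c₂ := 4 + 5) (Run.put (Q := (· = s''.put a₁ v)) _ _ ?_ rfl) ?_ |>.mono
      (by omega) fun _ h => h
    · simp only [Expr.eval_cell, Expr.eval, hx'', m₁]
      rw [ha₁]
      congr 1
      ring
    rintro _ rfl
    refine Run.seq (Run.set (Q := (· = (s''.put a₁ v).set x (i + 1))) _ _ ?_ rfl) ?_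
    · simp [Expr.eval, hx'']
    rintro _ rfl
    have h32 : ((s''.put a₁ v).set x (i + 1)).reg 32 = s''.reg 32 := by
      rw [State.set_reg_ne (by omega), State.put_reg]
    refine Run.put _ _ ?_ rfl
    simp only [Expr.eval_header, Expr.eval, State.set_reg_self, h32]
    refine ⟨?_, ?_, ?_⟩
    · have := ((hsame.put_right (c := i + 1) (by omega) le_rfl hA v).set_both hx (i + 1)).put_right
        (c := 0) (by omega) le_rfl hA (i + 1)
      rw [State.set_set, ← ha₁, h32] at this
      exact this
    · simp only [State.put_reg, h32, State.put_mem_self]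
    · intro r hr
      simp only [State.put_reg, h32]
      rw [State.put_mem_ne (by omega), State.set_mem]
      by_cases hri : r = i
      · subst hri
        rw [State.put_mem_self, build, Function.update_self]
      · rw [State.put_mem_ne (by omega), build, Function.update_of_ne hri, ← l₃ r (by omega), hb'',
          hd (r + 1)]
  · rintro s' ⟨l₁, -⟩
    have hx' : s'.reg x = n := by rw [l₁.1 x (by omega), State.set_reg_self]
    have hk' : s'.reg k = n := by rw [l₁.1 k (by omega), State.set_reg_ne (by omega), h3k]
    simp [Expr.eval, hx', hk']
  · rw [State.set_reg_ne (by omega), hs₃, State.set_reg_ne (by omega), hs₂]; simp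
  · rintro s' ⟨l₁, l₂, l₃⟩
    refine Run.seq (Run.set (Q := (· = s'.set x (s₃.reg x))) _ _ ?_ rfl) ?_
    · simp only [Expr.eval]
      rw [l₁.1 _ (by omega), State.set_reg_ne (by omega), h3x]
    rintro _ rfl
    have hs4 : Same A k s (s'.set x (s₃.reg x)) := by
      refine hs3.trans hk ?_
      have := (l₁.mono (j' := A) (k' := k) le_rfl (by omega)).set_both hx (s₃.reg x)
      rwa [State.set_set, State.set_eq_self rfl] at this
    have hrep₀ := h.same hk hs4
    have hrep : Rep (A + 1) (s'.set x (s₃.reg x)) ρ (Function.update α A (build F n)) := by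
      refine ⟨hrep₀.1, fun B hB r => ?_⟩
      by_cases hBA : B = A
      · subst hBA
        have h32 : (s'.set x (s₃.reg x)).reg 32 = s'.reg 32 := State.set_reg_ne (by omega) _
        rw [Function.update_self, State.view, h32, State.set_mem, l₂]
        split_ifs with hr
        · exact l₃ r hr
        · rw [build_of_le _ (by omega)]
      · rw [Function.update_of_ne hBA, hrep₀.2 B (by omega)]
    refine (hb (A + 1) k _ _ _ hbs hk hrep).mono le_rfl fun s'' ⟨m₁, m₂⟩ => ⟨?_, ?_⟩
    · rw [m₁, eval]
    · exact hs4.trans hk (m₂.mono (by omega) le_rfl)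

theorem correct (e : Term) : e.Correct := by
  induction e with
  | num c => exact correct_num c
  | var x => exact correct_var x
  | add a b ha hb => exact correct_add ha hb
  | sub a b ha hb => exact correct_sub ha hb
  | quo a b ha hb => exact correct_quo ha hb
  | rem a b ha hb => exact correct_rem ha hb
  | get A i hi => exact correct_get A hi
  | ite c a b hc ha hb => exact correct_ite hc ha hb
  | bind x a b ha hb => exact correct_bind ha hb
  | sum x N b hN hb => exact correct_sum hN hb
  | arr A x N f b hN hf hb => exact correct_arr hN hf hb

end Term

end RAM

/-! ### The complete program, including the relocation of the input -/

namespace RAM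

/-- The program does not write to the memory. -/
def Prog.NoStore : Prog → Prop
  | .skip => True
  | .assign _ _ => True
  | .store _ _ => False
  | .seq p q => p.NoStore ∧ q.NoStore
  | .ite _ p q => p.NoStore ∧ q.NoStore
  | .loop _ p => p.NoStore

theorem Exec.mem_eq {p : Prog} {s s' : State} {T : ℕ} (h : Exec p s T s') (hp : p.NoStore) :
    s'.mem = s.mem := by
  induction h with
  | skip | assign | loopDone => rfl
  | store => exact hp.elim
  | seq _ _ ih₁ ih₂ => rw [ih₂ hp.2, ih₁ hp.1]
  | iteTrue _ _ ih => exact ih hp.1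
  | iteFalse _ _ ih => exact ih hp.2
  | loopStep _ _ _ ih₁ ih₂ => rw [ih₂ hp, ih₁ hp]

/-- The program that reads the first three input cells into the variables 0, 1, 2, computes the
length of the input by the term `L`, copies the input to array 0, and evaluates `e`. -/
def Term.prog (L e : Term) : Prog :=
  .seq (.assign 0 (.load (.const 0))) (.seq (.assign 1 (.load (.const 1)))
  (.seq (.assign 2 (.load (.const 2))) (.seq (L.comp 33) (.seq (.assign 32 (.reg 33))
  (.seq (.assign 33 (.const 0))
  (.seq (.loop (.sub (.reg 32) (.reg 33)) (.seq (.store (.cell 32 33) (.load (.reg 33)))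
    (.assign 33 (.add (.reg 33) (.const 1)))))
  (.seq (.store (.header 0) (.reg 32))
  (.seq (e.comp 33) (.assign 0 (.reg 33))))))))))

/-- The values of the variables at the start. -/
def startVars (l : List ℕ) : ℕ → ℕ :=
  Function.update (Function.update (Function.update (fun _ => 0) 0 (l.getD 0 0)) 1 (l.getD 1 0)) 2
    (l.getD 2 0)

/-- The arrays at the start. -/
def startArrays (l : List ℕ) : ℕ → ℕ → ℕ := fun _ => clip l.length fun i => l.getD i 0

/-- While `L` is evaluated, register 32 is still 0 and arrays would overlap the input. This does no
harm, because `L` reads no array (`Scoped 0`) and its program stores nothing. Afterwards the base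
address is the input length, so all arrays lie behind the input. -/
theorem Term.run_prog {L e : Term} (hL : L.Scoped 0) (hL' : (L.comp 33).NoStore)
    (he : e.Scoped 1) (l : List ℕ)
    (hlen : L.eval (startVars l) (fun _ _ => 0) = l.length) :
    Run (L.prog e) (initial l) (e.cost (startVars l) (startArrays l) +
      L.cost (startVars l) (fun _ _ => 0) + 78 * l.length + 40) fun s =>
        s.reg 0 = e.eval (startVars l) (startArrays l) := by
  set ρ := startVars l with hρ
  set s₀ := initial l
  refine (Run.seq (c₁ := 3) (Run.set (Q := (· = s₀.set 0 (l.getD 0 0))) _ _ rfl rfl)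
    (c₂ := 3 + (3 + (L.cost ρ (fun _ _ => 0) + (2 + (2 + (∑ i ∈ Finset.range l.length, (74 + 3 + 1) +
      (3 + 1) + (5 + (e.cost ρ (startArrays l) + 2)))))))) ?_).mono
    (by simp; omega) fun _ h => h
  rintro _ rfl
  refine Run.seq (Run.set (Q := (· = (s₀.set 0 (l.getD 0 0)).set 1 (l.getD 1 0))) _ _ rfl rfl) ?_
  rintro _ rfl
  refine Run.seq (Run.set (Q := (· = ((s₀.set 0 (l.getD 0 0)).set 1 (l.getD 1 0)).set 2
    (l.getD 2 0))) _ _ rfl rfl) ?_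
  rintro _ rfl
  set s₁ := ((s₀.set 0 (l.getD 0 0)).set 1 (l.getD 1 0)).set 2 (l.getD 2 0) with hs₁
  have hreg : ∀ x, s₁.reg x = ρ x := fun x => rfl
  have hmem : ∀ i, s₁.mem i = l.getD i 0 := fun x => rfl
  have hrep : Rep 0 s₁ ρ (fun _ _ => 0) := ⟨fun x _ => hreg x, fun A hA => by omega⟩
  obtain ⟨T, s₂, h₁, h₂, h₃, h₄⟩ := L.correct 0 33 s₁ ρ _ hL le_rfl hrep
  refine Run.seq (Q := (s₂ = ·)) ⟨T, s₂, h₁, h₂, rfl⟩ ?_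
  rintro _ rfl
  have hmem₂ : ∀ i, s₂.mem i = l.getD i 0 := fun i => by rw [h₁.mem_eq hL', hmem]
  have hreg₂ : ∀ x < 33, s₂.reg x = ρ x := fun x hx => by rw [h₄.1 x hx, hreg]
  rw [hlen] at h₃
  refine Run.seq (Run.set (Q := (· = s₂.set 32 l.length)) _ _ (by simp [Expr.eval, h₃]) rfl) ?_
  rintro _ rfl
  refine Run.seq (Run.set (Q := (· = (s₂.set 32 l.length).set 33 0)) _ _ rfl rfl) ?_
  rintro _ rfl
  refine Run.seq (Run.loop (fun i s => (∀ x < 32, s.reg x = ρ x) ∧ s.reg 32 = l.length ∧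
    s.reg 33 = i ∧ (∀ r < l.length, s.mem r = l.getD r 0) ∧
      ∀ r < i, s.mem (l.length + 32 * (r + 1)) = l.getD r 0) (fun _ => 74) l.length ?_ ?_ ?_) ?_
  · rintro i hi s ⟨k₁, k₂, k₃, k₄, k₅⟩
    refine ⟨by simp only [Expr.eval, k₂, k₃]; omega, ?_⟩
    refine Run.seq (c₁ := 70) (c₂ := 4) (Run.put (Q := (· = s.put (l.length + 32 * (i + 1))
      (l.getD i 0))) _ _ ?_ rfl) ?_
    · simp only [Expr.eval_cell, Expr.eval, k₂, k₃, k₄ i hi]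
      congr 1; ring
    rintro _ rfl
    refine Run.set _ _ ⟨fun x hx => ?_, ?_, ?_, fun r hr => ?_, fun r hr => ?_⟩ rfl
    · rw [State.set_reg_ne (by omega), State.put_reg, k₁ x hx]
    · rw [State.set_reg_ne (by omega), State.put_reg, k₂]
    · simp [Expr.eval, k₃]
    · rw [State.set_mem, State.put_mem_ne (by omega), k₄ r hr]
    · rw [State.set_mem]
      by_cases hri : r = i
      · rw [hri, State.put_mem_self]
      · rw [State.put_mem_ne (by omega), k₅ r (by omega)]
  · rintro s ⟨-, k₂, k₃, -⟩
    simp [Expr.eval, k₂, k₃]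
  · refine ⟨fun x hx => ?_, ?_, by simp, fun r _ => hmem₂ r, by simp⟩
    · rw [State.set_reg_ne (by omega), State.set_reg_ne (by omega), hreg₂ x (by omega)]
    · rw [State.set_reg_ne (by omega), State.set_reg_self]
  · rintro s ⟨k₁, k₂, -, -, k₅⟩
    refine Run.seq (Run.put (Q := (· = s.put l.length l.length)) _ _ ?_ rfl) ?_
    · simp [Expr.eval, k₂]
    rintro _ rfl
    have hrep' : Rep 1 (s.put l.length l.length) ρ (startArrays l) := by
      refine ⟨k₁, fun A hA i => ?_⟩
      obtain rfl : A = 0 := by omega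
      rw [State.view, State.put_reg, k₂, Nat.add_zero, State.put_mem_self, startArrays, clip]
      split_ifs with hi
      · rw [State.put_mem_ne (by omega), k₅ i hi]
      · rfl
    refine Run.seq (e.correct 1 33 _ ρ _ he le_rfl hrep') fun s' ⟨m₁, _⟩ => ?_
    exact Run.set _ _ (by simp [Expr.eval, m₁]) rfl

/-! ### Derived terms, evaluation and cost of loops -/

namespace Term

variable {ρ : ℕ → ℕ} {α : ℕ → ℕ → ℕ}

theorem cost_sum_le {x : ℕ} {N b : Term} {cN B n : ℕ} (hN : N.cost ρ α ≤ cN)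
    (hn : N.eval ρ α = n) (h : ∀ i < n, b.cost (Function.update ρ x i) α ≤ B) :
    (sum x N b).cost ρ α ≤ cN + n * (B + 12) + 14 := by
  rw [cost, hn]
  have : ∑ i ∈ Finset.range n, (b.cost (Function.update ρ x i) α + 12) ≤ n * (B + 12) := by
    refine (Finset.sum_le_card_nsmul _ _ (B + 12) fun i hi => ?_).trans (by simp)
    have := h i (Finset.mem_range.1 hi)
    omega
  omega

theorem eval_arr {A x : ℕ} {N f b : Term} {n : ℕ} {h : ℕ → ℕ} (hn : N.eval ρ α = n)
    (H : ∀ i < n, f.eval (Function.update ρ x i) (Function.update α A (clip i h)) = h i) :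
    (arr A x N f b).eval ρ α = b.eval ρ (Function.update α A (clip n h)) := by
  rw [eval, hn, build_eq_clip H]

theorem cost_arr_le {A x : ℕ} {N f b : Term} {n cN B cb : ℕ} {h : ℕ → ℕ} (hn : N.eval ρ α = n)
    (H : ∀ i < n, f.eval (Function.update ρ x i) (Function.update α A (clip i h)) = h i)
    (hN : N.cost ρ α ≤ cN)
    (hf : ∀ i < n, f.cost (Function.update ρ x i) (Function.update α A (clip i h)) ≤ B)
    (hb : b.cost ρ (Function.update α A (clip n h)) ≤ cb) :
    (arr A x N f b).cost ρ α ≤ cN + n * (B + 90) + cb + 20 := by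
  rw [cost, hn, build_eq_clip H]
  have : ∑ i ∈ Finset.range n, (f.cost (Function.update ρ x i) (Function.update α A
      (build (fun i g => f.eval (Function.update ρ x i) (Function.update α A g)) i)) + 90) ≤
      n * (B + 90) := by
    refine (Finset.sum_le_card_nsmul _ _ (B + 90) fun i hi => ?_).trans (by simp)
    have hi := Finset.mem_range.1 hi
    rw [build_eq_clip fun i' hi' => H i' (hi'.trans hi)]
    have := hf i hi
    omega
  omega

end Term

end RAM

/-! ### Stable matchings in terms of tallies and of the worst students of each type -/

/-- An instance in numbers: the positions in the preference lists (0 for unacceptable), the quotas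
and the capacities; moreover, a numbering of the types that occur. -/
structure NumInst where
  n : ℕ
  m : ℕ
  t : ℕ
  τ : ℕ → ℕ → ℕ
  rs : ℕ → ℕ → ℕ
  rc : ℕ → ℕ → ℕ
  lo : ℕ → ℕ → ℕ
  up : ℕ → ℕ → ℕ
  cp : ℕ → ℕ
  k : ℕ
  tid : ℕ → ℕ
  n_pos : 0 < n
  τ_le : ∀ u z, τ u z ≤ 1
  tid_lt : ∀ u < n, tid u < k
  tid_eq : ∀ u < n, ∀ v < n, tid u = tid v ↔ ∀ z < t, τ u z = τ v z

namespace NumInst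

variable (J : NumInst)

/-- The number of students that `f` assigns to `w`; `f u = w + 1` means that `u` is assigned to `w`,
and `f u = 0` that `u` is unassigned. -/
def size (f : ℕ → ℕ) (w : ℕ) : ℕ := ∑ u ∈ Finset.range J.n, if f u = w + 1 then 1 else 0

/-- The number of students with property `z` that `f` assigns to `w`. -/
def load (f : ℕ → ℕ) (w z : ℕ) : ℕ := ∑ u ∈ Finset.range J.n, if f u = w + 1 then J.τ u z else 0

/-- `N` and `S` respect all capacities and quotas. -/
def Feas (N : ℕ → ℕ) (S : ℕ → ℕ → ℕ) : Prop :=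
  ∀ w < J.m, N w ≤ J.cp w ∧ ∀ z < J.t, J.lo w z ≤ S w z ∧ S w z ≤ J.up w z

/-- Student `u` can be admitted to `w` when some students that `w` likes less are removed. -/
def Admits (f : ℕ → ℕ) (u w : ℕ) : Prop :=
  ∃ U : Finset ℕ, (∀ v ∈ U, v < J.n ∧ f v = w + 1 ∧ J.rc w u < J.rc w v) ∧
    J.size f w + 1 ≤ J.cp w + U.card ∧
    ∀ z < J.t, J.lo w z + ∑ v ∈ U, J.τ v z ≤ J.load f w z + J.τ u z ∧
      J.load f w z + J.τ u z ≤ J.up w z + ∑ v ∈ U, J.τ v z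

/-- `f` is a feasible and stable matching. -/
structure Stable (f : ℕ → ℕ) : Prop where
  le : ∀ u < J.n, f u ≤ J.m
  acc : ∀ u < J.n, ∀ w < J.m, f u = w + 1 → J.rs u w ≠ 0
  feas : J.Feas (J.size f) (J.load f)
  stable : ∀ u < J.n, ∀ w < J.m, J.rs u w ≠ 0 →
    (∀ w' < J.m, f u = w' + 1 → J.rs u w < J.rs u w') → ¬ J.Admits f u w

/-- There is a student of type `j` at `w`, and `d w j` is the worst one. -/
def Valid (N : ℕ → ℕ) (d : ℕ → ℕ → ℕ) (w j : ℕ) : Prop := N w ≠ 0 ∧ J.tid (d w j) = j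

/-- Admitting `u` to `w` would violate the upper quota `i`, or the capacity in the case `i = t`. -/
def Need (N : ℕ → ℕ) (S : ℕ → ℕ → ℕ) (u w i : ℕ) : Prop :=
  if i < J.t then J.up w i < S w i + J.τ u i else J.cp w < N w + 1

/-- Student `u` fits to `w` if, for each violated upper bound `i`, the worst student of type `b i`
is removed. -/
def Fits (N : ℕ → ℕ) (S d : ℕ → ℕ → ℕ) (u w : ℕ) (b : ℕ → ℕ) : Prop :=
  (∀ i < J.t + 1, J.Need N S u w i → J.Valid N d w (b i) ∧ J.rc w u < J.rc w (d w (b i)) ∧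
    (i < J.t → J.τ (d w (b i)) i ≠ 0)) ∧
  ∀ z < J.t, (∑ j ∈ Finset.range J.k,
    open Classical in if ∃ i < J.t + 1, J.Need N S u w i ∧ b i = j then J.τ (d w j) z else 0) +
      J.lo w z ≤ S w z + J.τ u z

/-- `w` would admit `u`. -/
def Blk (N : ℕ → ℕ) (S d : ℕ → ℕ → ℕ) (u w : ℕ) : Prop :=
  J.rs u w ≠ 0 ∧ ∃ b : ℕ → ℕ, (∀ i < J.t + 1, b i < J.k) ∧ J.Fits N S d u w b

/-- Student `u` may be assigned to the option `o`. -/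
def Opt (N : ℕ → ℕ) (S d : ℕ → ℕ → ℕ) (u o : ℕ) : Prop :=
  (∀ w < J.m, ∀ j < J.k, J.Valid N d w j → d w j = u → w + 1 = o) ∧
  (∀ w < J.m, J.Blk N S d u w → o ≠ 0 ∧ ¬ J.rs u w < J.rs u (o - 1)) ∧
  (o ≠ 0 → J.rs u (o - 1) ≠ 0 ∧ J.Valid N d (o - 1) (J.tid u) ∧
    J.rc (o - 1) u ≤ J.rc (o - 1) (d (o - 1) (J.tid u)))

variable {J}
variable {f N : ℕ → ℕ} {S d : ℕ → ℕ → ℕ}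

/-- The last two hypotheses say that `d` records the worst student of each type present. Each upper
bound is exceeded by at most one, so one removal per exceeded bound is enough; and a removed student
may be exchanged for the worst one of the same type, which has the same type vector and is at least
as bad for `w`. -/
theorem blk_iff (hd : ∀ w < J.m, ∀ j < J.k, d w j < J.n)
    (hN : ∀ w < J.m, N w = J.size f w) (hS : ∀ w < J.m, ∀ z < J.t, S w z = J.load f w z)
    (hF : J.Feas N S)
    (h₁ : ∀ w < J.m, ∀ j < J.k, J.Valid N d w j → f (d w j) = w + 1)
    (h₂ : ∀ u < J.n, ∀ w < J.m, f u = w + 1 → J.Valid N d w (J.tid u) ∧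
      J.rc w u ≤ J.rc w (d w (J.tid u)))
    {u w : ℕ} (hw : w < J.m) :
    J.Blk N S d u w ↔ J.rs u w ≠ 0 ∧ J.Admits f u w := by
  classical
  refine and_congr_right fun _ => ⟨?_, ?_⟩
  · rintro ⟨b, hb, hb₁, hb₂⟩
    set I := (Finset.range (J.t + 1)).filter fun i => J.Need N S u w i with hI
    have hIm : ∀ i, i ∈ I ↔ i < J.t + 1 ∧ J.Need N S u w i := fun i => by simp [hI]
    set X := I.image b with hX
    -- Validity puts `d w j` into type `j`, so different types have different worst students and
    -- sums over types are sums over removed students.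
    have hinj : Set.InjOn (d w) X := by
      intro j hj j' hj' h
      simp only [hX, Finset.coe_image, Set.mem_image, Finset.mem_coe, hIm] at hj hj'
      obtain ⟨i, ⟨hi, hi'⟩, rfl⟩ := hj
      obtain ⟨i', ⟨hi₁, hi₁'⟩, rfl⟩ := hj'
      rw [← (hb₁ i hi hi').1.2, h, (hb₁ i' hi₁ hi₁').1.2]
    have hsum : ∀ z, ∑ v ∈ X.image (d w), J.τ v z = ∑ j ∈ Finset.range J.k,
        if ∃ i < J.t + 1, J.Need N S u w i ∧ b i = j then J.τ (d w j) z else 0 := by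
      intro z
      rw [Finset.sum_image hinj, ← Finset.sum_filter]
      refine Finset.sum_congr ?_ fun _ _ => rfl
      ext j
      simp only [hX, Finset.mem_image, hIm, Finset.mem_filter, Finset.mem_range]
      constructor
      · rintro ⟨i, ⟨hi, hi'⟩, rfl⟩
        exact ⟨hb i hi, i, hi, hi', rfl⟩
      · rintro ⟨-, i, hi, hi', rfl⟩
        exact ⟨i, ⟨hi, hi'⟩, rfl⟩
    refine ⟨X.image (d w), ?_, ?_, fun z hz => ⟨?_, ?_⟩⟩
    · intro v hv
      simp only [hX, Finset.mem_image, hIm] at hv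
      obtain ⟨_, ⟨i, ⟨hi, hi'⟩, rfl⟩, rfl⟩ := hv
      exact ⟨hd w hw _ (hb i hi), h₁ w hw _ (hb i hi) (hb₁ i hi hi').1, (hb₁ i hi hi').2.1⟩
    -- Before the admission the capacity is respected, so a single removal repairs it; the removed
    -- set is nonempty exactly because the bound with index `t` was exceeded.
    · rw [← hN w hw, Finset.card_image_of_injOn hinj]
      have hcap := (hF w hw).1
      by_cases hneed : J.Need N S u w J.t
      · have : 0 < X.card := Finset.card_pos.2 ⟨b J.t, Finset.mem_image_of_mem _
          ((hIm _).2 ⟨by omega, hneed⟩)⟩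
        omega
      · simp only [Need, lt_irrefl, if_false] at hneed
        omega
    · rw [hsum, ← hS w hw z hz]
      have := hb₂ z hz
      omega
    · rw [hsum, ← hS w hw z hz]
      by_cases hneed : J.Need N S u w z
      · obtain ⟨h3, -, h5⟩ := hb₁ z (by omega) hneed
        have h6 : J.τ (d w (b z)) z ≤ ∑ j ∈ Finset.range J.k,
            if ∃ i < J.t + 1, J.Need N S u w i ∧ b i = j then J.τ (d w j) z else 0 := by
          refine le_trans ?_ (Finset.single_le_sum (fun _ _ => Nat.zero_le _)
            (Finset.mem_range.2 (hb z (by omega))))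
          rw [if_pos ⟨z, by omega, hneed, rfl⟩]
        have := h5 hz
        have := ((hF w hw).2 z hz).2
        have := J.τ_le u z
        omega
      · simp only [Need, hz, if_true] at hneed
        omega
  · rintro ⟨U, hU, hU₁, hU₂⟩
    have key : ∀ i, ∃ j, j < J.k ∧ (i < J.t + 1 → J.Need N S u w i →
        ∃ v ∈ U, J.tid v = j ∧ (i < J.t → J.τ v i ≠ 0)) := by
      intro i
      by_cases hi : i < J.t + 1 ∧ J.Need N S u w i
      · have : ∃ v ∈ U, i < J.t → J.τ v i ≠ 0 := by
          by_cases hit : i < J.t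
          · have hn := hi.2
            simp only [Need, hit, if_true] at hn
            have := (hU₂ i hit).2
            rw [← hS w hw i hit] at this
            have hpos : ∑ v ∈ U, J.τ v i ≠ 0 := by omega
            obtain ⟨v, hv, hv'⟩ := Finset.exists_ne_zero_of_sum_ne_zero hpos
            exact ⟨v, hv, fun _ => hv'⟩
          · have hn := hi.2
            simp only [Need, hit, if_false] at hn
            rw [hN w hw] at hn
            obtain ⟨v, hv⟩ : U.Nonempty := Finset.card_pos.1 (by omega)
            exact ⟨v, hv, fun h => absurd h hit⟩
        obtain ⟨v, hv, hv'⟩ := this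
        exact ⟨J.tid v, J.tid_lt v (hU v hv).1, fun _ _ => ⟨v, hv, rfl, hv'⟩⟩
      · exact ⟨J.tid 0, J.tid_lt 0 J.n_pos, fun h h' => absurd ⟨h, h'⟩ hi⟩
    choose b hb hb' using key
    have hval : ∀ v ∈ U, J.Valid N d w (J.tid v) ∧ J.rc w u < J.rc w (d w (J.tid v)) ∧
        ∀ z < J.t, J.τ (d w (J.tid v)) z = J.τ v z := by
      intro v hv
      obtain ⟨h3, h4, h5⟩ := hU v hv
      obtain ⟨h6, h7⟩ := h₂ v h3 w hw h4
      exact ⟨h6, h5.trans_le h7,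
        (J.tid_eq _ (hd w hw _ (J.tid_lt v h3)) v h3).1 h6.2⟩
    refine ⟨b, fun i _ => hb i, fun i hi hi' => ?_, fun z hz => ?_⟩
    · obtain ⟨v, hv, hv', hv''⟩ := hb' i hi hi'
      rw [← hv']
      obtain ⟨h3, h4, h5⟩ := hval v hv
      exact ⟨h3, h4, fun hit => by rw [h5 i hit]; exact hv'' hit⟩
    -- Every chosen type is the type of some member of `U`, and each type counts once on the left.
    -- Splitting `U` by type shows that the worst students contribute no more than `U` itself, so
    -- the lower quotas survive.
    · have hle : (∑ j ∈ Finset.range J.k,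
          if ∃ i < J.t + 1, J.Need N S u w i ∧ b i = j then J.τ (d w j) z else 0) ≤
          ∑ v ∈ U, J.τ v z := by
        calc _ ≤ ∑ j ∈ Finset.range J.k, ∑ v ∈ U.filter (fun v => J.tid v = j), J.τ v z := by
              refine Finset.sum_le_sum fun j _ => ?_
              split_ifs with h
              · obtain ⟨i, hi, hi', rfl⟩ := h
                obtain ⟨v, hv, hv', -⟩ := hb' i hi hi'
                rw [← hv', (hval v hv).2.2 z hz]
                exact Finset.single_le_sum (f := fun v => J.τ v z) (fun _ _ => Nat.zero_le _)
                  (Finset.mem_filter.2 ⟨hv, rfl⟩)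
              · exact Nat.zero_le _
          _ = ∑ v ∈ U, J.τ v z := Finset.sum_fiberwise_of_maps_to
              (fun v hv => Finset.mem_range.2 (J.tid_lt v (hU v hv).1)) _
      have := (hU₂ z hz).1
      rw [← hS w hw z hz] at this
      omega

/-- The first condition of `Opt` places each recorded worst student at the right college, and the
third makes it a worst one. With these, `blk_iff` applies, and the second condition is precisely the
absence of blocking pairs. -/
theorem stable_of_opt (hd : ∀ w < J.m, ∀ j < J.k, d w j < J.n)
    (hN : ∀ w < J.m, N w = J.size f w) (hS : ∀ w < J.m, ∀ z < J.t, S w z = J.load f w z)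
    (hF : J.Feas N S) (hle : ∀ u < J.n, f u ≤ J.m) (hopt : ∀ u < J.n, J.Opt N S d u (f u)) :
    J.Stable f := by
  have h₁ : ∀ w < J.m, ∀ j < J.k, J.Valid N d w j → f (d w j) = w + 1 := fun w hw j hj hv =>
    ((hopt _ (hd w hw j hj)).1 w hw j hj hv rfl).symm
  have h₂ : ∀ u < J.n, ∀ w < J.m, f u = w + 1 → J.Valid N d w (J.tid u) ∧
      J.rc w u ≤ J.rc w (d w (J.tid u)) := by
    intro u hu w _ hf
    have := ((hopt u hu).2.2 (by omega)).2
    rwa [hf, Nat.add_sub_cancel] at this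
  refine ⟨hle, fun u hu w _ hf => ?_, fun w hw => ?_, fun u hu w hw ha hp hA => ?_⟩
  · have := ((hopt u hu).2.2 (by omega)).1
    rwa [hf, Nat.add_sub_cancel] at this
  · rw [← hN w hw]
    exact ⟨(hF w hw).1, fun z hz => by rw [← hS w hw z hz]; exact (hF w hw).2 z hz⟩
  · have := (hopt u hu).2.1 w hw ((blk_iff hd hN hS hF h₁ h₂ hw).2 ⟨ha, hA⟩)
    obtain ⟨w', hw'⟩ := Nat.exists_eq_succ_of_ne_zero this.1
    have hlt := hle u hu
    have h3 := this.2
    rw [hw'] at h3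
    exact h3 (hp w' (by omega) hw')

theorem size_pos_iff {w : ℕ} : J.size f w ≠ 0 ↔ ∃ u < J.n, f u = w + 1 := by
  rw [size, Ne, Finset.sum_eq_zero_iff]
  simp

/-- If `w` has students but none of type `j`, any of its students can be stored as `d w j`: having
another type, it makes `Valid` fail. So absence needs no extra digit. The freedom in `d'`, `N` and
`S` is needed because decoding a guess returns the data only for indices in range. -/
theorem exists_opt (h : J.Stable f) : ∃ d : ℕ → ℕ → ℕ, (∀ w j, d w j < J.n) ∧
    ∀ d' : ℕ → ℕ → ℕ, (∀ w < J.m, ∀ j < J.k, d' w j = d w j) →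
    ∀ N S, (∀ w < J.m, N w = J.size f w) → (∀ w < J.m, ∀ z < J.t, S w z = J.load f w z) →
      ∀ u < J.n, J.Opt N S d' u (f u) := by
  classical
  have key : ∀ w j, ∃ v, v < J.n ∧
      ((∃ u < J.n, f u = w + 1 ∧ J.tid u = j) → f v = w + 1 ∧ J.tid v = j ∧
        ∀ u < J.n, f u = w + 1 → J.tid u = j → J.rc w u ≤ J.rc w v) ∧
      (J.size f w ≠ 0 → J.tid v = j → ∃ u < J.n, f u = w + 1 ∧ J.tid u = j) := by
    intro w j
    by_cases hex : ∃ u < J.n, f u = w + 1 ∧ J.tid u = j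
    · obtain ⟨u, hu, hu', hu''⟩ := hex
      obtain ⟨v, hv, hmax⟩ := Finset.exists_max_image
        ((Finset.range J.n).filter fun u => f u = w + 1 ∧ J.tid u = j) (J.rc w)
        ⟨u, by simp [hu, hu', hu'']⟩
      simp only [Finset.mem_filter, Finset.mem_range] at hv hmax
      exact ⟨v, hv.1, fun _ => ⟨hv.2.1, hv.2.2, fun u' h1 h2 h3 => hmax u' ⟨h1, h2, h3⟩⟩,
        fun _ _ => ⟨u, hu, hu', hu''⟩⟩
    · by_cases hs : J.size f w = 0
      -- At an empty college there may be no student of another type at all, for example when only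
      -- one type occurs. The condition `N w ≠ 0` in `Valid` covers this case, so student 0 is an
      -- admissible entry.
      · exact ⟨0, J.n_pos, fun h => absurd h hex, fun h => absurd hs h⟩
      · obtain ⟨v, hv, hv'⟩ := size_pos_iff.1 hs
        exact ⟨v, hv, fun h => absurd h hex, fun _ h => ⟨v, hv, hv', h⟩⟩
  choose d hd hd₁ hd₂ using key
  refine ⟨d, hd, fun d' hdd N S hN hS => ?_⟩
  have h₁ : ∀ w < J.m, ∀ j < J.k, J.Valid N d' w j → f (d' w j) = w + 1 := fun w hw j hj hv => by
    rw [Valid, hdd w hw j hj, hN w hw] at hv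
    rw [hdd w hw j hj]
    exact (hd₁ w j (hd₂ w j hv.1 hv.2)).1
  have h₂ : ∀ u < J.n, ∀ w < J.m, f u = w + 1 → J.Valid N d' w (J.tid u) ∧
      J.rc w u ≤ J.rc w (d' w (J.tid u)) := by
    intro u hu w hw hf
    obtain ⟨-, h4, h5⟩ := hd₁ w (J.tid u) ⟨u, hu, hf, rfl⟩
    rw [Valid, hdd w hw _ (J.tid_lt u hu)]
    exact ⟨⟨by rw [hN w hw]; exact size_pos_iff.2 ⟨u, hu, hf⟩, h4⟩, h5 u hu hf rfl⟩
  have hF : J.Feas N S := fun w hw => by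
    rw [hN w hw]
    exact ⟨(h.feas w hw).1, fun z hz => by rw [hS w hw z hz]; exact (h.feas w hw).2 z hz⟩
  intro u hu
  refine ⟨fun w hw j hj hv hdu => ?_, fun w hw hb => ?_, fun ho => ?_⟩
  · rw [← hdu, h₁ w hw j hj hv]
  · obtain ⟨ha, hA⟩ := (blk_iff (fun w hw j hj => by rw [hdd w hw j hj]; exact hd w j) hN hS hF h₁ h₂ hw).1 hb
    by_contra hcon
    refine h.stable u hu w hw ha (fun w' _ hf => ?_) hA
    by_contra hlt
    exact hcon ⟨by omega, by rwa [hf, Nat.add_sub_cancel]⟩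
  · obtain ⟨w, hw⟩ := Nat.exists_eq_succ_of_ne_zero ho
    have hwm : w < J.m := by have := h.le u hu; omega
    rw [hw, Nat.succ_eq_add_one, Nat.add_sub_cancel]
    exact ⟨h.acc u hu w hwm hw, h₂ u hu w hwm hw⟩

end NumInst

/-! ### Digits -/

theorem sum_digits_lt {b D : ℕ} {x : ℕ → ℕ} (hx : ∀ i < D, x i < b) :
    ∑ i ∈ Finset.range D, x i * b ^ i < b ^ D := by
  induction D with
  | zero => simp
  | succ D ih =>
    rw [Finset.sum_range_succ, pow_succ]
    have h₁ := ih fun i hi => hx i (by omega)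
    have h₂ : (x D + 1) * b ^ D ≤ b * b ^ D := Nat.mul_le_mul_right _ (hx D (by omega))
    rw [add_mul] at h₂
    linarith

/-- Peel off the top summand: below the top position it is a multiple of `b ^ (i + 1)` and
disappears modulo `b` after the division; at the top position the remaining sum is too small to
matter. -/
theorem digit_sum_digits {b D : ℕ} {x : ℕ → ℕ} (hx : ∀ i < D, x i < b) {i : ℕ} (hi : i < D) :
    (∑ i ∈ Finset.range D, x i * b ^ i) / b ^ i % b = x i := by
  have hb : 0 < b := (Nat.zero_le _).trans_lt (hx i hi)
  induction D with
  | zero => omega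
  | succ D ih =>
    rw [Finset.sum_range_succ]
    rcases Nat.lt_succ_iff_lt_or_eq.1 hi with h | rfl
    · obtain ⟨r, rfl⟩ := Nat.exists_eq_add_of_lt h
      have : x (i + r + 1) * b ^ (i + r + 1) = b ^ i * (b * (x (i + r + 1) * b ^ r)) := by ring
      rw [this, Nat.add_mul_div_left _ _ (pow_pos hb _), Nat.add_mul_mod_self_left]
      exact ih (fun i hi => hx i (by omega)) h
    · rw [Nat.add_mul_div_right _ _ (pow_pos hb _),
        Nat.div_eq_of_lt (sum_digits_lt fun i hi => hx i (by omega)), zero_add,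
        Nat.mod_eq_of_lt (hx i (by omega))]

theorem sum_range_mul (g : ℕ → ℕ) (a b : ℕ) :
    ∑ i ∈ Finset.range (a * b), g i =
      ∑ r ∈ Finset.range a, ∑ s ∈ Finset.range b, g (r * b + s) := by
  induction a with
  | zero => simp
  | succ a ih => rw [Nat.succ_mul, Finset.sum_range_add, ih, Finset.sum_range_succ]

theorem mul_add_lt_mul {r s a b : ℕ} (hr : r < a) (hs : s < b) : r * b + s < a * b := by
  have : (r + 1) * b ≤ a * b := Nat.mul_le_mul_right _ hr
  rw [add_mul] at this
  omega

theorem mul_add_div_eq {r s b : ℕ} (hs : s < b) : (r * b + s) / b = r := by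
  rw [mul_comm, Nat.mul_add_div (by omega), Nat.div_eq_of_lt hs, add_zero]

theorem mul_add_mod_eq {r s b : ℕ} (hs : s < b) : (r * b + s) % b = s := by
  rw [mul_comm, Nat.mul_add_mod, Nat.mod_eq_of_lt hs]

/-! ### Guesses as numbers, and the dynamic program -/

namespace NumInst

variable (J : NumInst)

/-- The number of digits of a guess of sizes and loads. -/
def numT : ℕ := J.m + J.m * J.t

/-- The number of students with property `z`. -/
def total (z : ℕ) : ℕ := ∑ u ∈ Finset.range J.n, J.τ u z

/-- The worst students, read off from a number. -/
def worst (cW w j : ℕ) : ℕ := cW / J.n ^ (w * J.k + j) % J.n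

/-- The sizes: read off from a number, or all students are at `a - 1`. -/
def sizeOf (cT a w : ℕ) : ℕ :=
  if a = 0 then cT / J.n ^ w % J.n else if w + 1 = a then J.n else 0

/-- The loads: read off from a number, or all students are at `a - 1`. -/
def loadOf (cT a w z : ℕ) : ℕ :=
  if a = 0 then cT / J.n ^ (J.m + (w * J.t + z)) % J.n else if w + 1 = a then J.total z else 0

/-- The contribution of student `u` with option `o` to the number encoding sizes and loads. -/
def wt (u o : ℕ) : ℕ :=
  if o = 0 then 0
  else J.n ^ (o - 1) + ∑ z ∈ Finset.range J.t, J.τ u z * J.n ^ (J.m + ((o - 1) * J.t + z))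

/-- There are assignments of allowed options to the first `u` students with total weight `s`. -/
def Reach (P : ℕ → ℕ → Prop) (u s : ℕ) : Prop :=
  ∃ f : ℕ → ℕ, (∀ v < u, f v ≤ J.m ∧ P v (f v)) ∧ ∑ v ∈ Finset.range u, J.wt v (f v) = s

/-- The test performed for a guess. -/
def Accepts (cW cT a : ℕ) : Prop :=
  J.Feas (J.sizeOf cT a) (J.loadOf cT a) ∧
    if a = 0 then J.Reach (J.Opt (J.sizeOf cT a) (J.loadOf cT a) (J.worst cW)) J.n cT
    else ∀ u < J.n, J.Opt (J.sizeOf cT a) (J.loadOf cT a) (J.worst cW) u a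

variable {J} {f : ℕ → ℕ}

/-- Exchanging the two summations collects, at each power of `n`, one size or one load. The
coefficients may still be as large as `n`; they are digits only under the extra hypothesis of
`decode`. -/
theorem sum_wt (hf : ∀ u < J.n, f u ≤ J.m) : ∑ u ∈ Finset.range J.n, J.wt u (f u) =
    ∑ i ∈ Finset.range J.numT, (if i < J.m then J.size f i
      else J.load f ((i - J.m) / J.t) ((i - J.m) % J.t)) * J.n ^ i := by
  have h₁ : ∀ u ∈ Finset.range J.n, J.wt u (f u) = ∑ w ∈ Finset.range J.m, if f u = w + 1 then
      J.n ^ w + ∑ z ∈ Finset.range J.t, J.τ u z * J.n ^ (J.m + (w * J.t + z)) else 0 := by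
    intro u hu
    have hu' := hf u (Finset.mem_range.1 hu)
    rcases Nat.eq_zero_or_pos (f u) with h | h
    · rw [wt, if_pos h]
      exact (Finset.sum_eq_zero fun w _ => if_neg (by omega)).symm
    · rw [wt, if_neg (by omega)]
      symm
      rw [Finset.sum_eq_single (f u - 1)]
      · rw [if_pos (by omega)]
      · exact fun w _ hw => if_neg (by omega)
      · exact fun hw => absurd (Finset.mem_range.2 (by omega)) hw
  rw [Finset.sum_congr rfl h₁, Finset.sum_comm, numT, Finset.sum_range_add, sum_range_mul,
    ← Finset.sum_add_distrib]
  refine Finset.sum_congr rfl fun w hw => ?_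
  rw [if_pos (Finset.mem_range.1 hw), size, Finset.sum_mul]
  have h₂ : ∀ z ∈ Finset.range J.t, (if J.m + (w * J.t + z) < J.m then
      J.size f (J.m + (w * J.t + z)) else J.load f ((J.m + (w * J.t + z) - J.m) / J.t)
        ((J.m + (w * J.t + z) - J.m) % J.t)) * J.n ^ (J.m + (w * J.t + z)) =
      ∑ u ∈ Finset.range J.n, if f u = w + 1 then J.τ u z * J.n ^ (J.m + (w * J.t + z)) else 0 := by
    intro z hz
    have hz := Finset.mem_range.1 hz
    rw [if_neg (by omega), Nat.add_sub_cancel_left, mul_add_div_eq hz, mul_add_mod_eq hz, load,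
      Finset.sum_mul]
    exact Finset.sum_congr rfl fun u _ => by split_ifs <;> simp
  rw [Finset.sum_congr rfl h₂, Finset.sum_comm, ← Finset.sum_add_distrib]
  refine Finset.sum_congr rfl fun u _ => ?_
  split_ifs
  · simp
  · simp

theorem load_le_size (w z : ℕ) : J.load f w z ≤ J.size f w :=
  Finset.sum_le_sum fun u _ => by split_ifs; exacts [J.τ_le u z, le_rfl]

theorem size_le (w : ℕ) : J.size f w ≤ J.n := by
  refine (Finset.sum_le_card_nsmul _ _ 1 fun u _ => ?_).trans (by simp)
  split_ifs <;> omega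

theorem eq_of_size_eq {w : ℕ} (h : J.size f w = J.n) : ∀ u < J.n, f u = w + 1 := by
  intro u hu
  by_contra hne
  have : J.size f w < ∑ u ∈ Finset.range J.n, 1 :=
    Finset.sum_lt_sum (fun u _ => by split_ifs <;> omega)
      ⟨u, Finset.mem_range.2 hu, by rw [if_neg hne]; omega⟩
  simp [h] at this

theorem size_of_eq {w : ℕ} (h : ∀ u < J.n, f u = w + 1) (w' : ℕ) :
    J.size f w' = if w' = w then J.n else 0 := by
  rw [size, Finset.sum_congr rfl fun u hu => by rw [h u (Finset.mem_range.1 hu)]]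
  by_cases hw : w' = w
  · simp [hw]
  · simp [hw, Ne.symm hw]

theorem load_of_eq {w : ℕ} (h : ∀ u < J.n, f u = w + 1) (w' z : ℕ) :
    J.load f w' z = if w' = w then J.total z else 0 := by
  rw [load, Finset.sum_congr rfl fun u hu => by rw [h u (Finset.mem_range.1 hu)]]
  by_cases hw : w' = w
  · simp [hw, total]
  · simp [hw, Ne.symm hw]

/-- If no college has all students, all sizes are below `n`, and loads are at most sizes. So no
carries occur and the tallies are the digits. -/
theorem decode (hf : ∀ u < J.n, f u ≤ J.m) (hs : ∀ w < J.m, J.size f w < J.n) :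
    ∑ u ∈ Finset.range J.n, J.wt u (f u) < J.n ^ J.numT ∧
    (∀ w < J.m, J.sizeOf (∑ u ∈ Finset.range J.n, J.wt u (f u)) 0 w = J.size f w) ∧
    ∀ w < J.m, ∀ z < J.t,
      J.loadOf (∑ u ∈ Finset.range J.n, J.wt u (f u)) 0 w z = J.load f w z := by
  rw [sum_wt hf]
  set x := fun i => if i < J.m then J.size f i else J.load f ((i - J.m) / J.t) ((i - J.m) % J.t)
    with hx
  have hlt : ∀ i < J.numT, x i < J.n := by
    intro i hi
    simp only [hx]
    split_ifs with h
    · exact hs i h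
    · refine (load_le_size _ _).trans_lt (hs _ ?_)
      rw [numT] at hi
      exact Nat.div_lt_of_lt_mul (by rw [mul_comm]; omega)
  refine ⟨sum_digits_lt hlt, fun w hw => ?_, fun w hw z hz => ?_⟩
  · rw [sizeOf, if_pos rfl, digit_sum_digits hlt (by rw [numT]; omega)]
    simp [hx, hw]
  · have := mul_add_lt_mul hw hz
    rw [loadOf, if_pos rfl, digit_sum_digits hlt (by rw [numT]; omega)]
    simp [hx, mul_add_div_eq hz, mul_add_mod_eq hz]

/-- The value `a = 0` stands for tallies coded by `cT`; `a = w + 1` stands for the matching with all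
students at `w`, whose size `n` is not a digit in base `n`. -/
theorem exists_stable_iff : (∃ f, J.Stable f) ↔
    ∃ cW < J.n ^ (J.m * J.k), ∃ cT < J.n ^ J.numT, ∃ a < J.m + 1, J.Accepts cW cT a := by
  have hn := J.n_pos
  have hd : ∀ cW, ∀ w < J.m, ∀ j < J.k, J.worst cW w j < J.n := fun cW w _ j _ => Nat.mod_lt _ hn
  constructor
  · rintro ⟨f, hf⟩
    obtain ⟨d, hdn, hd'⟩ := exists_opt hf
    have hlt : ∀ i < J.m * J.k, (fun i => d (i / J.k) (i % J.k)) i < J.n := fun i _ => hdn _ _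
    set cW := ∑ i ∈ Finset.range (J.m * J.k), (fun i => d (i / J.k) (i % J.k)) i * J.n ^ i with hcW
    have hW : ∀ w < J.m, ∀ j < J.k, J.worst cW w j = d w j := by
      intro w hw j hj
      rw [worst, hcW, digit_sum_digits hlt (mul_add_lt_mul hw hj)]
      simp only [mul_add_div_eq hj, mul_add_mod_eq hj]
    have hopt := hd' _ hW
    refine ⟨cW, sum_digits_lt hlt, ?_⟩
    by_cases hall : ∃ w < J.m, J.size f w = J.n
    · obtain ⟨w₀, hw₀, hs⟩ := hall
      have hf' := eq_of_size_eq hs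
      have hN : ∀ w < J.m, J.sizeOf 0 (w₀ + 1) w = J.size f w := by
        intro w _
        simp [sizeOf, size_of_eq hf']
      have hS : ∀ w < J.m, ∀ z < J.t, J.loadOf 0 (w₀ + 1) w z = J.load f w z := by
        intro w _ z _
        simp [loadOf, load_of_eq hf']
      -- For positive `a` the number `cT` plays no role, so 0 is taken.
      refine ⟨0, pow_pos hn _, w₀ + 1, by omega, fun w hw => ?_, ?_⟩
      · rw [hN w hw]
        exact ⟨(hf.feas w hw).1, fun z hz => by rw [hS w hw z hz]; exact (hf.feas w hw).2 z hz⟩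
      · rw [if_neg (by omega)]
        intro u hu
        have := hopt _ _ hN hS u hu
        rwa [hf' u hu] at this
    · push Not at hall
      obtain ⟨h₁, h₂, h₃⟩ := decode hf.le fun w hw => lt_of_le_of_ne (size_le w) (hall w hw)
      refine ⟨_, h₁, 0, by omega, fun w hw => ?_, ?_⟩
      · rw [h₂ w hw]
        exact ⟨(hf.feas w hw).1, fun z hz => by rw [h₃ w hw z hz]; exact (hf.feas w hw).2 z hz⟩
      · rw [if_pos rfl]
        exact ⟨f, fun u hu => ⟨hf.le u hu, hopt _ _ h₂ h₃ u hu⟩, rfl⟩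
  · rintro ⟨cW, -, cT, -, a, ha, hF, hacc⟩
    by_cases ha0 : a = 0
    · subst ha0
      rw [if_pos rfl] at hacc
      obtain ⟨f, hf, rfl⟩ := hacc
      have hle : ∀ u < J.n, f u ≤ J.m := fun u hu => (hf u hu).1
      refine ⟨f, ?_⟩
      have hs : ∀ w < J.m, J.size f w < J.n := by
        intro w hw
        refine lt_of_le_of_ne (size_le w) fun hs => ?_
        have hall := eq_of_size_eq hs
        have h0 := ((hf 0 hn).2.2.2 (by rw [hall 0 hn]; omega)).2.1.1
        rw [hall 0 hn, Nat.add_sub_cancel, sizeOf, if_pos rfl, Finset.sum_congr rfl fun u hu => by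
          rw [hall u (Finset.mem_range.1 hu)]] at h0
        apply h0
        -- A carry has to be excluded. If all `n` students were at `w`, the sizes would contribute
        -- `n * n ^ w` and the loads only powers from `n ^ m` on, so digit `w` would be 0. The guess
        -- would then treat `w` as empty, against the third condition of `Opt` for student 0.
        have hdvd : J.n * J.n ^ w ∣ ∑ u ∈ Finset.range J.n, J.wt u (w + 1) := by
          simp only [wt, Nat.add_one_ne_zero, if_false, Nat.add_sub_cancel]
          rw [Finset.sum_add_distrib]
          refine dvd_add (by simp) (Finset.dvd_sum fun u _ => Finset.dvd_sum fun z _ => ?_)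
          refine Dvd.dvd.mul_left ?_ _
          rw [mul_comm, ← pow_succ]
          exact pow_dvd_pow _ (by omega)
        obtain ⟨q, hq⟩ := hdvd
        rw [hq, mul_assoc, mul_left_comm, Nat.mul_div_cancel_left _ (pow_pos hn _)]
        exact Nat.mul_mod_right _ _
      obtain ⟨-, h₂, h₃⟩ := decode hle hs
      exact stable_of_opt (hd cW) h₂ h₃ hF hle fun u hu => (hf u hu).2
    · rw [if_neg ha0] at hacc
      refine ⟨fun _ => a, stable_of_opt (hd cW) (fun w _ => ?_) (fun w _ z _ => ?_) hF
        (fun _ _ => by omega) hacc⟩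
      · rw [sizeOf, if_neg ha0, size_of_eq (w := a - 1) fun _ _ => by omega]
        split_ifs <;> omega
      · rw [loadOf, if_neg ha0, load_of_eq (w := a - 1) fun _ _ => by omega]
        split_ifs <;> omega

/-- The number of assignments of allowed options to the first `u` students with weight `s`. -/
def count (m : ℕ) (L wt : ℕ → ℕ → ℕ) : ℕ → ℕ → ℕ
  | 0, s => if s = 0 then 1 else 0
  | u + 1, s => ∑ o ∈ Finset.range (m + 1),
      if L u o ≠ 0 ∧ wt u o ≤ s then count m L wt u (s - wt u o) else 0

/-- Split off the option of the last student. Counting instead of storing truth values suits the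
term language, whose only aggregation is the sum; a sum of natural numbers is nonzero if and only if
some summand is. -/
theorem count_ne_zero_iff {L : ℕ → ℕ → ℕ} {P : ℕ → ℕ → Prop} (u s : ℕ)
    (hL : ∀ v < u, ∀ o ≤ J.m, L v o ≠ 0 ↔ P v o) :
    count J.m L J.wt u s ≠ 0 ↔ J.Reach P u s := by
  induction u generalizing s with
  | zero => simp [count, Reach, eq_comm]
  | succ u ih =>
    rw [count, Ne, Finset.sum_eq_zero_iff]
    push Not
    constructor
    · rintro ⟨o, ho, h⟩
      have ho := Finset.mem_range.1 ho
      rw [ne_eq, ite_eq_right_iff, Classical.not_imp] at h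
      obtain ⟨⟨h₁, h₂⟩, h₃⟩ := h
      obtain ⟨f, hf, hsum⟩ := (ih _ fun v hv => hL v (by omega)).1 h₃
      refine ⟨Function.update f u o, fun v hv => ?_, ?_⟩
      · by_cases hvu : v = u
        · subst hvu
          rw [Function.update_self]
          exact ⟨by omega, (hL v hv o (by omega)).1 h₁⟩
        · rw [Function.update_of_ne hvu]
          exact hf v (by omega)
      · rw [Finset.sum_range_succ, Function.update_self, Finset.sum_congr rfl fun v hv => by
          rw [Function.update_of_ne (Finset.mem_range.1 hv).ne], hsum]
        omega
    · rintro ⟨f, hf, hsum⟩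
      rw [Finset.sum_range_succ] at hsum
      refine ⟨f u, Finset.mem_range.2 (by have := (hf u (by omega)).1; omega), ?_⟩
      rw [if_pos ⟨(hL u (by omega) _ (hf u (by omega)).1).2 (hf u (by omega)).2, by omega⟩]
      exact (ih _ fun v hv => hL v (by omega)).2 ⟨f, fun v hv => hf v (by omega), by omega⟩

end NumInst

/-! ### Numbering the types that occur -/

namespace TypeId

variable (t : ℕ) (τ : ℕ → ℕ → ℕ)

/-- Two students have the same type vector. -/
def Same (u v : ℕ) : Prop := ∀ z < t, τ u z = τ v z

open Classical in
/-- The first student with the same type vector as `u`. -/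
noncomputable def first (u : ℕ) : ℕ :=
  ∑ v ∈ Finset.range u, if ∃ v' < v + 1, Same t τ v' u then 0 else 1

/-- The number of types among the first `r` students. -/
noncomputable def num (r : ℕ) : ℕ := ∑ v ∈ Finset.range r, if first t τ v = v then 1 else 0

variable {t τ}

theorem Same.symm {u v : ℕ} (h : Same t τ u v) : Same t τ v u := fun z hz => (h z hz).symm

theorem Same.trans {u v w : ℕ} (h : Same t τ u v) (h' : Same t τ v w) : Same t τ u w :=
  fun z hz => (h z hz).trans (h' z hz)

/-- The condition in the sum defining `first` is monotone in `v`: it fails exactly below the least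
index with the type of `u`. The sum counts these indices and hence equals that least index. -/
theorem first_spec (u : ℕ) : first t τ u ≤ u ∧ Same t τ (first t τ u) u ∧
    ∀ v, Same t τ v u → first t τ u ≤ v := by
  classical
  have hex : ∃ v, Same t τ v u := ⟨u, fun _ _ => rfl⟩
  have hle : Nat.find hex ≤ u := Nat.find_min' hex fun _ _ => rfl
  have : first t τ u = Nat.find hex := by
    have h : ∀ v, (∃ v' < v + 1, Same t τ v' u) ↔ Nat.find hex ≤ v := fun v =>
      ⟨fun ⟨v', h₁, h₂⟩ => (Nat.find_min' hex h₂).trans (by omega),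
        fun h => ⟨_, by omega, Nat.find_spec hex⟩⟩
    have hset : (Finset.range u).filter (fun v => ¬ Nat.find hex ≤ v) =
        Finset.range (Nat.find hex) := by
      ext v
      simp only [Finset.mem_filter, Finset.mem_range]
      omega
    rw [first]
    simp only [h]
    rw [← Finset.card_range (Nat.find hex), ← hset, Finset.card_filter]
    exact Finset.sum_congr rfl fun v _ => by split_ifs <;> simp_all
  rw [this]
  exact ⟨hle, Nat.find_spec hex, fun v hv => Nat.find_min' hex hv⟩

theorem first_eq_iff {u v : ℕ} : first t τ u = first t τ v ↔ Same t τ u v := by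
  constructor
  · intro h
    have := (first_spec (t := t) (τ := τ) u).2.1
    rw [h] at this
    exact this.symm.trans (first_spec v).2.1
  · intro h
    exact le_antisymm ((first_spec u).2.2 _ ((first_spec v).2.1.trans h.symm))
      ((first_spec v).2.2 _ ((first_spec u).2.1.trans h))

theorem first_first (u : ℕ) : first t τ (first t τ u) = first t τ u :=
  first_eq_iff.2 (first_spec u).2.1

theorem num_mono {r r' : ℕ} (h : r ≤ r') : num t τ r ≤ num t τ r' :=
  Finset.sum_le_sum_of_subset (Finset.range_subset_range.2 h)

theorem num_first_lt {u r : ℕ} (h : first t τ u < r) : num t τ (first t τ u) < num t τ r := by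
  refine lt_of_lt_of_le ?_ (num_mono (Nat.succ_le_of_lt h))
  rw [num, num, Nat.succ_eq_add_one, Finset.sum_range_succ, if_pos (first_first u)]
  omega

/-- The counting function `num` grows right after each representative, so it is injective on
representatives; the resulting numbers serve as type numbers. -/
theorem num_first_eq_iff {u v : ℕ} :
    num t τ (first t τ u) = num t τ (first t τ v) ↔ Same t τ u v := by
  rw [← first_eq_iff]
  refine ⟨fun h => ?_, fun h => by rw [h]⟩
  by_contra hne
  rcases Nat.lt_or_gt_of_ne hne with h' | h'
  · exact (num_first_lt h').ne h
  · exact (num_first_lt h').ne h.symm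

theorem num_le (r : ℕ) : num t τ r ≤ r := by
  refine (Finset.sum_le_card_nsmul _ _ 1 fun u _ => ?_).trans (by simp)
  split_ifs <;> omega

/-- Distinct representatives have distinct 0-1 vectors of length `t`. -/
theorem num_le_two_pow (hτ : ∀ u z, τ u z ≤ 1) (r : ℕ) : num t τ r ≤ 2 ^ t := by
  rw [num, ← Finset.card_filter]
  have : Fintype.card (Fin t → Fin 2) = 2 ^ t := by simp
  rw [← this, ← Finset.card_univ]
  refine Finset.card_le_card_of_injOn (fun v z => ⟨τ v z, by have := hτ v z; omega⟩)
    (fun _ _ => Finset.mem_coe.2 (Finset.mem_univ _)) fun u hu v hv h => ?_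
  simp only [Finset.coe_filter, Finset.mem_range, Set.mem_ofPred_eq] at hu hv
  rw [← hu.2, ← hv.2, first_eq_iff]
  intro z hz
  simpa using congrFun h ⟨z, hz⟩

end TypeId

/-! ### Positions in preference lists -/

-- If `x` is strictly preferred to `y`, all elements above `x` are above `y`, and `x` is one more.
-- Otherwise completeness gives that `y` is weakly preferred to `x`, and the inclusion is reversed.
open Classical in
theorem rank_lt_iff {ι : Type*} [Fintype ι] {A : ι → Prop} {r : ι → ι → Prop}
    (h : IsPrefList {x | A x} r) {x y : ι} (hx : A x) (hy : A y) :
    (Finset.univ.filter fun z => A z ∧ StrictPref r z x).card <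
      (Finset.univ.filter fun z => A z ∧ StrictPref r z y).card ↔ StrictPref r x y := by
  constructor
  · intro hlt
    by_contra hn
    have hyx : r y x := by
      rcases h.1 x hx y hy with h' | h'
      · by_contra h''
        exact hn ⟨h', h''⟩
      · exact h'
    refine absurd (Finset.card_le_card ?_) (not_le.2 hlt)
    intro z hz
    simp only [Finset.mem_filter, Finset.mem_univ, true_and] at hz ⊢
    obtain ⟨hz, hzy, hyz⟩ := hz
    exact ⟨hz, h.2 z hz y hy x hx hzy hyx, fun hxz => hyz (h.2 y hy x hx z hz hyx hxz)⟩
  · intro hs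
    refine Finset.card_lt_card (Finset.ssubset_iff_of_subset ?_ |>.2 ⟨x, ?_, ?_⟩)
    · intro z hz
      simp only [Finset.mem_filter, Finset.mem_univ, true_and] at hz ⊢
      obtain ⟨hz, hzx, hxz⟩ := hz
      exact ⟨hz, h.2 z hz x hx y hy hzx hs.1, fun hyz => hxz (h.2 x hx y hy z hz hs.1 hyz)⟩
    · simpa using ⟨hx, hs⟩
    · exact fun h => (Finset.mem_filter.1 h).2.2.2 (Finset.mem_filter.1 h).2.2.1

/-! ### From the given instance to the instance in numbers -/

namespace SMTIDiverse

variable {n m t : ℕ} (I : SMTIDiverse n m t)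

theorem rankS_ne_zero_iff {u : Fin n} {w : Fin m} : I.rankS u w ≠ 0 ↔ I.acc u w := by
  rw [rankS]; split_ifs with h <;> simp [h]

theorem rankS_lt_iff {u : Fin n} {w w' : Fin m} (h : I.acc u w) (h' : I.acc u w') :
    I.rankS u w < I.rankS u w' ↔ StrictPref (I.prefS u) w w' := by
  rw [rankS, rankS, if_pos h, if_pos h', Nat.add_lt_add_iff_right]
  exact rank_lt_iff (I.prefS_list u) h h'

theorem rankC_lt_iff {w : Fin m} {u u' : Fin n} (h : I.acc u w) (h' : I.acc u' w) :
    I.rankC w u < I.rankC w u' ↔ StrictPref (I.prefC w) u u' := by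
  rw [rankC, rankC, if_pos h, if_pos h', Nat.add_lt_add_iff_right]
  exact rank_lt_iff (A := fun u => I.acc u w) (I.prefC_list w) h h'

/-- A table as a function of two numbers. -/
def ext {a b : ℕ} (f : Fin a → Fin b → ℕ) (i j : ℕ) : ℕ :=
  if h : i < a ∧ j < b then f ⟨i, h.1⟩ ⟨j, h.2⟩ else 0

theorem ext_fin {a b : ℕ} (f : Fin a → Fin b → ℕ) (i : Fin a) (j : Fin b) :
    ext f i j = f i j := by simp [ext]

/-- The instance in numbers. -/
noncomputable def toNum (hn : 0 < n) : NumInst where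
  n := n
  m := m
  t := t
  τ := ext fun u z => (I.τ u z : ℕ)
  rs := ext I.rankS
  rc := ext I.rankC
  lo := ext I.lower
  up := ext I.upper
  cp := fun w => if h : w < m then I.cap ⟨w, h⟩ else 0
  k := TypeId.num t (ext fun u z => (I.τ u z : ℕ)) n
  tid := fun u => TypeId.num t (ext fun u z => (I.τ u z : ℕ))
    (TypeId.first t (ext fun u z => (I.τ u z : ℕ)) u)
  n_pos := hn
  τ_le := fun u z => by
    rw [ext]
    split_ifs
    · omega
    · omega
  tid_lt := fun u hu => TypeId.num_first_lt ((TypeId.first_spec u).1.trans_lt hu)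
  tid_eq := fun _ _ _ _ => TypeId.num_first_eq_iff

theorem toNum_τ (hn : 0 < n) (u : Fin n) (z : Fin t) : (I.toNum hn).τ u z = I.τ u z :=
  ext_fin (fun u z => (I.τ u z : ℕ)) u z

theorem toNum_cp (hn : 0 < n) (w : Fin m) : (I.toNum hn).cp w = I.cap w := by simp [toNum]

theorem toNum_size (hn : 0 < n) {f : ℕ → ℕ} {M : I.Matching}
    (h : ∀ (u : Fin n) (w : Fin m), M.college u = some w ↔ f u = w + 1) (w : Fin m) :
    (I.toNum hn).size f w = (M.students w).card := by
  rw [Matching.students, Finset.card_filter, NumInst.size]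
  change ∑ u ∈ Finset.range n, _ = _
  rw [Finset.sum_range]
  exact Finset.sum_congr rfl fun u _ => by simp only [h]

theorem toNum_load (hn : 0 < n) {f : ℕ → ℕ} {M : I.Matching}
    (h : ∀ (u : Fin n) (w : Fin m), M.college u = some w ↔ f u = w + 1) (w : Fin m) (z : Fin t) :
    (I.toNum hn).load f w z = ∑ u ∈ M.students w, (I.τ u z : ℕ) := by
  rw [Matching.students, Finset.sum_filter, NumInst.load]
  change ∑ u ∈ Finset.range n, _ = _
  rw [Finset.sum_range]
  refine Finset.sum_congr rfl fun u _ => ?_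
  simp only [h]
  congr 1
  exact I.toNum_τ hn u z

/-- As `u` is not at `w` and the removed students are, cardinality and loads after the exchange are
exact sums. Moving the removed part to the other side avoids truncated subtraction. -/
theorem toNum_admits (hn : 0 < n) {f : ℕ → ℕ} {M : I.Matching}
    (h : ∀ (u : Fin n) (w : Fin m), M.college u = some w ↔ f u = w + 1)
    {u : Fin n} {w : Fin m} (ha : I.acc u w) (hu : M.college u ≠ some w) :
    (I.toNum hn).Admits f u w ↔ ∃ S ⊆ M.students w, (∀ u' ∈ S, StrictPref (I.prefC w) u u') ∧
      I.FeasibleFor w (insert u (M.students w \ S)) := by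
  have hmem : ∀ v, v ∈ M.students w ↔ M.college v = some w := fun v => by
    simp [Matching.students]
  have key : ∀ S ⊆ M.students w, (I.FeasibleFor w (insert u (M.students w \ S)) ↔
      (M.students w).card + 1 ≤ I.cap w + S.card ∧ ∀ z : Fin t,
        I.lower w z + ∑ v ∈ S, (I.τ v z : ℕ) ≤ (∑ v ∈ M.students w, (I.τ v z : ℕ)) + I.τ u z ∧
        (∑ v ∈ M.students w, (I.τ v z : ℕ)) + I.τ u z ≤
          I.upper w z + ∑ v ∈ S, (I.τ v z : ℕ)) := by
    intro S hS
    have hnot : u ∉ M.students w \ S := fun hc => hu ((hmem u).1 (Finset.mem_sdiff.1 hc).1)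
    rw [FeasibleFor, Finset.card_insert_of_notMem hnot, Finset.card_sdiff_of_subset hS]
    have := Finset.card_le_card hS
    refine and_congr (by omega) (forall_congr' fun z => ?_)
    rw [Finset.sum_insert hnot]
    have := Finset.sum_sdiff (f := fun v => (I.τ v z : ℕ)) hS
    omega
  constructor
  · rintro ⟨U, hU, hU₁, hU₂⟩
    set S : Finset (Fin n) := Finset.univ.filter fun v => (v : ℕ) ∈ U with hSdef
    have hmap : S.map Fin.valEmbedding = U := by
      ext v
      simp only [hSdef, Finset.mem_map, Finset.mem_filter, Finset.mem_univ, true_and,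
        Fin.valEmbedding_apply]
      exact ⟨fun ⟨v', h₁, h₂⟩ => h₂ ▸ h₁, fun hv => ⟨⟨v, (hU v hv).1⟩, hv, rfl⟩⟩
    have hS : S ⊆ M.students w := fun v hv => by
      have hv := (Finset.mem_filter.1 hv).2
      exact (hmem v).2 ((h v w).2 (hU v hv).2.1)
    have hsum : ∀ z : Fin t, ∑ v ∈ U, (I.toNum hn).τ v z = ∑ v ∈ S, (I.τ v z : ℕ) := by
      intro z
      rw [← hmap, Finset.sum_map]
      exact Finset.sum_congr rfl fun v _ => I.toNum_τ hn v z
    refine ⟨S, hS, fun v hv => ?_, (key S hS).2 ⟨?_, fun z => ?_⟩⟩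
    · have h₁ := (hU v (Finset.mem_filter.1 hv).2).2.2
      have h₂ := M.acceptable v w ((hmem v).1 (hS hv))
      change ext I.rankC w u < ext I.rankC w v at h₁
      rw [ext_fin, ext_fin] at h₁
      exact (I.rankC_lt_iff ha h₂).1 h₁
    · rw [← hmap, Finset.card_map, toNum_cp, I.toNum_size hn h] at hU₁
      exact hU₁
    · have := hU₂ z z.2
      rw [hsum, I.toNum_load hn h] at this
      have e₁ : (I.toNum hn).lo w z = I.lower w z := ext_fin _ _ _
      have e₂ : (I.toNum hn).up w z = I.upper w z := ext_fin _ _ _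
      have e₃ : (I.toNum hn).τ u z = I.τ u z := I.toNum_τ hn u z
      rwa [e₁, e₂, e₃] at this
  · rintro ⟨S, hS, hS₁, hS₂⟩
    obtain ⟨h₁, h₂⟩ := (key S hS).1 hS₂
    have hsum : ∀ z : Fin t, ∑ v ∈ S.map Fin.valEmbedding, (I.toNum hn).τ v z =
        ∑ v ∈ S, (I.τ v z : ℕ) := by
      intro z
      rw [Finset.sum_map]
      exact Finset.sum_congr rfl fun v _ => I.toNum_τ hn v z
    refine ⟨S.map Fin.valEmbedding, fun v hv => ?_, ?_, fun z hz => ?_⟩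
    · obtain ⟨v, hvS, rfl⟩ := Finset.mem_map.1 hv
      have hcol := (hmem v).1 (hS hvS)
      refine ⟨v.2, (h v w).1 hcol, ?_⟩
      change ext I.rankC w u < ext I.rankC w v
      rw [ext_fin, ext_fin]
      exact (I.rankC_lt_iff ha (M.acceptable v w hcol)).2 (hS₁ v hvS)
    · rw [Finset.card_map, toNum_cp, I.toNum_size hn h]
      exact h₁
    · have := h₂ ⟨z, hz⟩
      have e₁ : (I.toNum hn).lo w z = I.lower w ⟨z, hz⟩ := ext_fin _ w ⟨z, hz⟩
      have e₂ : (I.toNum hn).up w z = I.upper w ⟨z, hz⟩ := ext_fin _ w ⟨z, hz⟩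
      have e₃ : (I.toNum hn).τ u z = I.τ u ⟨z, hz⟩ := I.toNum_τ hn u ⟨z, hz⟩
      rw [e₁, e₂, e₃, hsum ⟨z, hz⟩, I.toNum_load hn h w ⟨z, hz⟩]
      exact this

theorem toNum_stable_iff (hn : 0 < n) {f : ℕ → ℕ} {M : I.Matching} (hf : ∀ u < n, f u ≤ m)
    (h : ∀ (u : Fin n) (w : Fin m), M.college u = some w ↔ f u = w + 1) :
    (I.toNum hn).Stable f ↔ M.Feasible ∧ M.Stable := by
  have hfeas : (I.toNum hn).Feas ((I.toNum hn).size f) ((I.toNum hn).load f) ↔ M.Feasible := by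
    constructor
    · intro hF w
      obtain ⟨h₁, h₂⟩ := hF w w.2
      refine ⟨?_, fun z => ?_⟩
      · rwa [I.toNum_size hn h, toNum_cp] at h₁
      · have := h₂ z z.2
        rw [I.toNum_load hn h] at this
        have e₁ : (I.toNum hn).lo w z = I.lower w z := ext_fin _ _ _
        have e₂ : (I.toNum hn).up w z = I.upper w z := ext_fin _ _ _
        rwa [e₁, e₂] at this
    · intro hF w hw
      obtain ⟨h₁, h₂⟩ := hF ⟨w, hw⟩
      refine ⟨?_, fun z hz => ?_⟩
      · rw [I.toNum_size hn h ⟨w, hw⟩, I.toNum_cp hn ⟨w, hw⟩]; exact h₁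
      · have e₁ : (I.toNum hn).lo w z = I.lower ⟨w, hw⟩ ⟨z, hz⟩ := ext_fin _ ⟨w, hw⟩ ⟨z, hz⟩
        have e₂ : (I.toNum hn).up w z = I.upper ⟨w, hw⟩ ⟨z, hz⟩ := ext_fin _ ⟨w, hw⟩ ⟨z, hz⟩
        rw [e₁, e₂, I.toNum_load hn h ⟨w, hw⟩ ⟨z, hz⟩]; exact h₂ ⟨z, hz⟩
  have hrs : ∀ (u : Fin n) (w : Fin m), (I.toNum hn).rs u w = I.rankS u w := fun u w =>
    ext_fin _ u w
  constructor
  · intro hs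
    have hF := hfeas.1 hs.feas
    refine ⟨hF, ?_⟩
    rintro u w ⟨ha, hu, hpref, hblk⟩
    refine hs.stable u u.2 w w.2 ?_ (fun w' hw' hf' => ?_) ((I.toNum_admits hn h ha hu).2 hblk)
    · rw [hrs, rankS_ne_zero_iff]; exact ha
    · have hcol := (h u ⟨w', hw'⟩).2 hf'
      rw [hrs, hrs u ⟨w', hw'⟩, I.rankS_lt_iff ha (M.acceptable _ _ hcol)]
      exact hpref _ hcol
  · rintro ⟨hF, hs⟩
    refine ⟨hf, fun u hu w hw hf' => ?_, hfeas.2 hF, fun u hu w hw ha hp hA => ?_⟩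
    · rw [hrs ⟨u, hu⟩ ⟨w, hw⟩, rankS_ne_zero_iff]
      exact M.acceptable _ _ ((h ⟨u, hu⟩ ⟨w, hw⟩).2 hf')
    · have ha' := ha
      rw [hrs ⟨u, hu⟩ ⟨w, hw⟩, rankS_ne_zero_iff] at ha'
      have hpref : ∀ w', M.college ⟨u, hu⟩ = some w' →
          StrictPref (I.prefS ⟨u, hu⟩) ⟨w, hw⟩ w' := by
        intro w' hcol
        have := hp w' w'.2 ((h ⟨u, hu⟩ w').1 hcol)
        rwa [hrs ⟨u, hu⟩ ⟨w, hw⟩, hrs ⟨u, hu⟩ w',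
          I.rankS_lt_iff ha' (M.acceptable _ _ hcol)] at this
      -- The numeric notion of stability does not mention `M(u) ≠ w`, since a student at `w` would
      -- have to prefer `w` strictly to itself.
      have hne : M.college ⟨u, hu⟩ ≠ some ⟨w, hw⟩ := fun hcol =>
        (hpref _ hcol).2 (hpref _ hcol).1
      exact hs ⟨u, hu⟩ ⟨w, hw⟩ ⟨ha', hne, hpref,
        (I.toNum_admits (u := ⟨u, hu⟩) (w := ⟨w, hw⟩) hn h ha' hne).1 hA⟩

theorem exists_stable_toNum_iff (hn : 0 < n) :
    (∃ f, (I.toNum hn).Stable f) ↔ I.HasFeasibleStableMatching := by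
  constructor
  · rintro ⟨f, hf⟩
    refine ⟨⟨fun u => if h : f u ≠ 0 then some ⟨f u - 1, by
        have h₁ := hf.le u u.2
        change f u ≤ m at h₁
        omega⟩ else none, fun u w hw => ?_⟩, ?_⟩
    · split_ifs at hw with h
      rw [← I.rankS_ne_zero_iff, ← ext_fin I.rankS]
      refine hf.acc u u.2 w w.2 ?_
      rw [← Option.some.inj hw]
      simp only
      omega
    · refine (I.toNum_stable_iff hn (f := f) (fun u hu => hf.le u hu) fun u w => ?_).1 hf
      simp only
      split_ifs with h
      · rw [Option.some.injEq, Fin.ext_iff]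
        simp only
        omega
      · simp only [false_iff]
        omega
  · rintro ⟨M, hM⟩
    refine ⟨fun u => if h : u < n then (M.college ⟨u, h⟩).elim 0 fun w => w + 1 else 0,
      (I.toNum_stable_iff hn (M := M) (fun u hu => ?_) fun u w => ?_).2 hM⟩
    · simp only [hu, dif_pos]
      cases M.college ⟨u, hu⟩ with
      | none => simp
      | some w => simp
    · simp only [u.2, dif_pos]
      cases M.college u with
      | none => simp
      | some w' => simp [Fin.ext_iff]

/-! ### Access to the input -/

theorem length_table {a b : ℕ} (f : Fin a → Fin b → ℕ) : (table f).length = a * b := by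
  simp [table, List.length_flatMap]

theorem getD_flatMap {β : Type*} (l : List β) (g : β → List ℕ) (b : ℕ)
    (hg : ∀ x ∈ l, (g x).length = b) (i j : ℕ) (hi : i < l.length) (hj : j < b) :
    (l.flatMap g).getD (i * b + j) 0 = (g l[i]).getD j 0 := by
  induction l generalizing i with
  | nil => simp at hi
  | cons x l ih =>
    rw [List.flatMap_cons]
    cases i with
    | zero =>
      rw [zero_mul, zero_add, List.getD_append _ _ _ _ (by rw [hg x (by simp)]; exact hj)]
      rfl
    | succ i =>
      rw [List.getD_append_right _ _ _ _ (by rw [hg x (by simp), Nat.succ_mul]; omega),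
        hg x (by simp), show (i + 1) * b + j - b = i * b + j by rw [Nat.succ_mul]; omega]
      exact ih (fun y hy => hg y (by simp [hy])) i (by simpa using hi)

theorem getD_table {a b : ℕ} (f : Fin a → Fin b → ℕ) {i j : ℕ} (hi : i < a) (hj : j < b) :
    (table f).getD (i * b + j) 0 = ext f i j := by
  rw [table, getD_flatMap _ _ b (by simp) i j (by simpa using hi) hj]
  simp [ext, hi, hj]

theorem length_encode :
    I.encode.length = 3 + n * t + n * m + m * n + m * t + m * t + m := by
  simp [encode, length_table]; ring

theorem encode_eq : I.encode = [n, m, t] ++ (table (fun u z => (I.τ u z : ℕ)) ++ (table I.rankS ++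
    (table I.rankC ++ (table I.lower ++ (table I.upper ++ List.ofFn I.cap))))) := by
  simp [encode]

theorem getD_encode (hn : 0 < n) :
    I.encode.getD 0 0 = n ∧ I.encode.getD 1 0 = m ∧ I.encode.getD 2 0 = t ∧
    (∀ u < n, ∀ z < t, I.encode.getD (3 + (u * t + z)) 0 = (I.toNum hn).τ u z) ∧
    (∀ u < n, ∀ w < m, I.encode.getD (3 + n * t + (u * m + w)) 0 = (I.toNum hn).rs u w) ∧
    (∀ w < m, ∀ u < n, I.encode.getD (3 + n * t + n * m + (w * n + u)) 0 = (I.toNum hn).rc w u) ∧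
    (∀ w < m, ∀ z < t, I.encode.getD (3 + n * t + n * m + m * n + (w * t + z)) 0 =
      (I.toNum hn).lo w z) ∧
    (∀ w < m, ∀ z < t, I.encode.getD (3 + n * t + n * m + m * n + m * t + (w * t + z)) 0 =
      (I.toNum hn).up w z) ∧
    (∀ w < m, I.encode.getD (3 + n * t + n * m + m * n + m * t + m * t + w) 0 =
      (I.toNum hn).cp w) := by
  have skip : ∀ (l l' : List ℕ) (a b : ℕ), l.length = a → (l ++ l').getD (a + b) 0 = l'.getD b 0 := by
    rintro l l' a b rfl
    rw [List.getD_append_right _ _ _ _ (by omega), Nat.add_sub_cancel_left]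
  have here : ∀ (l l' : List ℕ) (b : ℕ), b < l.length → (l ++ l').getD b 0 = l.getD b 0 :=
    fun l l' b h => List.getD_append _ _ _ _ h
  rw [encode_eq]
  refine ⟨rfl, rfl, rfl, fun u hu z hz => ?_, fun u hu w hw => ?_, fun w hw u hu => ?_,
    fun w hw z hz => ?_, fun w hw z hz => ?_, fun w hw => ?_⟩
  · rw [skip [n, m, t] _ 3 _ rfl, here _ _ _ (by rw [length_table]; exact mul_add_lt_mul hu hz),
      getD_table _ hu hz]
    rfl
  · simp only [add_assoc]
    rw [skip [n, m, t] _ 3 _ rfl, skip _ _ _ _ (length_table _), here _ _ _ (by rw [length_table]; exact mul_add_lt_mul hu hw),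
      getD_table _ hu hw]
    rfl
  · simp only [add_assoc]
    rw [skip [n, m, t] _ 3 _ rfl, skip _ _ _ _ (length_table _), skip _ _ _ _ (length_table _), here _ _ _ (by rw [length_table]; exact mul_add_lt_mul hw hu),
      getD_table _ hw hu]
    rfl
  · simp only [add_assoc]
    rw [skip [n, m, t] _ 3 _ rfl, skip _ _ _ _ (length_table _), skip _ _ _ _ (length_table _), skip _ _ _ _ (length_table _), here _ _ _ (by rw [length_table]; exact mul_add_lt_mul hw hz),
      getD_table _ hw hz]
    rfl
  · simp only [add_assoc]
    rw [skip [n, m, t] _ 3 _ rfl, skip _ _ _ _ (length_table _), skip _ _ _ _ (length_table _), skip _ _ _ _ (length_table _), skip _ _ _ _ (length_table _), here _ _ _ (by rw [length_table]; exact mul_add_lt_mul hw hz),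
      getD_table _ hw hz]
    rfl
  · simp only [add_assoc]
    rw [skip [n, m, t] _ 3 _ rfl, skip _ _ _ _ (length_table _), skip _ _ _ _ (length_table _), skip _ _ _ _ (length_table _), skip _ _ _ _ (length_table _), skip _ _ _ _ (length_table _)]
    simp [toNum, hw]

end SMTIDiverse

/-! ### Tests, static cost bounds and tables in the language of terms -/

namespace RAM

namespace Term

variable {ρ : ℕ → ℕ} {α : ℕ → ℕ → ℕ}

/-- The term holds as a test. -/
def Tr (e : Term) (ρ : ℕ → ℕ) (α : ℕ → ℕ → ℕ) : Prop := e.eval ρ α ≠ 0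

def bool (e : Term) : Term := ite e (num 1) (num 0)

def and (a b : Term) : Term := ite a b (num 0)

def imp (a b : Term) : Term := ite a b (num 1)

def lt (a b : Term) : Term := sub b a

def le (a b : Term) : Term := ite (sub a b) (num 0) (num 1)

def eq (a b : Term) : Term := ite (add (sub a b) (sub b a)) (num 0) (num 1)

def all (x : ℕ) (N b : Term) : Term := ite (sum x N (ite b (num 0) (num 1))) (num 0) (num 1)

/-- The product of `a` and `b`; the variable 31 must not occur in `b`. -/
def mul (a b : Term) : Term := sum 31 a b

/-- The indicator of a proposition. -/
noncomputable def ind (P : Prop) : ℕ := open Classical in if P then 1 else 0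

theorem ind_ne_zero {P : Prop} : ind P ≠ 0 ↔ P := by
  classical
  rw [ind]; split_ifs with h <;> simp [h]

theorem eval_bool {e : Term} {P : Prop} (h : e.Tr ρ α ↔ P) : e.bool.eval ρ α = ind P := by
  by_cases hP : P
  · have := h.2 hP
    rw [Tr] at this
    simp [bool, eval, ind, hP, this]
  · have := mt h.1 hP
    rw [Tr] at this
    simp [bool, eval, ind, hP, this]

theorem tr_and {a b : Term} : (a.and b).Tr ρ α ↔ a.Tr ρ α ∧ b.Tr ρ α := by
  simp only [Tr, and, eval]
  split_ifs with h <;> simp [h]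

theorem tr_imp {a b : Term} : (a.imp b).Tr ρ α ↔ (a.Tr ρ α → b.Tr ρ α) := by
  simp only [Tr, imp, eval]
  split_ifs with h <;> simp [h]

theorem tr_ite {c a b : Term} {P : Prop} (h : c.Tr ρ α ↔ P) :
    (ite c a b).Tr ρ α ↔ (P → a.Tr ρ α) ∧ (¬ P → b.Tr ρ α) := by
  rw [← h]
  simp only [Tr, eval]
  split_ifs with h' <;> simp [h']

theorem tr_lt {a b : Term} {x y : ℕ} (ha : a.eval ρ α = x) (hb : b.eval ρ α = y) :
    (lt a b).Tr ρ α ↔ x < y := by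
  simp only [Tr, lt, eval, ha, hb]
  omega

theorem tr_le {a b : Term} {x y : ℕ} (ha : a.eval ρ α = x) (hb : b.eval ρ α = y) :
    (le a b).Tr ρ α ↔ x ≤ y := by
  simp only [Tr, le, eval, ha, hb]
  split_ifs <;> simp <;> omega

theorem tr_eq {a b : Term} {x y : ℕ} (ha : a.eval ρ α = x) (hb : b.eval ρ α = y) :
    (eq a b).Tr ρ α ↔ x = y := by
  simp only [Tr, eq, eval, ha, hb]
  split_ifs <;> simp <;> omega

theorem eval_eq {a b : Term} {x y : ℕ} (ha : a.eval ρ α = x) (hb : b.eval ρ α = y) :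
    (eq a b).eval ρ α = if x = y then 1 else 0 := by
  simp only [eq, eval, ha, hb]
  split_ifs <;> omega

theorem tr_sum {x : ℕ} {N b : Term} {n : ℕ} (hn : N.eval ρ α = n) :
    (sum x N b).Tr ρ α ↔ ∃ i < n, b.Tr (Function.update ρ x i) α := by
  simp [Tr, eval, hn, Finset.sum_eq_zero_iff]

theorem tr_all {x : ℕ} {N b : Term} {n : ℕ} (hn : N.eval ρ α = n) :
    (all x N b).Tr ρ α ↔ ∀ i < n, b.Tr (Function.update ρ x i) α := by
  have : (all x N b).Tr ρ α ↔ ¬ (sum x N (ite b (num 0) (num 1))).Tr ρ α := by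
    rw [Tr, all, eval, Tr]
    split_ifs with h <;> simpa [eval] using h
  rw [this, tr_sum hn]
  simp [Tr, eval]

theorem tr_iff {e : Term} {v : ℕ} (h : e.eval ρ α = v) : e.Tr ρ α ↔ v ≠ 0 := by rw [Tr, h]

theorem eval_var {x v : ℕ} (h : ρ x = v) : (var x).eval ρ α = v := h

theorem eval_mul {a b : Term} {x y : ℕ} (ha : a.eval ρ α = x)
    (hb : ∀ i, b.eval (Function.update ρ 31 i) α = y) : (mul a b).eval ρ α = x * y := by
  simp [mul, eval, ha, hb]

/-! ### Costs -/

/-- A bound for the cost of terms without loops. -/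
def flat : Term → ℕ
  | num _ => 2
  | var _ => 2
  | add a b => a.flat + b.flat + 4
  | sub a b => a.flat + b.flat + 4
  | get _ i => i.flat + 80
  | ite c a b => c.flat + 2 + a.flat + b.flat
  | bind _ a b => a.flat + b.flat + 8
  | _ => 0

/-- The term has no loops. -/
def isFlat : Term → Bool
  | num _ => true
  | var _ => true
  | add a b => a.isFlat && b.isFlat
  | sub a b => a.isFlat && b.isFlat
  | get _ i => i.isFlat
  | ite c a b => c.isFlat && a.isFlat && b.isFlat
  | bind _ a b => a.isFlat && b.isFlat
  | _ => false

/-- For a concrete loop-free term `flat` is a numeral, as both branches of `ite` are charged. Hence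
`rfl` and `decide` suffice for the round constants used from here on. -/
theorem cost_le_flat {e : Term} (he : e.isFlat = true) (ρ : ℕ → ℕ) (α : ℕ → ℕ → ℕ) :
    e.cost ρ α ≤ e.flat := by
  induction e generalizing ρ with
  | num | var => exact le_rfl
  | add a b ha hb | sub a b ha hb =>
    simp only [isFlat, Bool.and_eq_true] at he
    have := ha he.1 ρ
    have := hb he.2 ρ
    simp only [cost, flat]; omega
  | get A i hi =>
    have := hi he ρ
    simp only [cost, flat]; omega
  | ite c a b hc ha hb =>
    simp only [isFlat, Bool.and_eq_true] at he
    have := hc he.1.1 ρ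
    have := ha he.1.2 ρ
    have := hb he.2 ρ
    simp only [cost, flat]
    split_ifs <;> omega
  | bind x a b ha hb =>
    simp only [isFlat, Bool.and_eq_true] at he
    have := ha he.1 ρ
    have := hb he.2 (Function.update ρ x (a.eval ρ α))
    simp only [cost, flat]; omega
  | quo | rem | sum | arr => simp [isFlat] at he

theorem cost_flat {e : Term} {C : ℕ} (he : e.isFlat = true) (hC : e.flat ≤ C) :
    e.cost ρ α ≤ C := (cost_le_flat he ρ α).trans hC

theorem cost_ite_le {c a b : Term} {x y z : ℕ} (hc : c.cost ρ α ≤ x) (ha : a.cost ρ α ≤ y)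
    (hb : b.cost ρ α ≤ z) : (ite c a b).cost ρ α ≤ x + y + z + 2 := by
  rw [cost]
  split_ifs <;> omega

theorem cost_bool_le {e : Term} {x : ℕ} (h : e.cost ρ α ≤ x) : e.bool.cost ρ α ≤ x + 6 :=
  cost_ite_le h le_rfl le_rfl

theorem cost_and_le {a b : Term} {x y : ℕ} (ha : a.cost ρ α ≤ x) (hb : b.cost ρ α ≤ y) :
    (and a b).cost ρ α ≤ x + y + 4 := cost_ite_le ha hb le_rfl

theorem cost_add_le {a b : Term} {x y : ℕ} (ha : a.cost ρ α ≤ x) (hb : b.cost ρ α ≤ y) :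
    (add a b).cost ρ α ≤ x + y + 4 := by rw [cost]; omega

theorem cost_bind_le {x : ℕ} {a b : Term} {ca cb v : ℕ} (ha : a.cost ρ α ≤ ca)
    (hv : a.eval ρ α = v) (hb : b.cost (Function.update ρ x v) α ≤ cb) :
    (bind x a b).cost ρ α ≤ ca + cb + 8 := by rw [cost, hv]; omega

theorem cost_le_le {a b : Term} {x y : ℕ} (ha : a.cost ρ α ≤ x) (hb : b.cost ρ α ≤ y) :
    (le a b).cost ρ α ≤ x + y + 10 := by
  refine (cost_ite_le (x := x + y + 4) ?_ le_rfl le_rfl).trans (le_of_eq ?_)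
  · rw [cost]; omega
  · simp only [cost]

theorem cost_all_le {x : ℕ} {N b : Term} {cN B n : ℕ} (hN : N.cost ρ α ≤ cN)
    (hn : N.eval ρ α = n) (h : ∀ i < n, b.cost (Function.update ρ x i) α ≤ B) :
    (all x N b).cost ρ α ≤ cN + n * (B + 18) + 20 := by
  refine (cost_ite_le (cost_sum_le hN hn fun i hi => cost_ite_le (h i hi) le_rfl le_rfl) le_rfl
    le_rfl).trans ?_
  simp only [cost]
  ring_nf
  exact le_rfl

theorem cost_mul_le {a b : Term} {x ca cb : ℕ} (ha : a.eval ρ α = x) (hca : a.cost ρ α ≤ ca)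
    (hb : ∀ i, b.cost (Function.update ρ 31 i) α ≤ cb) :
    (mul a b).cost ρ α ≤ ca + x * (cb + 12) + 14 := cost_sum_le hca ha fun i _ => hb i

theorem cost_quo_le {a b : Term} {x y ca cb q : ℕ} (ha : a.eval ρ α = x) (hb : b.eval ρ α = y)
    (hca : a.cost ρ α ≤ ca) (hcb : b.cost ρ α ≤ cb) (hq : x / y ≤ q) :
    (quo a b).cost ρ α ≤ ca + cb + 14 * q + 14 := by
  rw [cost, ha, hb]; omega

theorem cost_rem_le {a b : Term} {x y ca cb q : ℕ} (ha : a.eval ρ α = x) (hb : b.eval ρ α = y)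
    (hca : a.cost ρ α ≤ ca) (hcb : b.cost ρ α ≤ cb) (hq : x / y ≤ q) :
    (rem a b).cost ρ α ≤ ca + cb + 14 * q + 14 := by
  rw [cost, ha, hb]; omega

/-! ### Multiples, powers and digits -/

/-- With the array `A` of the multiples of `v` below `N * v`, evaluate `b`. -/
def withMultiples (A : ℕ) (N v b : Term) : Term :=
  arr A 31 N (ite (var 31) (add (get A (sub (var 31) (num 1))) v) (num 0)) b

section multiples

variable {A : ℕ} {N v b : Term} {n x : ℕ}

theorem multiples_aux (hv : ∀ i g, v.eval (Function.update ρ 31 i) (Function.update α A g) = x) :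
    ∀ i < n, (ite (var 31) (add (get A (sub (var 31) (num 1))) v) (num 0)).eval
      (Function.update ρ 31 i) (Function.update α A (clip i fun i => i * x)) = i * x := by
  intro i _
  simp only [eval, Function.update_self, hv]
  split_ifs with h
  · rw [clip_of_lt _ (by omega)]
    obtain ⟨r, rfl⟩ := Nat.exists_eq_succ_of_ne_zero h
    simp [Nat.succ_mul]
  · simp_all

theorem eval_withMultiples (hn : N.eval ρ α = n)
    (hv : ∀ i g, v.eval (Function.update ρ 31 i) (Function.update α A g) = x) :
    (withMultiples A N v b).eval ρ α = b.eval ρ (Function.update α A (clip n fun i => i * x)) :=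
  eval_arr hn (multiples_aux hv)

theorem cost_withMultiples {cN cv cb : ℕ} (hn : N.eval ρ α = n)
    (hv : ∀ i g, v.eval (Function.update ρ 31 i) (Function.update α A g) = x)
    (hcN : N.cost ρ α ≤ cN)
    (hcv : ∀ i g, v.cost (Function.update ρ 31 i) (Function.update α A g) ≤ cv)
    (hcb : b.cost ρ (Function.update α A (clip n fun i => i * x)) ≤ cb) :
    (withMultiples A N v b).cost ρ α ≤ cN + n * (cv + 200) + cb + 20 := by
  refine (cost_arr_le (B := cv + 110) hn (multiples_aux hv) hcN (fun i _ => ?_) hcb).trans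
    (by ring_nf; omega)
  refine (cost_ite_le (x := 2) le_rfl (cost_add_le (x := 88) le_rfl (hcv i _)) le_rfl).trans ?_
  simp only [cost]
  omega

end multiples

/-- With the array `A` of the first `N` powers of `v`, evaluate `b`. -/
def withPowers (A : ℕ) (N v b : Term) : Term :=
  arr A 30 N (ite (var 30) (mul v (get A (sub (var 30) (num 1)))) (num 1)) b

section powers

variable {A : ℕ} {N v b : Term} {n x : ℕ}

theorem powers_aux (hv : ∀ i g, v.eval (Function.update ρ 30 i) (Function.update α A g) = x) :
    ∀ i < n, (ite (var 30) (mul v (get A (sub (var 30) (num 1)))) (num 1)).eval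
      (Function.update ρ 30 i) (Function.update α A (clip i fun i => x ^ i)) = x ^ i := by
  intro i _
  rw [eval, eval_mul (y := clip i (fun i => x ^ i) (i - 1)) (hv _ _) fun r => by simp [eval]]
  simp only [eval, Function.update_self]
  split_ifs with h
  · rw [clip_of_lt _ (by omega)]
    obtain ⟨r, rfl⟩ := Nat.exists_eq_succ_of_ne_zero h
    simp [pow_succ, mul_comm]
  · simp_all

theorem eval_withPowers (hn : N.eval ρ α = n)
    (hv : ∀ i g, v.eval (Function.update ρ 30 i) (Function.update α A g) = x) :
    (withPowers A N v b).eval ρ α = b.eval ρ (Function.update α A (clip n fun i => x ^ i)) :=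
  eval_arr hn (powers_aux hv)

/-- In the product, `v` is the number of rounds and the previous power is the summand. A new power
therefore costs `x` rounds, however large it is. -/
theorem cost_withPowers {cN cv cb : ℕ} (hn : N.eval ρ α = n)
    (hv : ∀ i g, v.eval (Function.update ρ 30 i) (Function.update α A g) = x)
    (hcN : N.cost ρ α ≤ cN)
    (hcv : ∀ i g, v.cost (Function.update ρ 30 i) (Function.update α A g) ≤ cv)
    (hcb : b.cost ρ (Function.update α A (clip n fun i => x ^ i)) ≤ cb) :
    (withPowers A N v b).cost ρ α ≤ cN + n * (cv + 100 * x + 120) + cb + 20 := by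
  refine (cost_arr_le (B := cv + 100 * x + 30) hn (powers_aux hv) hcN (fun i _ => ?_) hcb).trans
    (by ring_nf; omega)
  refine (cost_ite_le (x := 2) le_rfl (cost_mul_le (cb := 88) (hv i _) (hcv i _) fun _ => le_rfl)
    le_rfl).trans ?_
  simp only [cost]
  omega

end powers

/-- With the array `Q + 1` of the first `D` digits of `c` in base `x`, where `P` is the array of the
powers of `x`, evaluate `b`. -/
def withDigits (Q P : ℕ) (D c b : Term) : Term :=
  arr Q 31 (add D (num 1))
    (ite (var 31) (rem (get Q (sub (var 31) (num 1))) (get P (sub D (var 31)))) c)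
    (arr (Q + 1) 31 D (quo (get Q (sub D (add (var 31) (num 1)))) (get P (var 31))) b)

section digits

variable {Q P : ℕ} {D c b : Term} {n x y N : ℕ}

/-- Division is repeated subtraction, so computing `y / x ^ i` directly would be far too slow.
Instead the remainders modulo descending powers are formed one from another; then each quotient
involved is a single digit and costs at most `x` subtractions. -/
theorem digits_aux₁ (hPQ : P ≠ Q) (hN : n < N) (hP : α P = clip N fun i => x ^ i)
    (hD : ∀ i g, D.eval (Function.update ρ 31 i) (Function.update α Q g) = n)
    (hc : ∀ i g, c.eval (Function.update ρ 31 i) (Function.update α Q g) = y) (hy : y < x ^ n) :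
    ∀ i < n + 1,
      (ite (var 31) (rem (get Q (sub (var 31) (num 1))) (get P (sub D (var 31)))) c).eval
        (Function.update ρ 31 i) (Function.update α Q (clip i fun i => y % x ^ (n - i))) =
      y % x ^ (n - i) := by
  intro i hi
  simp only [eval, Function.update_self, hD, hc, Function.update_of_ne hPQ, hP]
  split_ifs with h
  · rw [clip_of_lt _ (by omega), clip_of_lt _ (by omega), Nat.mod_mod_of_dvd]
    exact pow_dvd_pow _ (by omega)
  · have h : i = 0 := by omega
    rw [h, Nat.sub_zero, Nat.mod_eq_of_lt hy]

theorem digits_aux₂ (hPQ : P < Q) (hN : n < N) (hP : α P = clip N fun i => x ^ i)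
    (hD : ∀ i g g', D.eval (Function.update ρ 31 i)
      (Function.update (Function.update α Q g) (Q + 1) g') = n) :
    ∀ i < n, (quo (get Q (sub D (add (var 31) (num 1)))) (get P (var 31))).eval
        (Function.update ρ 31 i) (Function.update (Function.update α Q
          (clip (n + 1) fun i => y % x ^ (n - i))) (Q + 1) (clip i fun i => y / x ^ i % x)) =
      y / x ^ i % x := by
  intro i hi
  simp only [eval, Function.update_self, hD, Function.update_of_ne (show P ≠ Q + 1 by omega),
    Function.update_of_ne (show Q ≠ Q + 1 by omega), Function.update_of_ne (show P ≠ Q by omega),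
    hP]
  rw [clip_of_lt _ (by omega), clip_of_lt _ (by omega), show n - (n - (i + 1)) = i + 1 by omega,
    pow_succ, Nat.mod_mul_right_div_self]

theorem eval_withDigits (hPQ : P < Q) (hN : n < N) (hP : α P = clip N fun i => x ^ i)
    (hD₀ : D.eval ρ α = n)
    (hD : ∀ i g, D.eval (Function.update ρ 31 i) (Function.update α Q g) = n)
    (hD₁ : ∀ g, D.eval ρ (Function.update α Q g) = n)
    (hD' : ∀ i g g', D.eval (Function.update ρ 31 i)
      (Function.update (Function.update α Q g) (Q + 1) g') = n)
    (hc : ∀ i g, c.eval (Function.update ρ 31 i) (Function.update α Q g) = y) (hy : y < x ^ n) :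
    (withDigits Q P D c b).eval ρ α = b.eval ρ (Function.update (Function.update α Q
      (clip (n + 1) fun i => y % x ^ (n - i))) (Q + 1) (clip n fun i => y / x ^ i % x)) := by
  rw [withDigits, eval_arr (n := n + 1) (by rw [eval, hD₀, eval])
    (digits_aux₁ hPQ.ne hN hP hD hc hy), eval_arr (hD₁ _) (digits_aux₂ hPQ hN hP hD')]

theorem cost_withDigits {cD cb cc : ℕ} (hPQ : P < Q) (hN : n < N) (hP : α P = clip N fun i => x ^ i)
    (hD₀ : D.eval ρ α = n)
    (hD : ∀ i g, D.eval (Function.update ρ 31 i) (Function.update α Q g) = n)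
    (hD₁ : ∀ g, D.eval ρ (Function.update α Q g) = n)
    (hD' : ∀ i g g', D.eval (Function.update ρ 31 i)
      (Function.update (Function.update α Q g) (Q + 1) g') = n)
    (hc : ∀ i g, c.eval (Function.update ρ 31 i) (Function.update α Q g) = y) (hy : y < x ^ n)
    (hcD : ∀ ρ α, D.cost ρ α ≤ cD) (hcc : ∀ ρ α, c.cost ρ α ≤ cc)
    (hcb : b.cost ρ (Function.update (Function.update α Q
      (clip (n + 1) fun i => y % x ^ (n - i))) (Q + 1) (clip n fun i => y / x ^ i % x)) ≤ cb) :
    (withDigits Q P D c b).cost ρ α ≤ (n + 1) * (2 * cD + cc + 28 * x + 800) + 2 * cD + cb := by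
  -- Base 0 is compatible with `y < x ^ n` only if there are no digits at all; otherwise quotients
  -- are below the positive base.
  have hx : 0 < x ∨ n = 0 := by
    rcases Nat.eq_zero_or_pos x with rfl | h
    · right
      by_contra hn
      rw [zero_pow hn] at hy
      omega
    · exact Or.inl h
  have h₁ : ∀ i < n + 1,
      (ite (var 31) (rem (get Q (sub (var 31) (num 1))) (get P (sub D (var 31)))) c).cost
        (Function.update ρ 31 i) (Function.update α Q (clip i fun i => y % x ^ (n - i))) ≤
      cD + cc + 14 * x + 200 := by
    intro i hi
    rw [cost, cost]
    have hcc := hcc (Function.update ρ 31 i) (Function.update α Q (clip i fun i => y % x ^ (n - i)))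
    have hcD := hcD (Function.update ρ 31 i) (Function.update α Q (clip i fun i => y % x ^ (n - i)))
    simp only [cost, eval, Function.update_self, hD, Function.update_of_ne hPQ.ne, hP]
    split_ifs with h
    · rw [clip_of_lt _ (by omega), clip_of_lt _ (by omega)]
      have hx : 0 < x := by omega
      have : y % x ^ (n - (i - 1)) / x ^ (n - i) ≤ x := by
        rw [show n - (i - 1) = n - i + 1 by omega, pow_succ, Nat.mod_mul_right_div_self]
        exact (Nat.mod_lt _ hx).le
      omega
    · omega
  have h₂ : ∀ i < n, (quo (get Q (sub D (add (var 31) (num 1)))) (get P (var 31))).cost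
        (Function.update ρ 31 i) (Function.update (Function.update α Q
          (clip (n + 1) fun i => y % x ^ (n - i))) (Q + 1) (clip i fun i => y / x ^ i % x)) ≤
      cD + 14 * x + 200 := by
    intro i hi
    rw [cost]
    have hcD := hcD (Function.update ρ 31 i) (Function.update (Function.update α Q
          (clip (n + 1) fun i => y % x ^ (n - i))) (Q + 1) (clip i fun i => y / x ^ i % x))
    have h := digits_aux₂ (y := y) hPQ hN hP hD' i hi
    rw [eval] at h
    rw [h]
    have : y / x ^ i % x ≤ x := (Nat.mod_lt _ (by omega)).le
    simp only [cost]
    omega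
  have h₃ := cost_arr_le (hD₁ _) (digits_aux₂ hPQ hN hP hD') (hcD _ _) h₂ hcb
  refine (cost_arr_le (cN := cD + 6) (n := n + 1) (by rw [eval, hD₀, eval])
    (digits_aux₁ hPQ.ne hN hP hD hc hy) ?_ h₁ h₃).trans ?_
  · have := hcD ρ α
    rw [cost, cost]; omega
  · ring_nf
    omega

end digits

end Term

end RAM

/-! ### The algorithm -/

namespace RAM

open Term NumInst

/-- The numbers the machine reads: types, positions, quotas and capacities, one after the other. -/
structure Reads (J : NumInst) (inp : ℕ → ℕ) : Prop where
  τ : ∀ u < J.n, ∀ z < J.t, inp (3 + (u * J.t + z)) = J.τ u z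
  rs : ∀ u < J.n, ∀ w < J.m, inp (3 + J.n * J.t + (u * J.m + w)) = J.rs u w
  rc : ∀ w < J.m, ∀ u < J.n, inp (3 + J.n * J.t + J.n * J.m + (w * J.n + u)) = J.rc w u
  lo : ∀ w < J.m, ∀ z < J.t,
    inp (3 + J.n * J.t + J.n * J.m + J.m * J.n + (w * J.t + z)) = J.lo w z
  up : ∀ w < J.m, ∀ z < J.t,
    inp (3 + J.n * J.t + J.n * J.m + J.m * J.n + J.m * J.t + (w * J.t + z)) = J.up w z
  cp : ∀ w < J.m,
    inp (3 + J.n * J.t + J.n * J.m + J.m * J.n + J.m * J.t + J.m * J.t + w) = J.cp w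
  k : J.k = TypeId.num J.t J.τ J.n
  tid : ∀ u < J.n, J.tid u = TypeId.num J.t J.τ (TypeId.first J.t J.τ u)

/-- The intended values of the variables, for the guess `cW`, `cT`, `a`. -/
def V (J : NumInst) (cW cT a : ℕ) : ℕ → ℕ
  | 0 => J.n
  | 1 => J.m
  | 2 => J.t
  | 3 => 3 + J.n * J.t
  | 4 => 3 + J.n * J.t + J.n * J.m
  | 5 => 3 + J.n * J.t + J.n * J.m + J.m * J.n
  | 6 => 3 + J.n * J.t + J.n * J.m + J.m * J.n + J.m * J.t
  | 7 => 3 + J.n * J.t + J.n * J.m + J.m * J.n + J.m * J.t + J.m * J.t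
  | 8 => J.k
  | 9 => J.m * J.k
  | 10 => J.numT
  | 11 => J.n ^ J.numT
  | 12 => cW
  | 13 => cT
  | 14 => a
  | _ => 0

/-- The intended arrays, for the guess `cW`, `cT`, `a`. -/
noncomputable def Arr (J : NumInst) (inp : ℕ → ℕ) (cW cT a : ℕ) : ℕ → ℕ → ℕ
  | 0 => inp
  | 1 => clip (J.n + J.m) fun i => i * J.t
  | 2 => clip J.n fun i => i * J.m
  | 3 => clip J.m fun i => i * J.n
  | 4 => clip J.n (TypeId.first J.t J.τ)
  | 5 => clip J.n J.tid
  | 6 => clip J.m fun i => i * J.k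
  | 7 => clip (J.m * J.k + J.numT + 1) fun i => J.n ^ i
  | 8 => clip (J.t + 2) fun i => J.k ^ i
  | 9 => clip J.t J.total
  | 10 => clip J.n fun i => i * (J.m + 1)
  | 11 => clip (J.n * (J.m + 1)) fun q => J.wt (q / (J.m + 1)) (q % (J.m + 1))
  | 12 => clip ((J.n + 1) * J.n ^ J.numT) fun p => p / J.n ^ J.numT
  | 13 => clip ((J.n + 1) * J.n ^ J.numT) fun p => p % J.n ^ J.numT
  | 14 => clip (J.m * J.k + 1) fun i => cW % J.n ^ (J.m * J.k - i)
  | 15 => clip (J.m * J.k) fun i => cW / J.n ^ i % J.n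
  | 16 => clip (J.numT + 1) fun i => cT % J.n ^ (J.numT - i)
  | 17 => clip J.numT fun i => cT / J.n ^ i % J.n
  | 18 => clip J.m (J.sizeOf cT a)
  | 19 => clip (J.m * J.t) fun q => J.loadOf cT a (q / J.t) (q % J.t)
  | 20 => clip (J.n * J.m) fun q =>
      ind (J.Blk (J.sizeOf cT a) (J.loadOf cT a) (J.worst cW) (q / J.m) (q % J.m))
  | 21 => clip (J.n * (J.m + 1)) fun q =>
      ind (J.Opt (J.sizeOf cT a) (J.loadOf cT a) (J.worst cW) (q / (J.m + 1)) (q % (J.m + 1)))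
  | _ => fun _ => 0

/-- The first `v` variables and the first `j` arrays have their intended values. -/
structure Env (J : NumInst) (inp : ℕ → ℕ) (cW cT a v j : ℕ) (ρ : ℕ → ℕ) (α : ℕ → ℕ → ℕ) :
    Prop where
  var : ∀ x < v, ρ x = V J cW cT a x
  arr : ∀ i < j, α i = Arr J inp cW cT a i

namespace Env

variable {J : NumInst} {inp : ℕ → ℕ} {cW cT a v j : ℕ} {ρ : ℕ → ℕ} {α : ℕ → ℕ → ℕ}

theorem setVar (h : Env J inp cW cT a v j ρ α) {x : ℕ} (hx : v ≤ x) (y : ℕ) :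
    Env J inp cW cT a v j (Function.update ρ x y) α :=
  ⟨fun i hi => by rw [Function.update_of_ne (by omega), h.var i hi], h.arr⟩

theorem setArr (h : Env J inp cW cT a v j ρ α) {A : ℕ} (hA : j ≤ A) (g : ℕ → ℕ) :
    Env J inp cW cT a v j ρ (Function.update α A g) :=
  ⟨h.var, fun i hi => by rw [Function.update_of_ne (by omega), h.arr i hi]⟩

theorem nextVar (h : Env J inp cW cT a v j ρ α) {y : ℕ} (hy : y = V J cW cT a v) :
    Env J inp cW cT a (v + 1) j (Function.update ρ v y) α :=
  ⟨fun i hi => by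
    by_cases hiv : i = v
    · rw [hiv, Function.update_self, hy]
    · rw [Function.update_of_ne hiv, h.var i (by omega)], h.arr⟩

theorem nextArr (h : Env J inp cW cT a v j ρ α) {g : ℕ → ℕ} (hg : g = Arr J inp cW cT a j) :
    Env J inp cW cT a v (j + 1) ρ (Function.update α j g) :=
  ⟨h.var, fun i hi => by
    by_cases hij : i = j
    · rw [hij, Function.update_self, hg]
    · rw [Function.update_of_ne hij, h.arr i (by omega)]⟩

theorem mono (h : Env J inp cW cT a v j ρ α) {v' j' : ℕ} (hv : v' ≤ v) (hj : j' ≤ j) :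
    Env J inp cW cT a v' j' ρ α :=
  ⟨fun i hi => h.var i (by omega), fun i hi => h.arr i (by omega)⟩

theorem eval (h : Env J inp cW cT a v j ρ α) (x : ℕ) (hx : x < v) :
    (Term.var x).eval ρ α = V J cW cT a x := h.var x hx

end Env

/-! ### The terms that test one guess -/

namespace Alg

/-- The tables follow the three header cells of the input; variables 3 to 7 hold the offsets of the
later ones, and arrays 1 to 3 the multiples of the row lengths `t`, `m` and `n`. So each input
access costs a constant. -/
def tauT (u z : Term) : Term := get 0 (add (num 3) (add (get 1 u) z))
def rsT (u w : Term) : Term := get 0 (add (var 3) (add (get 2 u) w))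
def rcT (w u : Term) : Term := get 0 (add (var 4) (add (get 3 w) u))
def loT (w z : Term) : Term := get 0 (add (var 5) (add (get 1 w) z))
def upT (w z : Term) : Term := get 0 (add (var 6) (add (get 1 w) z))
def cpT (w : Term) : Term := get 0 (add (var 7) w)
def worstT (w j : Term) : Term := get 15 (add (get 6 w) j)
def sizeT (w : Term) : Term := get 18 w
def loadT (w z : Term) : Term := get 19 (add (get 1 w) z)
def validT (w j : Term) : Term := and (sizeT w) (eq (get 5 (worstT w j)) j)

/-- Here and in the terms up to `blkT`, variable 16 is the student and 17 the college; variable 18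
is first the bound and later the number coding a tuple of types. Arrays from 21 on are temporary at
this stage: 21 marks the exceeded bounds, 22 holds the remainders that yield digits, 23 the tuple,
and 24 the set of types in it. -/
def needT : Term :=
  ite (lt (var 18) (var 2))
    (lt (upT (var 17) (var 18)) (add (loadT (var 17) (var 18)) (tauT (var 16) (var 18))))
    (lt (cpT (var 17)) (add (sizeT (var 17)) (num 1)))

def fitsT₁ : Term :=
  all 20 (add (var 2) (num 1)) (imp (get 21 (var 20))
    (and (validT (var 17) (get 23 (var 20)))
    (and (lt (rcT (var 17) (var 16)) (rcT (var 17) (worstT (var 17) (get 23 (var 20)))))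
      (imp (lt (var 20) (var 2)) (tauT (worstT (var 17) (get 23 (var 20))) (var 20))))))

def fitsT₂ : Term :=
  all 20 (var 2) (le
    (add (sum 19 (var 8) (ite (get 24 (var 19)) (tauT (worstT (var 17) (var 19)) (var 20)) (num 0)))
      (loT (var 17) (var 20)))
    (add (loadT (var 17) (var 20)) (tauT (var 16) (var 20))))

def memberT : Term :=
  bool (sum 20 (add (var 2) (num 1)) (and (get 21 (var 20)) (eq (get 23 (var 20)) (var 19))))

def fitsT : Term := arr 24 19 (var 8) memberT (and fitsT₁ fitsT₂)

def blkT : Term :=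
  and (rsT (var 16) (var 17)) (arr 21 18 (add (var 2) (num 1)) (bool needT)
    (sum 18 (get 8 (add (var 2) (num 1)))
      (withDigits 22 8 (add (var 2) (num 1)) (var 18) fitsT)))

def blkArrT : Term :=
  bool (bind 16 (quo (var 15) (var 1)) (bind 17 (rem (var 15) (var 1)) blkT))

/-- In the three parts of `optT`, variable 16 is the student and 17 the option. -/
def optT₁ : Term :=
  all 18 (var 1) (all 19 (var 8) (imp
    (and (validT (var 18) (var 19)) (eq (worstT (var 18) (var 19)) (var 16)))
    (eq (add (var 18) (num 1)) (var 17))))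

def optT₂ : Term :=
  all 18 (var 1) (imp (get 20 (add (get 2 (var 16)) (var 18)))
    (and (var 17) (le (rsT (var 16) (sub (var 17) (num 1))) (rsT (var 16) (var 18)))))

def optT₃ : Term :=
  imp (var 17) (and (rsT (var 16) (sub (var 17) (num 1)))
    (and (validT (sub (var 17) (num 1)) (get 5 (var 16)))
      (le (rcT (sub (var 17) (num 1)) (var 16))
        (rcT (sub (var 17) (num 1)) (worstT (sub (var 17) (num 1)) (get 5 (var 16)))))))

def optT : Term := and optT₁ (and optT₂ optT₃)

def optArrT : Term :=
  bool (bind 16 (quo (var 15) (add (var 1) (num 1)))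
    (bind 17 (rem (var 15) (add (var 1) (num 1))) optT))

def feasT : Term :=
  all 15 (var 1) (and (le (sizeT (var 15)) (cpT (var 15))) (all 16 (var 2)
    (and (le (loT (var 15) (var 16)) (loadT (var 15) (var 16)))
      (le (loadT (var 15) (var 16)) (upT (var 15) (var 16))))))

def wtT (u o : Term) : Term := get 11 (add (get 10 u) o)

/-- Entry `u * s + r`, with `s` the number of tallies, belongs to the first `u` students and weight
`r`. Arrays 12 and 13 supply `u` and `r` without a division. The entry for the previous student and
the reduced weight is found by subtracting `s` and the weight of the option. -/
def countT : Term :=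
  ite (lt (var 15) (var 11)) (ite (var 15) (num 0) (num 1))
    (bind 16 (sub (get 12 (var 15)) (num 1)) (bind 17 (get 13 (var 15))
      (sum 18 (add (var 1) (num 1)) (ite
        (and (get 21 (add (get 10 (var 16)) (var 18))) (le (wtT (var 16) (var 18)) (var 17)))
        (get 22 (sub (sub (var 15) (var 11)) (wtT (var 16) (var 18)))) (num 0)))))

def reachT : Term :=
  arr 22 15 (mul (add (var 0) (num 1)) (var 11)) countT
    (get 22 (add (mul (var 0) (var 11)) (var 13)))

def testT : Term :=
  ite (var 14) (all 15 (var 0) (get 21 (add (get 10 (var 15)) (var 14)))) reachT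

/-! ### The terms have the intended values -/

section

variable {J : NumInst} {inp : ℕ → ℕ} {cW cT a v j : ℕ} {ρ : ℕ → ℕ} {α : ℕ → ℕ → ℕ}
  {U Z W D : Term} {u z w d : ℕ}

theorem eval_tau (hr : Reads J inp) (h : Env J inp cW cT a v j ρ α) (hj : 1 < j)
    (hU : U.eval ρ α = u) (hZ : Z.eval ρ α = z) (hu : u < J.n) (hz : z < J.t) :
    (tauT U Z).eval ρ α = J.τ u z := by
  simp only [tauT, eval, hU, hZ, h.arr 0 (by omega), h.arr 1 (by omega), Arr]
  rw [clip_of_lt _ (by omega), hr.τ u hu z hz]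

theorem eval_rs (hr : Reads J inp) (h : Env J inp cW cT a v j ρ α) (hv : 3 < v) (hj : 2 < j)
    (hU : U.eval ρ α = u) (hW : W.eval ρ α = w) (hu : u < J.n) (hw : w < J.m) :
    (rsT U W).eval ρ α = J.rs u w := by
  simp only [rsT, eval, hU, hW, h.arr 0 (by omega), h.arr 2 (by omega), h.var 3 (by omega), Arr, V]
  rw [clip_of_lt _ (by omega), hr.rs u hu w hw]

theorem eval_rc (hr : Reads J inp) (h : Env J inp cW cT a v j ρ α) (hv : 4 < v) (hj : 3 < j)
    (hW : W.eval ρ α = w) (hU : U.eval ρ α = u) (hw : w < J.m) (hu : u < J.n) :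
    (rcT W U).eval ρ α = J.rc w u := by
  simp only [rcT, eval, hU, hW, h.arr 0 (by omega), h.arr 3 (by omega), h.var 4 (by omega), Arr, V]
  rw [clip_of_lt _ (by omega), hr.rc w hw u hu]

theorem eval_lo (hr : Reads J inp) (h : Env J inp cW cT a v j ρ α) (hv : 5 < v) (hj : 1 < j)
    (hW : W.eval ρ α = w) (hZ : Z.eval ρ α = z) (hw : w < J.m) (hz : z < J.t) :
    (loT W Z).eval ρ α = J.lo w z := by
  simp only [loT, eval, hZ, hW, h.arr 0 (by omega), h.arr 1 (by omega), h.var 5 (by omega), Arr, V]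
  rw [clip_of_lt _ (by omega), hr.lo w hw z hz]

theorem eval_up (hr : Reads J inp) (h : Env J inp cW cT a v j ρ α) (hv : 6 < v) (hj : 1 < j)
    (hW : W.eval ρ α = w) (hZ : Z.eval ρ α = z) (hw : w < J.m) (hz : z < J.t) :
    (upT W Z).eval ρ α = J.up w z := by
  simp only [upT, eval, hZ, hW, h.arr 0 (by omega), h.arr 1 (by omega), h.var 6 (by omega), Arr, V]
  rw [clip_of_lt _ (by omega), hr.up w hw z hz]

theorem eval_cp (hr : Reads J inp) (h : Env J inp cW cT a v j ρ α) (hv : 7 < v) (hj : 0 < j)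
    (hW : W.eval ρ α = w) (hw : w < J.m) : (cpT W).eval ρ α = J.cp w := by
  simp only [cpT, eval, hW, h.arr 0 (by omega), h.var 7 (by omega), Arr, V]
  rw [hr.cp w hw]

theorem eval_worst (h : Env J inp cW cT a v j ρ α) (hj : 15 < j)
    (hW : W.eval ρ α = w) (hD : D.eval ρ α = d) (hw : w < J.m) (hd : d < J.k) :
    (worstT W D).eval ρ α = J.worst cW w d := by
  simp only [worstT, eval, hW, hD, h.arr 15 (by omega), h.arr 6 (by omega), Arr]
  rw [clip_of_lt _ hw, clip_of_lt _ (mul_add_lt_mul hw hd), NumInst.worst]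

theorem worst_lt : J.worst cW w d < J.n := Nat.mod_lt _ J.n_pos

theorem eval_size (h : Env J inp cW cT a v j ρ α) (hj : 18 < j) (hW : W.eval ρ α = w)
    (hw : w < J.m) : (sizeT W).eval ρ α = J.sizeOf cT a w := by
  simp only [sizeT, eval, hW, h.arr 18 (by omega), Arr]
  rw [clip_of_lt _ hw]

theorem eval_load (h : Env J inp cW cT a v j ρ α) (hj : 19 < j)
    (hW : W.eval ρ α = w) (hZ : Z.eval ρ α = z) (hw : w < J.m) (hz : z < J.t) :
    (loadT W Z).eval ρ α = J.loadOf cT a w z := by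
  simp only [loadT, eval, hW, hZ, h.arr 19 (by omega), h.arr 1 (by omega), Arr]
  rw [clip_of_lt _ (show w < J.n + J.m by omega), clip_of_lt _ (mul_add_lt_mul hw hz), mul_add_div_eq hz,
    mul_add_mod_eq hz]

theorem tr_valid (h : Env J inp cW cT a v j ρ α) (hj : 18 < j)
    (hW : W.eval ρ α = w) (hD : D.eval ρ α = d) (hw : w < J.m) (hd : d < J.k) :
    (validT W D).Tr ρ α ↔ J.Valid (J.sizeOf cT a) (J.worst cW) w d := by
  have h₁ : (get 5 (worstT W D)).eval ρ α = J.tid (J.worst cW w d) := by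
    rw [eval, eval_worst h (by omega) hW hD hw hd, h.arr 5 (by omega), Arr, clip_of_lt _ worst_lt]
  rw [validT, tr_and, tr_iff (eval_size h hj hW hw), tr_eq h₁ hD, NumInst.Valid]

theorem tr_need (hr : Reads J inp) (h : Env J inp cW cT a 15 20 ρ α) (hu : u < J.n) (hw : w < J.m)
    (hρu : ρ 16 = u) (hρw : ρ 17 = w) (hρi : ρ 18 = d) :
    needT.Tr ρ α ↔ J.Need (J.sizeOf cT a) (J.loadOf cT a) u w d := by
  rw [needT, tr_ite (tr_lt (y := J.t) (eval_var hρi) (h.eval 2 (by omega))), NumInst.Need]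
  split_ifs with hd
  · rw [tr_lt (eval_up hr h (by omega) (by omega) (eval_var hρw) (eval_var hρi) hw hd) (y := J.loadOf cT a w d + J.τ u d)
      (by rw [eval, eval_load h (by omega) (eval_var hρw) (eval_var hρi) hw hd,
        eval_tau hr h (by omega) (eval_var hρu) (eval_var hρi) hu hd])]
    simp [hd]
  · rw [tr_lt (eval_cp hr h (by omega) (by omega) (eval_var hρw) hw) (y := J.sizeOf cT a w + 1)
      (by rw [eval, eval_size h (by omega) (eval_var hρw) hw, eval])]
    simp [hd]

theorem tr_get {A : ℕ} {i n : ℕ} {P : ℕ → Prop} (hA : α A = clip n fun i => ind (P i))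
    (hD : D.eval ρ α = i) (hi : i < n) : (get A D).Tr ρ α ↔ P i := by
  rw [tr_iff (v := ind (P i)) (by rw [eval, hD, hA, clip_of_lt _ hi]), ind_ne_zero]

theorem eval_get {A : ℕ} {i n : ℕ} {f : ℕ → ℕ} (hA : α A = clip n f)
    (hD : D.eval ρ α = i) (hi : i < n) : (get A D).eval ρ α = f i := by
  rw [eval, hD, hA, clip_of_lt _ hi]

theorem eval_member (h : Env J inp cW cT a 15 20 ρ α) {P : ℕ → Prop} {b : ℕ → ℕ}
    (hP : α 21 = clip (J.t + 1) fun i => ind (P i)) (hb : α 23 = clip (J.t + 1) b)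
    (hρ : ρ 19 = d) : memberT.eval ρ α = ind (∃ i < J.t + 1, P i ∧ b i = d) := by
  refine eval_bool ?_
  rw [tr_sum (n := J.t + 1) (by rw [eval, eval, eval, h.var 2 (by omega), V])]
  refine exists_congr fun i => and_congr_right fun hi => ?_
  rw [tr_and, tr_get hP (i := i) (by simp [eval]) hi,
    tr_eq (eval_get hb (i := i) (by simp [eval]) hi) (y := d) (by simp [eval, hρ])]

theorem tr_fits (hr : Reads J inp) (h : Env J inp cW cT a 15 20 ρ α) {b : ℕ → ℕ}
    (hu : u < J.n) (hw : w < J.m) (hρu : ρ 16 = u) (hρw : ρ 17 = w)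
    (hP : α 21 = clip (J.t + 1) fun i => ind (J.Need (J.sizeOf cT a) (J.loadOf cT a) u w i))
    (hb : α 23 = clip (J.t + 1) b) (hbk : ∀ i < J.t + 1, b i < J.k) :
    fitsT.Tr ρ α ↔ J.Fits (J.sizeOf cT a) (J.loadOf cT a) (J.worst cW) u w b := by
  have hk : (var 8).eval ρ α = J.k := h.var 8 (by omega)
  rw [Tr, fitsT, eval_arr hk fun i _ => eval_member ((h.setVar (x := 19) (by omega) i).setArr
    (A := 24) (by omega) _) (by rw [Function.update_of_ne (by omega)]; exact hP)
    (by rw [Function.update_of_ne (by omega)]; exact hb) (Function.update_self ..)]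
  change (and fitsT₁ fitsT₂).Tr _ _ ↔ _
  rw [tr_and]
  refine and_congr ?_ ?_
  · rw [fitsT₁, tr_all (n := J.t + 1) (by rw [eval, eval, eval, h.var 2 (by omega), V])]
    refine forall₂_congr fun i hi => ?_
    set ρ' := Function.update ρ 20 i with hρ'
    set α' := Function.update α 24 (clip J.k fun d => ind (∃ i < J.t + 1,
      J.Need (J.sizeOf cT a) (J.loadOf cT a) u w i ∧ b i = d)) with hα'
    have h' : Env J inp cW cT a 15 20 ρ' α' :=
      (h.setVar (x := 20) (by omega) i).setArr (A := 24) (by omega) _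
    have hi' : (var 20).eval ρ' α' = i := eval_var (Function.update_self ..)
    have hu' : (var 16).eval ρ' α' = u := by simp [eval, hρ', hρu]
    have hw' : (var 17).eval ρ' α' = w := by simp [eval, hρ', hρw]
    have hb' : (get 23 (var 20)).eval ρ' α' = b i :=
      eval_get (by rw [hα', Function.update_of_ne (by omega)]; exact hb) hi' hi
    have hP' : α' 21 = clip (J.t + 1) fun i =>
      ind (J.Need (J.sizeOf cT a) (J.loadOf cT a) u w i) := by
        rw [hα', Function.update_of_ne (by omega)]; exact hP
    have hwo := eval_worst h' (by omega) hw' hb' hw (hbk i hi)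
    rw [tr_imp, tr_get hP' hi' hi]
    refine imp_congr_right fun _ => ?_
    rw [tr_and, tr_valid h' (by omega) hw' hb' hw (hbk i hi), tr_and,
      tr_lt (eval_rc hr h' (by omega) (by omega) hw' hu' hw hu)
        (eval_rc hr h' (by omega) (by omega) hw' hwo hw worst_lt), tr_imp,
      tr_lt hi' (y := J.t) (h'.eval 2 (by omega))]
    refine and_congr_right fun _ => and_congr_right fun _ => forall_congr' fun hit => ?_
    rw [tr_iff (eval_tau hr h' (by omega) hwo hi' worst_lt hit)]
  · rw [fitsT₂, tr_all (n := J.t) ((h.setArr (A := 24) (by omega) _).eval 2 (by omega))]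
    refine forall₂_congr fun z hz => ?_
    set ρ' := Function.update ρ 20 z with hρ'
    set α' := Function.update α 24 (clip J.k fun d => ind (∃ i < J.t + 1,
      J.Need (J.sizeOf cT a) (J.loadOf cT a) u w i ∧ b i = d)) with hα'
    have h' : Env J inp cW cT a 15 20 ρ' α' :=
      (h.setVar (x := 20) (by omega) z).setArr (A := 24) (by omega) _
    have hz' : (var 20).eval ρ' α' = z := eval_var (Function.update_self ..)
    have hu' : (var 16).eval ρ' α' = u := by simp [eval, hρ', hρu]
    have hw' : (var 17).eval ρ' α' = w := by simp [eval, hρ', hρw]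
    refine tr_le ?_ ?_
    · rw [eval, eval_lo hr h' (by omega) (by omega) hw' hz' hw hz, eval]
      congr 1
      rw [show (var 8).eval ρ' α' = J.k from h'.var 8 (by omega)]
      refine Finset.sum_congr rfl fun d hd => ?_
      have hd := Finset.mem_range.1 hd
      set ρ'' := Function.update ρ' 19 d with hρ''
      have h'' : Env J inp cW cT a 15 20 ρ'' α' := h'.setVar (x := 19) (by omega) d
      have hd' : (var 19).eval ρ'' α' = d := eval_var (Function.update_self ..)
      have hw'' : (var 17).eval ρ'' α' = w := by rw [← hw']; simp [eval, hρ'']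
      have hz'' : (var 20).eval ρ'' α' = z := by rw [← hz']; simp [eval, hρ'']
      rw [eval, eval_tau hr h'' (by omega) (eval_worst h'' (by omega) hw'' hd' hw hd) hz''
        worst_lt hz]
      have hm := tr_get (α := α') (A := 24) (D := var 19) (ρ := ρ'') (i := d) (n := J.k)
        (P := fun d => ∃ i < J.t + 1, J.Need (J.sizeOf cT a) (J.loadOf cT a) u w i ∧ b i = d)
        (Function.update_self ..) hd' hd
      rw [Tr] at hm
      classical exact if_congr hm rfl rfl
    · rw [eval, eval_load h' (by omega) hw' hz' hw hz, eval_tau hr h' (by omega) hu' hz' hu hz]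

/-- Needed because the digits of a number recover a tuple only at its first `t + 1` places. -/
theorem fits_congr {N : ℕ → ℕ} {S d : ℕ → ℕ → ℕ} {b b' : ℕ → ℕ} (h : ∀ i < J.t + 1, b i = b' i) :
    J.Fits N S d u w b ↔ J.Fits N S d u w b' := by
  have : ∀ j, (∃ i < J.t + 1, J.Need N S u w i ∧ b i = j) ↔
      ∃ i < J.t + 1, J.Need N S u w i ∧ b' i = j := fun j =>
    exists_congr fun i => and_congr_right fun hi => by rw [h i hi]
  rw [NumInst.Fits, NumInst.Fits]
  refine and_congr (forall₂_congr fun i hi => by rw [h i hi]) (forall₂_congr fun z _ => ?_)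
  have e : ∀ j, (open Classical in if ∃ i < J.t + 1, J.Need N S u w i ∧ b i = j then J.τ (d w j) z
      else 0) = open Classical in if ∃ i < J.t + 1, J.Need N S u w i ∧ b' i = j then J.τ (d w j) z
      else 0 := fun j => by classical exact if_congr (this j) rfl rfl
  rw [Finset.sum_congr rfl fun j _ => e j]

/-- The existential quantifier over tuples becomes a sum over the numbers below `k ^ (t + 1)`, whose
digits in base `k` run through all tuples. -/
theorem tr_blk (hr : Reads J inp) (h : Env J inp cW cT a 15 20 ρ α)
    (hu : u < J.n) (hw : w < J.m) (hρu : ρ 16 = u) (hρw : ρ 17 = w) :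
    blkT.Tr ρ α ↔ J.Blk (J.sizeOf cT a) (J.loadOf cT a) (J.worst cW) u w := by
  rw [blkT, tr_and, tr_iff (eval_rs hr h (by omega) (by omega) (eval_var hρu) (eval_var hρw) hu hw), NumInst.Blk]
  refine and_congr_right fun _ => ?_
  rw [Tr, eval_arr (n := J.t + 1) (by rw [eval, eval, eval, h.var 2 (by omega), V]) fun i _ =>
    eval_bool (tr_need hr ((h.setVar (x := 18) (by omega) i).setArr (A := 21) (by omega) _) hu hw
      (d := i) (by simp [hρu]) (by simp [hρw]) (Function.update_self ..))]
  set α' := Function.update α 21 (clip (J.t + 1) fun i =>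
    ind (J.Need (J.sizeOf cT a) (J.loadOf cT a) u w i)) with hα'
  have h' : Env J inp cW cT a 15 20 ρ α' := h.setArr (A := 21) (by omega) _
  have ht : ∀ (x i : ℕ) (β : ℕ → ℕ → ℕ), 15 ≤ x →
      (add (var 2) (num 1)).eval (Function.update ρ x i) β = J.t + 1 := fun x i β hx => by
    rw [eval, eval, eval, Function.update_of_ne (by omega), h.var 2 (by omega), V]
  have hk8 : α' 8 = clip (J.t + 2) fun i => J.k ^ i := by rw [h'.arr 8 (by omega), Arr]
  have hN : (get 8 (add (var 2) (num 1))).eval ρ α' = J.k ^ (J.t + 1) := by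
    refine eval_get hk8 ?_ (by omega)
    rw [eval, eval, eval, h'.var 2 (by omega), V]
  change (sum 18 _ _).Tr _ _ ↔ _
  rw [tr_sum hN]
  have key : ∀ c < J.k ^ (J.t + 1), (withDigits 22 8 (add (var 2) (num 1)) (var 18) fitsT).Tr
      (Function.update ρ 18 c) α' ↔ J.Fits (J.sizeOf cT a) (J.loadOf cT a) (J.worst cW) u w
        fun i => c / J.k ^ i % J.k := by
    intro c hc
    have ht' : ∀ i β, (add (var 2) (num 1)).eval
        (Function.update (Function.update ρ 18 c) 31 i) β = J.t + 1 := fun i β => by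
      rw [eval, eval, eval, Function.update_of_ne (by omega), Function.update_of_ne (by omega),
        h.var 2 (by omega), V]
    rw [Tr, eval_withDigits (by omega) (by omega) hk8 (ht _ _ _ (by omega)) (fun i g => ht' i _)
      (fun g => ht _ _ _ (by omega)) (fun i g g' => ht' i _)
      (fun i g => by simp [eval]) hc]
    refine tr_fits hr ?_ hu hw (by simp [hρu]) (by simp [hρw]) ?_
      (Function.update_self ..) fun i _ => Nat.mod_lt _ ?_
    · exact ((h'.setVar (by omega) _).setArr (A := 22) (by omega) _).setArr (A := 23) (by omega) _
    · rw [Function.update_of_ne (by omega), Function.update_of_ne (by omega), hα',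
        Function.update_self]
    · exact (Nat.zero_le _).trans_lt (J.tid_lt 0 J.n_pos)
  constructor
  · rintro ⟨c, hc, hfit⟩
    exact ⟨_, fun i _ => Nat.mod_lt _ ((Nat.zero_le _).trans_lt (J.tid_lt 0 J.n_pos)),
      (key c hc).1 hfit⟩
  · rintro ⟨b, hb, hfit⟩
    refine ⟨_, sum_digits_lt hb, (key _ (sum_digits_lt hb)).2 ?_⟩
    exact (fits_congr fun i hi => digit_sum_digits hb hi).2 hfit

theorem eval_blkArr (hr : Reads J inp) (h : Env J inp cW cT a 15 20 ρ α) {q : ℕ}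
    (hq : q < J.n * J.m) (hρ : ρ 15 = q) : blkArrT.eval ρ α =
      ind (J.Blk (J.sizeOf cT a) (J.loadOf cT a) (J.worst cW) (q / J.m) (q % J.m)) := by
  have hm : 0 < J.m := Nat.pos_of_mul_pos_left (by omega : 0 < J.n * J.m)
  refine eval_bool ?_
  rw [Tr, eval, eval, eval, eval, hρ, h.var 1 (by omega), V, eval, eval, eval, eval,
    Function.update_of_ne (show 15 ≠ 16 by omega), Function.update_of_ne (show 1 ≠ 16 by omega),
    hρ, h.var 1 (by omega), V]
  exact tr_blk hr ((h.setVar (by omega) _).setVar (by omega) _) (Nat.div_lt_of_lt_mul (by rwa [mul_comm]))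
    (Nat.mod_lt _ hm) (by simp) (by simp)

theorem tr_opt (hr : Reads J inp) (h : Env J inp cW cT a 15 21 ρ α) {o : ℕ}
    (hu : u < J.n) (ho : o < J.m + 1) (hρu : ρ 16 = u) (hρo : ρ 17 = o) :
    optT.Tr ρ α ↔ J.Opt (J.sizeOf cT a) (J.loadOf cT a) (J.worst cW) u o := by
  rw [optT, tr_and, tr_and, NumInst.Opt]
  refine and_congr ?_ (and_congr ?_ ?_)
  · rw [optT₁, tr_all (n := J.m) (h.eval 1 (by omega))]
    refine forall₂_congr fun w hw => ?_
    rw [tr_all (n := J.k) (by rw [eval, Function.update_of_ne (by omega)]; exact h.var 8 (by omega))]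
    refine forall₂_congr fun d hd => ?_
    set ρ' := Function.update (Function.update ρ 18 w) 19 d with hρ'
    have h' : Env J inp cW cT a 15 21 ρ' α := (h.setVar (by omega) _).setVar (by omega) _
    have hw' : (var 18).eval ρ' α = w := by simp [eval, hρ']
    have hd' : (var 19).eval ρ' α = d := by simp [eval, hρ']
    have hu' : (var 16).eval ρ' α = u := by simp [eval, hρ', hρu]
    have ho' : (var 17).eval ρ' α = o := by simp [eval, hρ', hρo]
    rw [tr_imp, tr_and, tr_valid h' (by omega) hw' hd' hw hd,
      tr_eq (eval_worst h' (by omega) hw' hd' hw hd) hu',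
      tr_eq (x := w + 1) (by rw [eval, hw', eval]) ho', and_imp]
  · rw [optT₂, tr_all (n := J.m) (h.eval 1 (by omega))]
    refine forall₂_congr fun w hw => ?_
    set ρ' := Function.update ρ 18 w with hρ'
    have h' : Env J inp cW cT a 15 21 ρ' α := h.setVar (by omega) _
    have hw' : (var 18).eval ρ' α = w := by simp [eval, hρ']
    have hu' : (var 16).eval ρ' α = u := by simp [eval, hρ', hρu]
    have ho' : (var 17).eval ρ' α = o := by simp [eval, hρ', hρo]
    rw [tr_imp, tr_get (h'.arr 20 (by omega)) (i := u * J.m + w) ?_ (mul_add_lt_mul hu hw),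
      mul_add_div_eq hw, mul_add_mod_eq hw]
    · refine imp_congr_right fun _ => ?_
      rw [tr_and, tr_iff ho']
      refine and_congr_right fun ho0 => ?_
      rw [tr_le (eval_rs hr h' (by omega) (by omega) hu' (w := o - 1) (by rw [eval, ho', eval]) hu
        (by omega)) (eval_rs hr h' (by omega) (by omega) hu' hw' hu hw), not_lt]
    · rw [eval, hw', eval, hu', h'.arr 2 (by omega), Arr, clip_of_lt _ hu]
  · rw [optT₃, tr_imp, tr_iff (eval_var hρo)]
    refine forall_congr' fun ho0 => ?_
    have ho' : (sub (var 17) (num 1)).eval ρ α = o - 1 := by rw [eval, eval, eval, hρo]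
    have hu' : (var 16).eval ρ α = u := eval_var hρu
    have hd' : (get 5 (var 16)).eval ρ α = J.tid u := eval_get (h.arr 5 (by omega)) hu' hu
    rw [tr_and, tr_and, tr_iff (eval_rs hr h (by omega) (by omega) hu' ho' hu (by omega)),
      tr_valid h (by omega) ho' hd' (by omega) (J.tid_lt u hu),
      tr_le (eval_rc hr h (by omega) (by omega) ho' hu' (by omega) hu)
        (eval_rc hr h (by omega) (by omega) ho'
          (eval_worst h (by omega) ho' hd' (by omega) (J.tid_lt u hu)) (by omega) worst_lt)]

theorem eval_optArr (hr : Reads J inp) (h : Env J inp cW cT a 15 21 ρ α) {q : ℕ}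
    (hq : q < J.n * (J.m + 1)) (hρ : ρ 15 = q) : optArrT.eval ρ α =
      ind (J.Opt (J.sizeOf cT a) (J.loadOf cT a) (J.worst cW) (q / (J.m + 1)) (q % (J.m + 1))) := by
  refine eval_bool ?_
  have h₁ : (add (var 1) (num 1)).eval ρ α = J.m + 1 := by
    rw [eval, eval, eval, h.var 1 (by omega), V]
  have h₂ : ∀ i, (add (var 1) (num 1)).eval (Function.update ρ 16 i) α = J.m + 1 := fun i => by
    rw [eval, eval, eval, Function.update_of_ne (by omega), h.var 1 (by omega), V]
  rw [Tr, eval, eval, eval, hρ, h₁, eval, eval, eval, h₂,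
    Function.update_of_ne (show 15 ≠ 16 by omega), hρ]
  exact tr_opt hr ((h.setVar (by omega) _).setVar (by omega) _)
    (Nat.div_lt_of_lt_mul (by rwa [mul_comm])) (Nat.mod_lt _ (by omega)) (by simp) (by simp)

theorem tr_feas (hr : Reads J inp) (h : Env J inp cW cT a 15 20 ρ α) :
    feasT.Tr ρ α ↔ J.Feas (J.sizeOf cT a) (J.loadOf cT a) := by
  rw [feasT, tr_all (n := J.m) (h.eval 1 (by omega))]
  refine forall₂_congr fun w hw => ?_
  set ρ' := Function.update ρ 15 w with hρ'
  have h' : Env J inp cW cT a 15 20 ρ' α := h.setVar (by omega) _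
  have hw' : (var 15).eval ρ' α = w := by simp [eval, hρ']
  rw [tr_and, tr_le (eval_size h' (by omega) hw' hw) (eval_cp hr h' (by omega) (by omega) hw' hw),
    tr_all (n := J.t) (h'.eval 2 (by omega))]
  refine and_congr_right fun _ => forall₂_congr fun z hz => ?_
  set ρ'' := Function.update ρ' 16 z with hρ''
  have h'' : Env J inp cW cT a 15 20 ρ'' α := h'.setVar (by omega) _
  have hw'' : (var 15).eval ρ'' α = w := by simp [eval, hρ'', hρ']
  have hz'' : (var 16).eval ρ'' α = z := by simp [eval, hρ'']
  rw [tr_and, tr_le (eval_lo hr h'' (by omega) (by omega) hw'' hz'' hw hz)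
    (eval_load h'' (by omega) hw'' hz'' hw hz),
    tr_le (eval_load h'' (by omega) hw'' hz'' hw hz)
      (eval_up hr h'' (by omega) (by omega) hw'' hz'' hw hz)]

theorem eval_wt (h : Env J inp cW cT a v j ρ α) (hj : 11 < j) {O : Term} {o : ℕ}
    (hU : U.eval ρ α = u) (hO : O.eval ρ α = o) (hu : u < J.n) (ho : o < J.m + 1) :
    (wtT U O).eval ρ α = J.wt u o := by
  simp only [wtT, eval, hU, hO, h.arr 11 (by omega), h.arr 10 (by omega), Arr]
  rw [clip_of_lt _ hu, clip_of_lt _ (mul_add_lt_mul hu ho), mul_add_div_eq ho, mul_add_mod_eq ho]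

theorem tr_optGet (h : Env J inp cW cT a v j ρ α) (hj : 21 < j) {O : Term} {o : ℕ}
    (hU : U.eval ρ α = u) (hO : O.eval ρ α = o) (hu : u < J.n) (ho : o < J.m + 1) :
    (get 21 (add (get 10 U) O)).Tr ρ α ↔
      J.Opt (J.sizeOf cT a) (J.loadOf cT a) (J.worst cW) u o := by
  rw [tr_get (h.arr 21 (by omega)) (i := u * (J.m + 1) + o) ?_ (mul_add_lt_mul hu ho),
    mul_add_div_eq ho, mul_add_mod_eq ho]
  rw [eval, eval, hU, hO, h.arr 10 (by omega), Arr, clip_of_lt _ hu]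

theorem eval_count (h : Env J inp cW cT a 15 22 ρ α) {p : ℕ}
    (hp : p < (J.n + 1) * J.n ^ J.numT) :
    let L := fun u o => ind (J.Opt (J.sizeOf cT a) (J.loadOf cT a) (J.worst cW) u o)
    let c := fun p => count J.m L J.wt (p / J.n ^ J.numT) (p % J.n ^ J.numT)
    countT.eval (Function.update ρ 15 p) (Function.update α 22 (clip p c)) = c p := by
  intro L c
  set s := J.n ^ J.numT with hs
  have hs0 : 0 < s := pow_pos J.n_pos _
  set ρ' := Function.update ρ 15 p with hρ'
  set α' := Function.update α 22 (clip p c) with hα'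
  have h' : Env J inp cW cT a 15 22 ρ' α' := (h.setVar (by omega) _).setArr (by omega) _
  have hp' : ρ' 15 = p := Function.update_self ..
  have h11 : ρ' 11 = s := h'.var 11 (by omega)
  have hlt := tr_lt (ρ := ρ') (α := α') (a := var 15) (b := var 11) hp' h11
  rw [Tr] at hlt
  -- The eighth equation of `eval` is that of `ite`. It opens the branching on `p < s` and leaves
  -- the bound variables for later.
  simp only [countT, eval.eq_8]
  simp only [hlt]
  by_cases hps : p < s
  · have hc : c p = if p = 0 then 1 else 0 := by
      simp only [c, ← hs, Nat.div_eq_of_lt hps, Nat.mod_eq_of_lt hps, count]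
    rw [if_pos hps, hc]
    simp only [eval, hp']
    by_cases h0 : p = 0 <;> simp [h0]
  · rw [if_neg hps]
    have hdiv : p / s = (p - s) / s + 1 := Nat.div_eq_sub_div hs0 (by omega)
    have hmod : p % s = (p - s) % s := by rw [Nat.mod_eq_sub_mod (by omega)]
    have hlt' : (p - s) / s < J.n := by
      have : p / s < J.n + 1 := Nat.div_lt_of_lt_mul (by rwa [mul_comm])
      omega
    have hc : c p = ∑ o ∈ Finset.range (J.m + 1), if L ((p - s) / s) o ≠ 0 ∧
        J.wt ((p - s) / s) o ≤ p % s then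
          count J.m L J.wt ((p - s) / s) (p % s - J.wt ((p - s) / s) o) else 0 := by
      simp only [c, ← hs]
      rw [hdiv, count]
    have e₁ : (sub (get 12 (var 15)) (num 1)).eval ρ' α' = (p - s) / s := by
      rw [eval, eval, eval, eval, hp', h'.arr 12 (by omega), Arr, clip_of_lt _ hp, ← hs, hdiv,
        Nat.add_sub_cancel]
    rw [hc, eval, e₁]
    set ρ₁ := Function.update ρ' 16 ((p - s) / s) with hρ₁
    have h₁ : Env J inp cW cT a 15 22 ρ₁ α' := h'.setVar (by omega) _
    have e₂ : (get 13 (var 15)).eval ρ₁ α' = p % s :=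
      eval_get (f := fun p => p % s) (h₁.arr 13 (by omega)) (by simp [eval, hρ₁, hp']) hp
    rw [eval, e₂]
    set ρ₂ := Function.update ρ₁ 17 (p % s) with hρ₂
    have h₂ : Env J inp cW cT a 15 22 ρ₂ α' := h₁.setVar (by omega) _
    rw [eval, show (add (var 1) (num 1)).eval ρ₂ α' = J.m + 1 by
      rw [eval, eval, eval, h₂.var 1 (by omega), V]]
    refine Finset.sum_congr rfl fun o ho => ?_
    have ho := Finset.mem_range.1 ho
    set ρ₃ := Function.update ρ₂ 18 o with hρ₃
    have h₃ : Env J inp cW cT a 15 22 ρ₃ α' := h₂.setVar (by omega) _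
    have hu₃ : (var 16).eval ρ₃ α' = (p - s) / s := by simp [eval, hρ₃, hρ₂, hρ₁]
    have ho₃ : (var 18).eval ρ₃ α' = o := by simp [eval, hρ₃]
    have hs₃ : (var 17).eval ρ₃ α' = p % s := by simp [eval, hρ₃, hρ₂]
    have hp₃ : (var 15).eval ρ₃ α' = p := by simp [eval, hρ₃, hρ₂, hρ₁, hp']
    have h11₃ : (var 11).eval ρ₃ α' = s := h₃.var 11 (by omega)
    have hwt := eval_wt h₃ (by omega) hu₃ ho₃ hlt' ho
    have htr : (and (get 21 (add (get 10 (var 16)) (var 18))) (le (wtT (var 16) (var 18))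
        (var 17))).eval ρ₃ α' ≠ 0 ↔ L ((p - s) / s) o ≠ 0 ∧ J.wt ((p - s) / s) o ≤ p % s := by
      change Term.Tr _ _ _ ↔ _
      rw [tr_and, tr_optGet h₃ (by omega) hu₃ ho₃ hlt' ho, tr_le hwt hs₃, ind_ne_zero]
    rw [eval]
    simp only [htr]
    split_ifs with hif
    · rw [eval, eval, hwt, eval, hp₃, h11₃, hα', Function.update_self, clip_of_lt _ (by omega)]
      have hpos : p - s = p % s + (p - s) / s * s := by
        rw [hmod, mul_comm]; exact (Nat.mod_add_div _ _).symm
      have hle := hif.2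
      have hmlt := Nat.mod_lt p hs0
      -- Since the weight is at most the remainder, subtracting it borrows nothing from the part
      -- that encodes the student.
      have heq : p - s - J.wt ((p - s) / s) o =
          (p - s) / s * s + (p % s - J.wt ((p - s) / s) o) := by omega
      simp only [c, ← hs]
      rw [heq, mul_add_div_eq (by omega), mul_add_mod_eq (by omega)]
    · rfl

theorem tr_reach (h : Env J inp cW cT a 15 22 ρ α) (hcT : cT < J.n ^ J.numT) :
    reachT.Tr ρ α ↔
      J.Reach (J.Opt (J.sizeOf cT a) (J.loadOf cT a) (J.worst cW)) J.n cT := by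
  have hN : (mul (add (var 0) (num 1)) (var 11)).eval ρ α = (J.n + 1) * J.n ^ J.numT := by
    refine eval_mul ?_ fun i => ?_
    · rw [eval, eval, eval, h.var 0 (by omega), V]
    · rw [eval, Function.update_of_ne (by omega), h.var 11 (by omega), V]
  rw [Tr, reachT, eval_arr hN fun p hp => eval_count h hp]
  have hM : ∀ β, (mul (var 0) (var 11)).eval ρ β = J.n * J.n ^ J.numT := fun β => by
    refine eval_mul ?_ fun i => ?_
    · rw [eval, h.var 0 (by omega), V]
    · rw [eval, Function.update_of_ne (by omega), h.var 11 (by omega), V]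
  rw [eval, eval, hM, eval, h.var 13 (by omega), V, Function.update_self,
    clip_of_lt _ (mul_add_lt_mul (by omega) hcT), mul_add_div_eq hcT, mul_add_mod_eq hcT]
  exact count_ne_zero_iff _ _ fun v _ o _ => ind_ne_zero

theorem tr_test (h : Env J inp cW cT a 15 22 ρ α) (hcT : cT < J.n ^ J.numT) (ha : a < J.m + 1) :
    testT.Tr ρ α ↔ if a = 0 then
      J.Reach (J.Opt (J.sizeOf cT a) (J.loadOf cT a) (J.worst cW)) J.n cT
      else ∀ u < J.n, J.Opt (J.sizeOf cT a) (J.loadOf cT a) (J.worst cW) u a := by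
  have h14 : (var 14).eval ρ α = a := h.var 14 (by omega)
  rw [testT, tr_ite (tr_iff h14), tr_reach h hcT, tr_all (n := J.n) (h.eval 0 (by omega))]
  have : ∀ u < J.n, (get 21 (add (get 10 (var 15)) (var 14))).Tr (Function.update ρ 15 u) α ↔
      J.Opt (J.sizeOf cT a) (J.loadOf cT a) (J.worst cW) u a := fun u hu =>
    tr_optGet (h.setVar (x := 15) (by omega) u) (by omega) (by simp [eval])
      (by rw [← h14]; simp [eval]) hu ha
  have h' : (∀ i < J.n, (get 21 (add (get 10 (var 15)) (var 14))).Tr (Function.update ρ 15 i) α) ↔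
      ∀ u < J.n, J.Opt (J.sizeOf cT a) (J.loadOf cT a) (J.worst cW) u a :=
    forall₂_congr this
  rw [h']
  split_ifs with ha0 <;> simp [ha0]

end

end Alg

end RAM

/-! ### Step counts for one guess -/

namespace RAM

namespace Term

theorem cost_arr_le_of_forall {ρ : ℕ → ℕ} {α : ℕ → ℕ → ℕ} {A x : ℕ} {N f b : Term} {n cN B cb : ℕ}
    (hn : N.eval ρ α = n) (hN : N.cost ρ α ≤ cN)
    (hf : ∀ i < n, ∀ g, f.cost (Function.update ρ x i) (Function.update α A g) ≤ B)
    (hb : ∀ g, b.cost ρ (Function.update α A g) ≤ cb) :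
    (arr A x N f b).cost ρ α ≤ cN + n * (B + 90) + cb + 20 := by
  rw [cost, hn]
  have h₁ : ∑ i ∈ Finset.range n, (f.cost (Function.update ρ x i) (Function.update α A
      (build (fun i g => f.eval (Function.update ρ x i) (Function.update α A g)) i)) + 90) ≤
      n * (B + 90) := by
    refine (Finset.sum_le_card_nsmul _ _ (B + 90) fun i hi => ?_).trans (by simp)
    have := hf i (Finset.mem_range.1 hi) (build (fun i g => f.eval (Function.update ρ x i)
      (Function.update α A g)) i)
    omega
  have h₂ := hb (build (fun i g => f.eval (Function.update ρ x i) (Function.update α A g)) n)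
  omega

end Term

open Term NumInst

theorem _root_.NumInst.k_pos (J : NumInst) : 0 < J.k := (Nat.zero_le _).trans_lt (J.tid_lt 0 J.n_pos)

namespace Alg

section

variable {J : NumInst} {inp : ℕ → ℕ} {cW cT a v j : ℕ} {ρ : ℕ → ℕ} {α : ℕ → ℕ → ℕ}

theorem eval_m_add_one (h : Env J inp cW cT a v j ρ α) (hv : 1 < v) :
    (add (var 1) (num 1)).eval ρ α = J.m + 1 := by rw [eval, eval, eval, h.var 1 hv, V]

theorem eval_t_add_one (h : Env J inp cW cT a v j ρ α) (hv : 2 < v) :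
    (add (var 2) (num 1)).eval ρ α = J.t + 1 := by rw [eval, eval, eval, h.var 2 hv, V]

theorem cost_member_le (h : Env J inp cW cT a 15 9 ρ α) :
    memberT.cost ρ α ≤ (J.t + 1) * 600 + 100 :=
  (cost_bool_le (cost_sum_le (cN := 8) (B := 500) (cost_flat rfl (by decide))
    (eval_t_add_one h (by omega)) fun i _ => cost_flat rfl (by decide))).trans (by omega)

theorem cost_fits_le (h : Env J inp cW cT a 15 9 ρ α) :
    fitsT.cost ρ α ≤ 12000 * ((J.t + 1) * J.k) := by
  have h₁ : ∀ g, fitsT₁.cost ρ (Function.update α 24 g) ≤ 8 + (J.t + 1) * (4000 + 18) + 20 :=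
    fun g => cost_all_le (cost_flat rfl (by decide))
      (eval_t_add_one (h.setArr (A := 24) (by omega) g) (by omega))
      fun i _ => cost_flat rfl (by decide)
  have h₂ : ∀ g, fitsT₂.cost ρ (Function.update α 24 g) ≤
      2 + J.t * ((2 + J.k * (1200 + 12) + 14 + 600 + 4) + 1000 + 10 + 18) + 20 := fun g =>
    cost_all_le le_rfl ((h.setArr (A := 24) (by omega) g).eval 2 (by omega)) fun i _ =>
      cost_le_le (y := 1000) (cost_add_le (y := 600) (cost_sum_le (B := 1200) le_rfl
        (((h.setArr (A := 24) (by omega) g).setVar (x := 20) (by omega) i).eval 8 (by omega))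
          fun _ _ => cost_flat rfl (by decide)) (cost_flat rfl (by decide)))
        (cost_flat rfl (by decide))
  refine (cost_arr_le_of_forall (cN := 2) (h.eval 8 (by omega)) le_rfl (fun i _ g =>
    cost_member_le ((h.setVar (by omega) i).setArr (A := 24) (by omega) g))
    fun g => cost_and_le (h₁ g) (h₂ g)).trans ?_
  have hk := J.k_pos
  have := Nat.mul_le_mul_left J.t hk
  simp only [V]
  linarith

/-- There are `k ^ (t + 1)` tuples. For each of them the check runs over bounds and types, of order
`(t + 1) * k`, which also covers extracting the digits. -/
theorem cost_blk_le (h : Env J inp cW cT a 15 9 ρ α) :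
    blkT.cost ρ α ≤ 30000 * (J.k ^ (J.t + 1) * ((J.t + 1) * J.k)) := by
  have h₁ : ∀ g, ∀ c < J.k ^ (J.t + 1), (withDigits 22 8 (add (var 2) (num 1)) (var 18) fitsT).cost
      (Function.update ρ 18 c) (Function.update α 21 g) ≤
      (J.t + 1 + 1) * (2 * 8 + 2 + 28 * J.k + 800) + 2 * 8 + 12000 * ((J.t + 1) * J.k) := by
    intro g c hc
    have h' := (h.setArr (A := 21) (by omega) g).setVar (x := 18) (by omega) c
    refine cost_withDigits (by omega) (by omega) (h'.arr 8 (by omega))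
      (eval_t_add_one h' (by omega)) (fun i g => eval_t_add_one ((h'.setVar (by omega) i).setArr
        (A := 22) (by omega) g) (by omega)) (fun g => eval_t_add_one (h'.setArr
        (A := 22) (by omega) g) (by omega)) (fun i g g' => eval_t_add_one (((h'.setVar
          (by omega) i).setArr (A := 22) (by omega) g).setArr (A := 23) (by omega) g') (by omega))
      (fun i g => by simp [eval]) hc (fun _ _ => cost_flat rfl (by decide)) (fun _ _ => le_rfl) ?_
    exact cost_fits_le ((h'.setArr (A := 22) (by omega) _).setArr (A := 23) (by omega) _)
  have hN : ∀ g, (get 8 (add (var 2) (num 1))).eval ρ (Function.update α 21 g) =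
      J.k ^ (J.t + 1) := fun g =>
    have h' := h.setArr (A := 21) (by omega) g
    eval_get (f := fun i => J.k ^ i) (h'.arr 8 (by omega)) (eval_t_add_one h' (by omega)) (by omega)
  refine (cost_and_le (x := 500) (cost_flat rfl (by decide)) (cost_arr_le_of_forall (cN := 8)
    (B := 1500) (eval_t_add_one h (by omega)) (cost_flat rfl (by decide))
    (fun i _ g => cost_flat rfl (by decide)) fun g => cost_sum_le (cN := 100)
      (n := J.k ^ (J.t + 1)) (cost_flat rfl (by decide)) (hN g) (h₁ g))).trans ?_
  · have hk := J.k_pos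
    have hZ : J.t + 1 ≤ (J.t + 1) * J.k := Nat.le_mul_of_pos_right _ hk
    have hk' : J.k ≤ (J.t + 1) * J.k := Nat.le_mul_of_pos_left _ (by omega)
    have hX : 0 < J.k ^ (J.t + 1) := pow_pos hk _
    have e : (J.t + 1 + 1) * (2 * 8 + 2 + 28 * J.k + 800) + 2 * 8 + 12000 * ((J.t + 1) * J.k) + 12 ≤
        15000 * ((J.t + 1) * J.k) := by linarith
    have := Nat.mul_le_mul_left (J.k ^ (J.t + 1)) e
    have h₂ : (J.t + 1) * J.k ≤ J.k ^ (J.t + 1) * ((J.t + 1) * J.k) :=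
      Nat.le_mul_of_pos_left _ hX
    have h₃ : J.k ^ (J.t + 1) * (15000 * ((J.t + 1) * J.k)) =
      15000 * (J.k ^ (J.t + 1) * ((J.t + 1) * J.k)) := by ring
    omega

theorem cost_blkArr_le (h : Env J inp cW cT a 15 9 ρ α) {q : ℕ} (hq : q < J.n * J.m)
    (hρ : ρ 15 = q) :
    blkArrT.cost ρ α ≤ 40000 * (J.n + J.k ^ (J.t + 1) * ((J.t + 1) * J.k)) := by
  have hdiv : q / J.m ≤ J.n := (Nat.div_lt_of_lt_mul (by rwa [mul_comm])).le
  refine (cost_bool_le (cost_bind_le (cost_quo_le (eval_var hρ) (h.eval 1 (by omega)) (ca := 2)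
    (cb := 2) le_rfl le_rfl hdiv) rfl (cost_bind_le (cost_rem_le (x := q) (eval_var ?_)
      ((h.setVar (x := 16) (by omega) _).eval 1 (by omega)) (ca := 2) (cb := 2) le_rfl le_rfl hdiv)
      rfl (cost_blk_le ((h.setVar (x := 16) (by omega) _).setVar (x := 17) (by omega) _))))).trans ?_
  · rw [Function.update_of_ne (by omega), hρ]
  · have := J.n_pos
    omega

theorem cost_opt_le (h : Env J inp cW cT a 15 9 ρ α) :
    optT.cost ρ α ≤ 8000 * (J.n + J.m * J.k) := by
  have h₁ : optT₁.cost ρ α ≤ 2 + J.m * (2 + J.k * (2000 + 18) + 20 + 18) + 20 :=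
    cost_all_le le_rfl (h.eval 1 (by omega)) fun i _ => cost_all_le le_rfl
      ((h.setVar (by omega) i).eval 8 (by omega)) fun _ _ => cost_flat rfl (by decide)
  have h₂ : optT₂.cost ρ α ≤ 2 + J.m * (2000 + 18) + 20 :=
    cost_all_le le_rfl (h.eval 1 (by omega)) fun i _ => cost_flat rfl (by decide)
  refine (cost_and_le h₁ (cost_and_le h₂ (y := 4000) (cost_flat rfl (by decide)))).trans ?_
  have := Nat.le_mul_of_pos_right J.m J.k_pos
  have := J.n_pos
  linarith

theorem cost_optArr_le (h : Env J inp cW cT a 15 9 ρ α) {q : ℕ} (hq : q < J.n * (J.m + 1))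
    (hρ : ρ 15 = q) : optArrT.cost ρ α ≤ 9000 * (J.n + J.m * J.k) := by
  have hdiv : q / (J.m + 1) ≤ J.n := (Nat.div_lt_of_lt_mul (by rwa [mul_comm])).le
  refine (cost_bool_le (cost_bind_le (cost_quo_le (eval_var hρ) (eval_m_add_one h (by omega))
    (ca := 2) (cb := 8) le_rfl le_rfl hdiv) rfl (cost_bind_le (cost_rem_le (x := q) (eval_var ?_)
      (eval_m_add_one (h.setVar (x := 16) (by omega) _) (by omega)) (ca := 2) (cb := 8) le_rfl
      le_rfl hdiv) rfl
      (cost_opt_le ((h.setVar (x := 16) (by omega) _).setVar (x := 17) (by omega) _))))).trans ?_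
  · rw [Function.update_of_ne (by omega), hρ]
  · have := J.n_pos
    omega

theorem cost_feas_le (h : Env J inp cW cT a 15 9 ρ α) :
    feasT.cost ρ α ≤ 3000 * (J.m * (J.t + 1)) + 22 := by
  refine (cost_all_le (cN := 2) le_rfl (h.eval 1 (by omega)) fun i _ => cost_and_le (x := 500)
    (cost_flat rfl (by decide)) (cost_all_le (cN := 2) (B := 2000) le_rfl
      ((h.setVar (by omega) i).eval 2 (by omega)) fun _ _ => cost_flat rfl (by decide))).trans ?_
  have := Nat.zero_le (J.m * J.t)
  simp only [V]
  linarith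

/-- The dynamic program dominates: its entries number `(n + 1) * n ^ numT`, and each sums over `m +
1` options at constant cost. -/
theorem cost_test_le (h : Env J inp cW cT a 15 9 ρ α) :
    testT.cost ρ α ≤ 5000 * ((J.n + 1) * J.n ^ J.numT * (J.m + 1)) := by
  have hvar : ∀ i, (var 11).eval (Function.update ρ 31 i) α = J.n ^ J.numT := fun i =>
    (h.setVar (x := 31) (by omega) i).eval 11 (by omega)
  have hcount : ∀ ρ' α', Env J inp cW cT a 15 9 ρ' α' → countT.cost ρ' α' ≤
      500 + (J.m + 1) * 1500 := fun ρ' α' h' => by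
    refine (cost_ite_le (x := 10) (y := 20) (cost_flat rfl (by decide))
      (cost_flat rfl (by decide)) (cost_bind_le (ca := 100) (cost_flat rfl (by decide)) rfl
        (cost_bind_le (ca := 100) (cost_flat rfl (by decide)) rfl
          (cost_sum_le (cN := 8) (B := 1400) (n := J.m + 1) (cost_flat rfl (by decide))
            (eval_m_add_one ((h'.setVar (by omega) _).setVar (by omega) _) (by omega))
            fun _ _ => cost_flat rfl (by decide))))).trans (by omega)
  have hreach : reachT.cost ρ α ≤ 3000 * ((J.n + 1) * J.n ^ J.numT * (J.m + 1)) +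
      40 * (J.n + 1) + 300 := by
    refine (cost_arr_le_of_forall (n := (J.n + 1) * J.n ^ J.numT) (cN := 8 + (J.n + 1) * 14 + 14)
      (cb := 8 + (J.n + 1) * 14 + 200)
      (eval_mul (by rw [eval, eval, eval, h.var 0 (by omega), V]) hvar)
      (cost_mul_le (x := J.n + 1) (by rw [eval, eval, eval, h.var 0 (by omega), V]) le_rfl
        fun i => le_rfl) (fun i _ g => hcount _ _ ((h.setVar (by omega) i).setArr (by omega) g))
      fun g => ?_).trans ?_
    · have := cost_mul_le (a := var 0) (b := var 11)
        ((h.setArr (A := 22) (by omega) g).eval 0 (by omega)) (ca := 2) le_rfl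
        (cb := 2) fun i => le_rfl
      rw [V] at this
      rw [cost, cost, cost]
      omega
    · have := Nat.le_mul_of_pos_right ((J.n + 1) * J.n ^ J.numT) (Nat.succ_pos J.m)
      rw [Nat.succ_eq_add_one] at this
      have := Nat.zero_le ((J.n + 1) * J.n ^ J.numT * (J.m + 1))
      linarith
  refine (cost_ite_le (x := 2) le_rfl (cost_all_le (cN := 2) (B := 300) le_rfl (h.eval 0 (by omega))
    fun _ _ => cost_flat rfl (by decide)) hreach).trans ?_
  have h₁ := Nat.le_mul_of_pos_right (J.n + 1) (pow_pos J.n_pos J.numT)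
  have h₂ := Nat.le_mul_of_pos_right ((J.n + 1) * J.n ^ J.numT) (Nat.succ_pos J.m)
  rw [Nat.succ_eq_add_one] at h₂
  simp only [V]
  linarith

end

end Alg

end RAM

/-! ### Comparison of the step counts with the claimed bound -/

namespace NumInst

variable {J : NumInst}

/-- The order of the number of steps for one guess. -/
def budget (J : NumInst) : ℕ := J.n ^ ((J.m + 1) * (J.t + 1)) * (J.m * (J.n ^ J.t * J.t + J.m))

/-- The order of the number of steps for all guesses. -/
def fullBudget (J : NumInst) : ℕ := J.n ^ (J.m * J.k) * (J.n ^ J.numT * (J.m * J.budget))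

/-- There are colleges, and the number of types is bounded as it should be. -/
structure Small (J : NumInst) : Prop where
  m_pos : 0 < J.m
  k_le : J.k ≤ J.n
  k_le_two_pow : J.k ≤ 2 ^ J.t

theorem le_budget {x y : ℕ} (hx : x ≤ J.n ^ ((J.m + 1) * (J.t + 1)))
    (hy : y ≤ J.n ^ J.t * J.t + J.m) : x * (J.m * y) ≤ J.budget :=
  Nat.mul_le_mul hx (Nat.mul_le_mul_left _ hy)

theorem pow_le_pow_budget {i : ℕ} (hi : i ≤ (J.m + 1) * (J.t + 1)) :
    J.n ^ i ≤ J.n ^ ((J.m + 1) * (J.t + 1)) := Nat.pow_le_pow_right J.n_pos hi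

namespace Small

theorem two_le (h : J.Small) : 2 ≤ (J.m + 1) * (J.t + 1) :=
  Nat.mul_le_mul (show 2 ≤ J.m + 1 from Nat.succ_le_succ h.m_pos) (show 1 ≤ J.t + 1 by omega)

theorem t_add_one_le (h : J.Small) : J.t + 1 ≤ J.n ^ J.t * J.t + J.m :=
  Nat.add_le_add (Nat.le_mul_of_pos_left _ (pow_pos J.n_pos _)) h.m_pos

theorem sq_mul_le (h : J.Small) : J.n * J.n * (J.m * J.m) ≤ J.budget := by
  refine le_budget ?_ (Nat.le_add_left _ _)
  rw [← pow_two]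
  exact pow_le_pow_budget h.two_le

theorem sq_mul_le' (h : J.Small) : J.n * J.n * (J.m * (J.t + 1)) ≤ J.budget := by
  refine le_budget ?_ h.t_add_one_le
  rw [← pow_two]
  exact pow_le_pow_budget h.two_le

/-- Bounding `k` by `n` gives `n ^ (t + 3)`, which fits below `n ^ (2 * (t + 1))` only for `t ≥ 1`.
For `t = 0` there is a single type, so the power of `k` is at most 1. -/
theorem tuples_le (h : J.Small) :
    J.n * J.m * (J.k ^ (J.t + 1) * ((J.t + 1) * J.k)) ≤ J.budget := by
  have : J.n * J.m * (J.k ^ (J.t + 1) * ((J.t + 1) * J.k)) =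
      J.n * J.k ^ (J.t + 2) * (J.m * (J.t + 1)) := by ring
  rw [this]
  refine le_budget ?_ h.t_add_one_le
  rcases Nat.eq_zero_or_pos J.t with ht | ht
  · have hk : J.k ≤ 1 := by simpa [ht] using h.k_le_two_pow
    calc J.n * J.k ^ (J.t + 2) ≤ J.n * 1 ^ (J.t + 2) :=
          Nat.mul_le_mul_left _ (Nat.pow_le_pow_left hk _)
      _ = J.n ^ 1 := by simp
      _ ≤ _ := pow_le_pow_budget (by have := h.two_le; omega)
  · calc J.n * J.k ^ (J.t + 2) ≤ J.n * J.n ^ (J.t + 2) :=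
          Nat.mul_le_mul_left _ (Nat.pow_le_pow_left h.k_le _)
      _ = J.n ^ (J.t + 3) := by ring
      _ ≤ _ := pow_le_pow_budget ?_
    calc J.t + 3 ≤ 2 * (J.t + 1) := by omega
      _ ≤ _ := Nat.mul_le_mul_right _ (Nat.succ_le_succ h.m_pos)

theorem digits_le (h : J.Small) : 0 < J.budget ∧
    (J.numT + 1) * (28 * J.n + 806) + 4 ≤ 10000 * J.budget ∧
    (J.m * J.k + 1) * (28 * J.n + 806) + 4 ≤ 10000 * J.budget := by
  have hn := J.n_pos
  have hm := h.m_pos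
  have b₁ := h.sq_mul_le
  have b₂ := h.sq_mul_le'
  have c₁ : J.n * (J.m * (J.t + 1)) ≤ J.n * J.n * (J.m * (J.t + 1)) :=
    Nat.mul_le_mul_right _ (Nat.le_mul_of_pos_left _ hn)
  have c₂ : J.m * (J.t + 1) ≤ J.n * (J.m * (J.t + 1)) := Nat.le_mul_of_pos_left _ hn
  have c₃ : J.n ≤ J.n * (J.m * (J.t + 1)) :=
    Nat.le_mul_of_pos_right _ (Nat.mul_pos hm (Nat.succ_pos _))
  have c₄ : J.n * (J.m * J.k) ≤ J.n * J.n * (J.m * J.m) := by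
    calc J.n * (J.m * J.k) = J.n * J.k * (J.m * 1) := by ring
      _ ≤ _ := Nat.mul_le_mul (Nat.mul_le_mul_left _ h.k_le) (Nat.mul_le_mul_left _ hm)
  have c₅ : J.m * J.k ≤ J.n * (J.m * J.k) := Nat.le_mul_of_pos_left _ hn
  have e : J.numT = J.m * (J.t + 1) := by rw [numT]; ring
  rw [e]
  generalize J.m * (J.t + 1) = x at *
  generalize J.m * J.k = y at *
  refine ⟨by omega, by linarith, by linarith⟩

/-- As `numT = m * (t + 1)`, the exponent `numT + 1` is at most `(m + 1) * (t + 1)`; this is the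
room that the dynamic program needs. -/
theorem sums_le (h : J.Small) : J.n * J.n ^ J.numT * J.m ≤ J.budget := by
  have := le_budget (J := J) (x := J.n * J.n ^ J.numT) (y := 1) ?_ (h.m_pos.trans_le
    (Nat.le_add_left _ _))
  · rwa [mul_one] at this
  · rw [← pow_succ']
    refine pow_le_pow_budget ?_
    rw [numT]
    ring_nf
    omega

/-- Finding the first student of each type takes time of order `n ^ 3 * t`. It is done only once, so
one factor `n` may be taken from the number of guesses of worst students. -/
theorem cube_le (h : J.Small) : J.n * J.n * J.n * (J.t + 1) ≤ J.fullBudget := by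
  have h₁ : J.n ≤ J.n ^ (J.m * J.k) :=
    Nat.le_self_pow (Nat.mul_pos h.m_pos J.k_pos).ne' _
  have h₂ : J.t + 1 ≤ J.m * (J.t + 1) := Nat.le_mul_of_pos_left _ h.m_pos
  calc J.n * J.n * J.n * (J.t + 1) = J.n * (1 * (1 * (J.n * J.n * (J.t + 1)))) := by ring
    _ ≤ J.n ^ (J.m * J.k) * (J.n ^ J.numT * (J.m * J.budget)) :=
      Nat.mul_le_mul h₁ (Nat.mul_le_mul (pow_pos J.n_pos _) (Nat.mul_le_mul h.m_pos
        ((Nat.mul_le_mul_left _ h₂).trans h.sq_mul_le')))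

theorem budget_le (h : J.Small) : J.budget ≤ J.fullBudget :=
  (Nat.le_mul_of_pos_left _ h.m_pos).trans ((Nat.le_mul_of_pos_left _ (pow_pos J.n_pos _)).trans
    (Nat.le_mul_of_pos_left _ (pow_pos J.n_pos _)))

theorem setup_le (h : J.Small) : J.n * J.n * J.n ≤ J.fullBudget ∧
    J.n * J.n * J.n * J.t ≤ J.fullBudget ∧ J.n * J.m * J.n ≤ J.fullBudget ∧
    J.n * J.m * J.t ≤ J.fullBudget ∧ J.n * (J.m * J.k) ≤ J.fullBudget ∧
    J.n * J.n ^ J.numT ≤ J.fullBudget := by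
  have hG := h.budget_le
  have c := h.cube_le
  have hn := J.n_pos
  have hm := h.m_pos
  have h₁ : J.n * J.m * J.n ≤ J.n * J.n * (J.m * J.m) := by
    calc J.n * J.m * J.n = J.n * J.n * (J.m * 1) := by ring
      _ ≤ _ := Nat.mul_le_mul_left _ (Nat.mul_le_mul_left _ hm)
  have h₂ : J.n * J.m * J.t ≤ J.n * J.n * (J.m * (J.t + 1)) := by
    calc J.n * J.m * J.t = J.n * 1 * (J.m * J.t) := by ring
      _ ≤ _ := Nat.mul_le_mul (Nat.mul_le_mul_left _ hn) (Nat.mul_le_mul_left _ (by omega))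
  have h₃ : J.n * (J.m * J.k) ≤ J.n * J.m * J.n := by
    rw [mul_assoc]
    exact Nat.mul_le_mul_left _ (Nat.mul_le_mul_left _ h.k_le)
  have h₄ : J.n * J.n ^ J.numT ≤ J.n * J.n ^ J.numT * J.m := Nat.le_mul_of_pos_right _ hm
  have b₁ := h.sq_mul_le
  have b₂ := h.sq_mul_le'
  have b₃ := h.sums_le
  rw [mul_add, mul_one] at c
  exact ⟨by omega, by omega, by omega, by omega, by omega, by omega⟩

/-- The exponents `m * k`, `m * (t + 1)` and `(m + 1) * (t + 1)` add up, and `k ≤ 2 ^ t`. One factor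
`m` comes from the choices of `a`, the other from the test of one guess. -/
theorem fullBudget_le (h : J.Small) : J.fullBudget ≤
    J.n ^ (J.m * 2 ^ J.t + (2 * J.m + 1) * (J.t + 1)) * J.m ^ 2 * (J.n ^ J.t * J.t + J.m) := by
  have : J.fullBudget = J.n ^ (J.m * J.k + (2 * J.m + 1) * (J.t + 1)) * J.m ^ 2 *
      (J.n ^ J.t * J.t + J.m) := by
    rw [fullBudget, budget, numT, show J.m * J.k + (2 * J.m + 1) * (J.t + 1) =
      J.m * J.k + (J.m + J.m * J.t + (J.m + 1) * (J.t + 1)) by ring, pow_add, pow_add]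
    ring
  rw [this]
  refine Nat.mul_le_mul_right _ (Nat.mul_le_mul_right _ (Nat.pow_le_pow_right J.n_pos ?_))
  exact Nat.add_le_add_right (Nat.mul_le_mul_left _ h.k_le_two_pow) _

end Small

end NumInst

/-! ### Meaning and cost combined; the test of one guess -/

namespace RAM

open Term NumInst

theorem Reads.small {J : NumInst} {inp : ℕ → ℕ} (hr : Reads J inp) (hm : 0 < J.m) : J.Small :=
  ⟨hm, hr.k.trans_le (TypeId.num_le _), hr.k.trans_le (TypeId.num_le_two_pow J.τ_le _)⟩

/-- The term decides `P` with cost at most `c`. -/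
structure Spec (e : Term) (ρ : ℕ → ℕ) (α : ℕ → ℕ → ℕ) (P : Prop) (c : ℕ) : Prop where
  tr : e.Tr ρ α ↔ P
  cost : e.cost ρ α ≤ c

namespace Spec

variable {ρ : ℕ → ℕ} {α : ℕ → ℕ → ℕ} {P Q : Prop} {c c' : ℕ}

theorem mono {e : Term} (h : Spec e ρ α P c) (hc : c ≤ c') : Spec e ρ α P c' :=
  ⟨h.tr, h.cost.trans hc⟩

theorem and {a b : Term} (ha : Spec a ρ α P c) (hb : Spec b ρ α Q c') :
    Spec (a.and b) ρ α (P ∧ Q) (c + c' + 4) :=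
  ⟨tr_and.trans (and_congr ha.tr hb.tr), cost_and_le ha.cost hb.cost⟩

theorem bind {x v ca : ℕ} {a b : Term} (hv : a.eval ρ α = v) (ha : a.cost ρ α ≤ ca)
    (h : Spec b (Function.update ρ x v) α P c) : Spec (bind x a b) ρ α P (ca + c + 8) :=
  ⟨by rw [Tr, eval, hv]; exact h.tr, cost_bind_le ha hv h.cost⟩

theorem sum {x n cN B : ℕ} {N b : Term} {p : ℕ → Prop} (hn : N.eval ρ α = n) (hN : N.cost ρ α ≤ cN)
    (h : ∀ i < n, Spec b (Function.update ρ x i) α (p i) B) :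
    Spec (sum x N b) ρ α (∃ i < n, p i) (cN + n * (B + 12) + 14) :=
  ⟨(tr_sum hn).trans (exists_congr fun i => and_congr_right fun hi => (h i hi).tr),
    cost_sum_le hN hn fun i hi => (h i hi).cost⟩

theorem arr {A x n cN B : ℕ} {N f b : Term} {g : ℕ → ℕ} (hn : N.eval ρ α = n)
    (hN : N.cost ρ α ≤ cN)
    (H : ∀ i < n, f.eval (Function.update ρ x i) (Function.update α A (clip i g)) = g i)
    (hf : ∀ i < n, f.cost (Function.update ρ x i) (Function.update α A (clip i g)) ≤ B)
    (h : Spec b ρ (Function.update α A (clip n g)) P c) :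
    Spec (arr A x N f b) ρ α P (cN + n * (B + 90) + c + 20) :=
  ⟨by rw [Tr, eval_arr hn H]; exact h.tr, cost_arr_le hn H hN hf h.cost⟩

theorem multiples {A n x cN cv : ℕ} {N v b : Term} (hn : N.eval ρ α = n) (hN : N.cost ρ α ≤ cN)
    (hv : ∀ i g, v.eval (Function.update ρ 31 i) (Function.update α A g) = x)
    (hcv : ∀ i g, v.cost (Function.update ρ 31 i) (Function.update α A g) ≤ cv)
    (h : Spec b ρ (Function.update α A (clip n fun i => i * x)) P c) :
    Spec (withMultiples A N v b) ρ α P (cN + n * (cv + 200) + c + 20) :=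
  ⟨by rw [Tr, eval_withMultiples hn hv]; exact h.tr, cost_withMultiples hn hv hN hcv h.cost⟩

theorem powers {A n x cN cv : ℕ} {N v b : Term} (hn : N.eval ρ α = n) (hN : N.cost ρ α ≤ cN)
    (hv : ∀ i g, v.eval (Function.update ρ 30 i) (Function.update α A g) = x)
    (hcv : ∀ i g, v.cost (Function.update ρ 30 i) (Function.update α A g) ≤ cv)
    (h : Spec b ρ (Function.update α A (clip n fun i => x ^ i)) P c) :
    Spec (withPowers A N v b) ρ α P (cN + n * (cv + 100 * x + 120) + c + 20) :=
  ⟨by rw [Tr, eval_withPowers hn hv]; exact h.tr, cost_withPowers hn hv hN hcv h.cost⟩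

theorem digits {A B d r n x y N : ℕ} {b : Term} (hA : A < B) (hN : n < N)
    (hα : α A = clip N fun i => x ^ i) (hd : ρ d = n) (hd' : d < 31) (hr : ρ r = y) (hr' : r < 31)
    (hy : y < x ^ n)
    (h : Spec b ρ (Function.update (Function.update α B (clip (n + 1) fun i => y % x ^ (n - i)))
      (B + 1) (clip n fun i => y / x ^ i % x)) P c) :
    Spec (withDigits B A (var d) (var r) b) ρ α P ((n + 1) * (28 * x + 806) + 4 + c) := by
  have e : ∀ i β, (var d).eval (Function.update ρ 31 i) β = n := fun i β =>
    eval_var (by rw [Function.update_of_ne hd'.ne, hd])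
  have e' : ∀ i β, (var r).eval (Function.update ρ 31 i) β = y := fun i β =>
    eval_var (by rw [Function.update_of_ne hr'.ne, hr])
  refine ⟨?_, (cost_withDigits hA hN hα (eval_var hd) (fun i g => e i _)
    (fun _ => eval_var hd) (fun i _ _ => e i _) (fun i _ => e' i _) hy (fun _ _ => le_rfl)
    (fun _ _ => le_rfl) h.cost).trans (by ring_nf; exact le_rfl)⟩
  rw [Tr, eval_withDigits hA hN hα (eval_var hd) (fun i g => e i _)
    (fun _ => eval_var hd) (fun i _ _ => e i _) (fun i _ => e' i _) hy]
  exact h.tr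

end Spec

namespace Alg

/-- The size of college `15` according to the guess. -/
def sizeOfT : Term :=
  ite (var 14) (ite (eq (add (var 15) (num 1)) (var 14)) (var 0) (num 0)) (get 17 (var 15))

/-- The load `15` according to the guess. -/
def loadOfT : Term :=
  ite (var 14)
    (bind 16 (get 1 (sub (var 14) (num 1)))
      (ite (and (le (var 16) (var 15)) (lt (var 15) (add (var 16) (var 2))))
        (get 9 (sub (var 15) (var 16))) (num 0)))
    (get 17 (add (var 1) (var 15)))

def checkT : Term :=
  arr 18 15 (var 1) sizeOfT (arr 19 15 (sub (var 10) (var 1)) loadOfT (and feasT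
    (arr 20 15 (mul (var 0) (var 1)) blkArrT
      (arr 21 15 (mul (var 0) (add (var 1) (num 1))) optArrT testT))))

section

variable {J : NumInst} {inp : ℕ → ℕ} {cW cT a v j : ℕ} {ρ : ℕ → ℕ} {α : ℕ → ℕ → ℕ}

theorem eval_sizeOf (h : Env J inp cW cT a 15 18 ρ α) {w : ℕ} (hw : w < J.m) (hρ : ρ 15 = w) :
    sizeOfT.eval ρ α = J.sizeOf cT a w := by
  rw [sizeOfT, eval, show (var 14).eval ρ α = a from h.var 14 (by omega), NumInst.sizeOf]
  by_cases ha : a = 0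
  · rw [if_neg (by simpa using ha), if_pos ha]
    exact eval_get (f := fun i => cT / J.n ^ i % J.n) (h.arr 17 (by omega)) hρ
      (by rw [numT]; omega)
  · rw [if_pos ha, if_neg ha, eval, eval_eq (x := w + 1) (y := a) (by rw [eval, eval, eval, hρ])
      (h.eval 14 (by omega)), show (var 0).eval ρ α = J.n from h.var 0 (by omega), eval]
    split_ifs <;> simp_all

theorem eval_loadOf (h : Env J inp cW cT a 15 18 ρ α) {q : ℕ} (hq : q < J.m * J.t) (hρ : ρ 15 = q)
    (ha' : a < J.m + 1) : loadOfT.eval ρ α = J.loadOf cT a (q / J.t) (q % J.t) := by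
  have ht : 0 < J.t := Nat.pos_of_mul_pos_left (by omega : 0 < J.m * J.t)
  rw [loadOfT, eval, show (var 14).eval ρ α = a from h.var 14 (by omega), loadOf]
  by_cases ha : a = 0
  · rw [if_neg (by simpa using ha), if_pos ha, Nat.div_add_mod']
    exact eval_get (f := fun i => cT / J.n ^ i % J.n) (h.arr 17 (by omega))
      (by rw [eval, eval, eval, hρ, h.var 1 (by omega), V]) (by rw [numT]; omega)
  · rw [if_pos ha, if_neg ha, eval, eval_get (f := fun i => i * J.t) (i := a - 1)
      (h.arr 1 (by omega)) (by rw [eval, eval, eval, h.var 14 (by omega), V]) (by omega)]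
    set ρ' := Function.update ρ 16 ((a - 1) * J.t) with hρ'
    have h' : Env J inp cW cT a 15 18 ρ' α := h.setVar (by omega) _
    have h₁ : (var 15).eval ρ' α = q := by simp [eval, hρ', hρ]
    have h₂ : (var 16).eval ρ' α = (a - 1) * J.t := by simp [eval, hρ']
    -- Whether load `q` belongs to college `a - 1` is decided by comparing `q` with two consecutive
    -- multiples of `t`, which avoids dividing by `t`.
    have hc : (and (le (var 16) (var 15)) (lt (var 15) (add (var 16) (var 2)))).Tr ρ' α ↔
        q / J.t + 1 = a := by
      rw [tr_and, tr_le h₂ h₁, tr_lt h₁ (y := (a - 1) * J.t + J.t)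
        (by rw [eval, h₂, eval, h'.var 2 (by omega), V])]
      have : q / J.t + 1 = a ↔ q / J.t = a - 1 := by omega
      rw [this, Nat.div_eq_iff ht]
      have : (a - 1) * J.t + J.t = (a - 1 + 1) * J.t := by ring
      constructor
      · rintro ⟨h₁, h₂⟩
        exact ⟨h₁, by omega⟩
      · rintro ⟨h₁, h₂⟩
        exact ⟨h₁, by omega⟩
    rw [eval]
    rw [Tr] at hc
    simp only [hc]
    refine if_ctx_congr Iff.rfl (fun hqa => ?_) fun _ => rfl
    have e : (a - 1) * J.t = q / J.t * J.t := by rw [← hqa, Nat.add_sub_cancel]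
    have hmod := Nat.div_add_mod' q J.t
    exact eval_get (f := J.total) (h'.arr 9 (by omega)) (by rw [eval, h₁, h₂, e]; omega)
      (Nat.mod_lt _ ht)

/-- The costs to be absorbed are those of `n * m` admission tests, of `n * (m + 1)` options, of
feasibility and of the dynamic program. Each is of the order of the budget, by `tuples_le`,
`sq_mul_le`, `sq_mul_le'` and `sums_le`. -/
theorem spec_check (hr : Reads J inp) (hm : 0 < J.m) (h : Env J inp cW cT a 15 18 ρ α)
    (hcT : cT < J.n ^ J.numT) (ha : a < J.m + 1) :
    Spec checkT ρ α (J.Accepts cW cT a) (200000 * J.budget) := by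
  have hN₁ : ∀ g, (sub (var 10) (var 1)).eval ρ (Function.update α 18 g) = J.m * J.t := fun g => by
    rw [eval, eval, eval, h.var 10 (by omega), h.var 1 (by omega), V, V, numT]
    omega
  have hN₂ : ∀ β, (mul (var 0) (var 1)).eval ρ β = J.n * J.m := fun β => by
    refine eval_mul (eval_var (h.var 0 (by omega))) fun i => ?_
    exact eval_var (by rw [Function.update_of_ne (by omega)]; exact h.var 1 (by omega))
  have hN₃ : ∀ β, (mul (var 0) (add (var 1) (num 1))).eval ρ β = J.n * (J.m + 1) := fun β => by
    refine eval_mul (eval_var (h.var 0 (by omega))) fun i => ?_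
    rw [eval, eval, eval, Function.update_of_ne (by omega), h.var 1 (by omega), V]
  have E₁ : ∀ w < J.m, _ := fun w hw => eval_sizeOf ((h.setVar (x := 15) (by omega) w).setArr
    (A := 18) (by omega) (clip w (J.sizeOf cT a))) hw (Function.update_self ..)
  have h₁ : Env J inp cW cT a 15 19 ρ (Function.update α 18 (clip J.m (J.sizeOf cT a))) :=
    h.nextArr rfl
  have E₂ : ∀ q < J.m * J.t, _ := fun q hq => eval_loadOf ((h₁.setVar (x := 15) (by omega) q).setArr
    (A := 19) (by omega) (clip q fun q => J.loadOf cT a (q / J.t) (q % J.t))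
      |>.mono le_rfl (by omega)) hq (Function.update_self ..) ha
  have h₂ : Env J inp cW cT a 15 20 ρ _ := h₁.nextArr rfl
  have E₃ : ∀ q < J.n * J.m, _ := fun q hq => eval_blkArr hr ((h₂.setVar (x := 15) (by omega)
    q).setArr (A := 20) (by omega) (clip q fun q => ind (J.Blk (J.sizeOf cT a) (J.loadOf cT a)
      (J.worst cW) (q / J.m) (q % J.m)))) hq (Function.update_self ..)
  have h₃ : Env J inp cW cT a 15 21 ρ _ := h₂.nextArr rfl
  have E₄ : ∀ q < J.n * (J.m + 1), _ := fun q hq => eval_optArr hr ((h₃.setVar (x := 15) (by omega)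
    q).setArr (A := 21) (by omega) (clip q fun q => ind (J.Opt (J.sizeOf cT a) (J.loadOf cT a)
      (J.worst cW) (q / (J.m + 1)) (q % (J.m + 1))))) hq (Function.update_self ..)
  have h₄ : Env J inp cW cT a 15 22 ρ _ := h₃.nextArr rfl
  have hfeas : Spec feasT ρ _ _ _ := ⟨tr_feas hr h₂, cost_feas_le (h₂.mono le_rfl (by omega))⟩
  have htest : Spec testT ρ _ _ _ := ⟨tr_test h₄ hcT ha, cost_test_le (h₄.mono le_rfl (by omega))⟩
  have hopt := Spec.arr (hN₃ _) (cost_mul_le (ca := 2) (cb := 8) (h₃.eval 0 (by omega)) le_rfl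
    fun _ => le_rfl) E₄ (fun q hq => cost_optArr_le (((h₃.setVar (by omega) q).setArr (A := 21)
      (by omega) _).mono le_rfl (by omega)) hq (Function.update_self ..)) htest
  have hblk := Spec.arr (hN₂ _) (cost_mul_le (ca := 2) (cb := 2) (h₂.eval 0 (by omega)) le_rfl
    fun _ => le_rfl) E₃ (fun q hq => cost_blkArr_le (((h₂.setVar (by omega) q).setArr (A := 20)
      (by omega) _).mono le_rfl (by omega)) hq (Function.update_self ..)) hopt
  have hload := Spec.arr (cN := 8) (B := 800) (hN₁ _) le_rfl E₂
    (fun _ _ => cost_flat rfl (by decide)) (hfeas.and hblk)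
  have hall := Spec.arr (cN := 2) (B := 400) (h.eval 1 (by omega)) le_rfl E₁
    (fun _ _ => cost_flat rfl (by decide)) hload
  refine hall.mono ?_
  have hs := hr.small hm
  have hn := J.n_pos
  have hk := J.k_pos
  have b₁ := hs.sq_mul_le
  have b₂ := hs.sq_mul_le'
  have b₃ := hs.tuples_le
  have b₄ := hs.sums_le
  have c₁ : J.m * (J.t + 1) ≤ J.budget :=
    (Nat.le_mul_of_pos_left _ (Nat.mul_pos hn hn)).trans b₂
  have c₂ : J.n * J.m * J.n ≤ J.budget :=
    le_trans (by rw [mul_right_comm]; exact Nat.mul_le_mul_left _ (Nat.le_mul_of_pos_left _ hm)) b₁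
  have c₃ : J.n * J.m * (J.m * J.k) ≤ J.budget := by
    refine le_trans (le_of_eq_of_le (show _ = J.n * J.k * (J.m * J.m) by ring) ?_) b₁
    exact Nat.mul_le_mul_right _ (Nat.mul_le_mul_left _ hs.k_le)
  have c₄ : J.n * J.m ≤ J.n * J.m * J.n := Nat.le_mul_of_pos_right _ hn
  have c₅ : J.n ≤ J.n * J.m := Nat.le_mul_of_pos_right _ hm
  have c₆ : J.n ^ J.numT * J.m ≤ J.n * J.n ^ J.numT * J.m :=
    Nat.mul_le_mul_right _ (Nat.le_mul_of_pos_left _ hn)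
  have c₇ : J.n ^ J.numT ≤ J.n ^ J.numT * J.m := Nat.le_mul_of_pos_right _ hm
  have c₈ : J.n * J.n ^ J.numT ≤ J.n * J.n ^ J.numT * J.m := Nat.le_mul_of_pos_right _ hm
  have c₉ : J.n * J.n ≤ J.n * J.m * J.n := Nat.mul_le_mul_right _ c₅
  have c₁₀ : J.n * (J.m * J.k) ≤ J.n * J.m * (J.m * J.k) := Nat.mul_le_mul_right _ c₅
  have c₁₁ : J.m ≤ J.m * (J.t + 1) := Nat.le_mul_of_pos_right _ (Nat.succ_pos _)
  have c₁₂ : J.m * J.t ≤ J.m * (J.t + 1) := Nat.mul_le_mul_left _ (by omega)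
  simp only [V]
  -- With the powers and `m * k` as atoms, the rest is a linear combination of the monomials bounded
  -- above.
  generalize J.n ^ J.numT = s at *
  generalize J.k ^ (J.t + 1) * ((J.t + 1) * J.k) = Y at *
  generalize J.m * J.k = Z at *
  linarith

end

end Alg

end RAM

/-! ### Enumeration of the guesses -/

namespace RAM

open Term NumInst

namespace Env

variable {J : NumInst} {inp : ℕ → ℕ} {cW cT a v j : ℕ} {ρ : ℕ → ℕ} {α : ℕ → ℕ → ℕ}

/-- The first variables and arrays do not depend on the guess. -/
theorem guess (h : Env J inp cW cT a v j ρ α) (hv : v ≤ 12) (hj : j ≤ 14) (cW' cT' a' : ℕ) :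
    Env J inp cW' cT' a' v j ρ α :=
  ⟨fun x hx => by rw [h.var x hx]; interval_cases v <;> interval_cases x <;> rfl,
    fun i hi => by rw [h.arr i hi]; interval_cases j <;> interval_cases i <;> rfl⟩

theorem guess₁ (h : Env J inp cW cT a v j ρ α) (hv : v ≤ 13) (hj : j ≤ 16) (cT' a' : ℕ) :
    Env J inp cW cT' a' v j ρ α :=
  ⟨fun x hx => by rw [h.var x hx]; interval_cases v <;> interval_cases x <;> rfl,
    fun i hi => by rw [h.arr i hi]; interval_cases j <;> interval_cases i <;> rfl⟩

theorem guess₂ (h : Env J inp cW cT a v j ρ α) (hv : v ≤ 14) (hj : j ≤ 18) (a' : ℕ) :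
    Env J inp cW cT a' v j ρ α :=
  ⟨fun x hx => by rw [h.var x hx]; interval_cases v <;> interval_cases x <;> rfl,
    fun i hi => by rw [h.arr i hi]; interval_cases j <;> interval_cases i <;> rfl⟩

end Env

namespace Alg

def guessT : Term :=
  sum 12 (get 7 (var 9)) (withDigits 14 7 (var 9) (var 12)
    (sum 13 (var 11) (withDigits 16 7 (var 10) (var 13)
      (sum 14 (add (var 1) (num 1)) checkT))))

variable {J : NumInst} {inp : ℕ → ℕ} {cW cT a v j : ℕ} {ρ : ℕ → ℕ} {α : ℕ → ℕ → ℕ}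

/-- Three nested sums search for an accepted guess. The digits of `cW` and `cT` are extracted as
soon as the number is fixed, at a cost within one budget by `digits_le`, so the inner loops only
read arrays. -/
theorem spec_guess (hr : Reads J inp) (hm : 0 < J.m) (h : Env J inp cW cT a 12 14 ρ α) :
    Spec guessT ρ α (∃ f, J.Stable f) (1000000 * J.fullBudget) := by
  have hs := hr.small hm
  have hD := hs.digits_le
  have h₁ : ∀ cW cT, cT < J.n ^ J.numT → ∀ ρ' α', Env J inp cW cT 0 14 18 ρ' α' →
      Spec (sum 14 (add (var 1) (num 1)) checkT) ρ' α' (∃ a < J.m + 1, J.Accepts cW cT a)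
        (500000 * (J.m * J.budget)) := by
    intro cW cT hcT ρ' α' h
    refine (Spec.sum (cN := 8) (eval_m_add_one h (by omega)) le_rfl fun a ha => spec_check hr hm
      ((h.guess₂ le_rfl le_rfl a).nextVar rfl) hcT ha).mono ?_
    have h₁ := Nat.le_mul_of_pos_left J.budget hm
    have h₂ : J.m ≤ J.m * J.budget := Nat.le_mul_of_pos_right _ hD.1
    have := hD.1
    linarith
  have h₂ : ∀ cW, cW < J.n ^ (J.m * J.k) → ∀ ρ' α', Env J inp cW 0 0 13 16 ρ' α' →
      Spec (sum 13 (var 11) (withDigits 16 7 (var 10) (var 13)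
        (sum 14 (add (var 1) (num 1)) checkT))) ρ' α'
        (∃ cT < J.n ^ J.numT, ∃ a < J.m + 1, J.Accepts cW cT a)
        (600000 * (J.n ^ J.numT * (J.m * J.budget))) := by
    intro cW hcW ρ' α' h
    refine (Spec.sum (cN := 2) (B := 510000 * (J.m * J.budget)) (h.eval 11 (by omega)) le_rfl fun cT hcT => ?_).mono ?_
    · have h' := (h.guess₁ le_rfl le_rfl cT 0).nextVar rfl
      refine (Spec.digits (by omega) (show J.numT < J.m * J.k + J.numT + 1 by omega)
        (h'.arr 7 (by omega)) (h'.var 10 (by omega)) (by omega) (h'.var 13 (by omega)) (by omega)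
        hcT (h₁ cW cT hcT _ _ ((h'.nextArr rfl).nextArr rfl))).mono ?_
      have h₁ := Nat.le_mul_of_pos_left J.budget hm
      have h₂ := hD.2.1
      have := hD.1
      linarith
    · have h₁ : 0 < J.n ^ J.numT := pow_pos J.n_pos _
      have h₂ : J.n ^ J.numT ≤ J.n ^ J.numT * (J.m * J.budget) :=
        Nat.le_mul_of_pos_right _ (Nat.mul_pos hm hD.1)
      simp only [V]
      linarith
  rw [exists_stable_iff]
  refine (Spec.sum (cN := 200) (B := 700000 * (J.n ^ J.numT * (J.m * J.budget)))
    (eval_get (f := fun i => J.n ^ i) (h.arr 7 (by omega))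
    (h.eval 9 (by omega)) (by simp only [V]; omega)) (cost_flat rfl (by decide))
    fun cW hcW => ?_).mono ?_
  · have h' := (h.guess le_rfl le_rfl cW 0 0).nextVar rfl
    refine (Spec.digits (by omega) (show J.m * J.k < J.m * J.k + J.numT + 1 by omega)
      (h'.arr 7 (by omega)) (h'.var 9 (by omega)) (by omega) (h'.var 12 (by omega)) (by omega)
      hcW (h₂ cW hcW _ _ ((h'.nextArr rfl).nextArr rfl))).mono ?_
    have h₁ := Nat.le_mul_of_pos_left J.budget hm
    have h₂ := hD.2.2
    have h₃ : J.m * J.budget ≤ J.n ^ J.numT * (J.m * J.budget) :=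
      Nat.le_mul_of_pos_left _ (pow_pos J.n_pos _)
    have := hD.1
    linarith
  · have h₂ : J.n ^ (J.m * J.k) ≤ J.fullBudget :=
      Nat.le_mul_of_pos_right _ (Nat.mul_pos (pow_pos J.n_pos _) (Nat.mul_pos hm hD.1))
    have h₁ : 0 < J.n ^ (J.m * J.k) := pow_pos J.n_pos _
    simp only [V]
    have h₃ : J.n ^ (J.m * J.k) * (700000 * (J.n ^ J.numT * (J.m * J.budget))) =
      700000 * J.fullBudget := by rw [fullBudget]; ring
    rw [mul_add, h₃]
    omega

end Alg

end RAM

/-! ### Tables computed before the enumeration -/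

namespace RAM

open Term NumInst

namespace Alg

/-- The first student with the type of student `15`. -/
def firstT : Term :=
  sum 16 (var 15) (ite (sum 17 (add (var 16) (num 1))
    (all 18 (var 2) (eq (tauT (var 17) (var 18)) (tauT (var 15) (var 18))))) (num 0) (num 1))

/-- The number of types. -/
def kT : Term := sum 15 (var 0) (eq (get 4 (var 15)) (var 15))

/-- The type of student `15`. -/
def tidT : Term := sum 16 (get 4 (var 15)) (eq (get 4 (var 16)) (var 16))

def totalT : Term := sum 16 (var 0) (tauT (var 16) (var 15))

/-- The product of a type entry and a power is replaced by a branching, as type entries are 0 or 1.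
-/
def wtEntryT : Term :=
  bind 16 (quo (var 15) (add (var 1) (num 1))) (bind 17 (rem (var 15) (add (var 1) (num 1)))
    (ite (var 17)
      (add (get 7 (sub (var 17) (num 1))) (sum 18 (var 2) (ite (tauT (var 16) (var 18))
        (get 7 (add (var 1) (add (get 1 (sub (var 17) (num 1))) (var 18)))) (num 0))))
      (num 0)))

/-- Quotient and remainder of `p` by `n ^ numT` follow from those of `p - n ^ numT` in constant
time; repeated subtraction would cost up to `n` rounds at every use in the dynamic program. -/
def rowT : Term :=
  ite (lt (var 15) (var 11)) (num 0) (add (get 12 (sub (var 15) (var 11))) (num 1))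

def colT : Term := ite (lt (var 15) (var 11)) (var 15) (get 13 (sub (var 15) (var 11)))

def sumsT : Term :=
  withMultiples 10 (var 0) (add (var 1) (num 1))
    (arr 11 15 (mul (var 0) (add (var 1) (num 1))) wtEntryT
      (arr 12 15 (mul (add (var 0) (num 1)) (var 11)) rowT
        (arr 13 15 (mul (add (var 0) (num 1)) (var 11)) colT guessT)))

/-- One array of powers of `n` serves worst students, tallies and weights; its length `m * k + numT
+ 1` exceeds every exponent in use. -/
def powersT : Term :=
  bind 9 (mul (var 1) (var 8)) (bind 10 (add (var 1) (mul (var 1) (var 2)))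
    (withPowers 7 (add (add (var 9) (var 10)) (num 1)) (var 0) (bind 11 (get 7 (var 10))
      (withPowers 8 (add (var 2) (num 2)) (var 8) (arr 9 15 (var 2) totalT sumsT)))))

def typesT : Term :=
  arr 4 15 (var 0) firstT (bind 8 kT (arr 5 15 (var 0) tidT
    (withMultiples 6 (var 1) (var 8) powersT)))

def tablesT : Term :=
  bind 3 (add (num 3) (mul (var 0) (var 2))) (bind 4 (add (var 3) (mul (var 0) (var 1)))
    (bind 5 (add (var 4) (mul (var 1) (var 0))) (bind 6 (add (var 5) (mul (var 1) (var 2)))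
      (bind 7 (add (var 6) (mul (var 1) (var 2))) (withMultiples 1 (add (var 0) (var 1)) (var 2)
        (withMultiples 2 (var 0) (var 1) (withMultiples 3 (var 1) (var 0) typesT)))))))

/-- The term that decides whether there is a feasible and stable matching. -/
def mainT : Term := bool tablesT

variable {J : NumInst} {inp : ℕ → ℕ} {cW cT a v j : ℕ} {ρ : ℕ → ℕ} {α : ℕ → ℕ → ℕ}

theorem eval_first (hr : Reads J inp) (h : Env J inp cW cT a 8 4 ρ α) {u : ℕ} (hu : u < J.n)
    (hρ : ρ 15 = u) : firstT.eval ρ α = TypeId.first J.t J.τ u := by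
  rw [firstT, eval, show (var 15).eval ρ α = u from hρ, TypeId.first]
  refine Finset.sum_congr rfl fun x hx => ?_
  have hx := Finset.mem_range.1 hx
  rw [eval]
  classical
  refine if_congr ?_ rfl rfl
  have h' := h.setVar (x := 16) (by omega) x
  change Tr _ _ _ ↔ _
  rw [tr_sum (n := x + 1) (by rw [eval, eval, eval, Function.update_self])]
  refine exists_congr fun y => and_congr_right fun hy => ?_
  have h'' := h'.setVar (x := 17) (by omega) y
  rw [tr_all (n := J.t) (h''.eval 2 (by omega))]
  refine forall₂_congr fun z hz => ?_
  have h₃ := h''.setVar (x := 18) (by omega) z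
  exact tr_eq (eval_tau hr h₃ (by omega) (u := y) (by simp [eval]) (z := z) (by simp [eval])
    (by omega) hz) (eval_tau hr h₃ (by omega) (u := u) (by simp [eval, hρ]) (z := z)
      (by simp [eval]) hu hz)

theorem cost_first_le (h : Env J inp cW cT a 8 4 ρ α) {u : ℕ} (hu : u < J.n) (hρ : ρ 15 = u) :
    firstT.cost ρ α ≤ J.n * (J.n * (J.t * 1018 + 34) + 40) + 16 := by
  refine (cost_sum_le (x := 16) (n := u) (cN := 2) (B := 8 + J.n * (J.t * 1018 + 34) + 20) le_rfl
    (eval_var hρ) fun x hx => ?_).trans ?_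
  · have h' := h.setVar (x := 16) (by omega) x
    refine (cost_ite_le (y := 2) (z := 2) (cost_sum_le (n := x + 1) (cN := 8) (B := J.t * 1018 + 22)
      le_rfl (by rw [eval, eval, eval, Function.update_self]) fun y _ => ?_) le_rfl le_rfl).trans ?_
    · exact (cost_all_le (cN := 2) (B := 1000) le_rfl ((h'.setVar (x := 17) (by omega) y).eval 2
        (by omega)) fun _ _ => cost_flat rfl (by decide)).trans (by simp only [V]; omega)
    · have := Nat.mul_le_mul_right (J.t * 1018 + 34) (show x + 1 ≤ J.n by omega)
      rw [show J.t * 1018 + 22 + 12 = J.t * 1018 + 34 by omega]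
      omega
  · have := Nat.mul_le_mul_right (8 + J.n * (J.t * 1018 + 34) + 20 + 12) hu.le
    rw [show 8 + J.n * (J.t * 1018 + 34) + 20 + 12 = J.n * (J.t * 1018 + 34) + 40 by omega] at *
    omega

theorem eval_kT (hr : Reads J inp) (h : Env J inp cW cT a 8 5 ρ α) : kT.eval ρ α = J.k := by
  rw [kT, eval, show (var 0).eval ρ α = J.n from h.var 0 (by omega), hr.k, TypeId.num]
  refine Finset.sum_congr rfl fun u hu => ?_
  exact eval_eq (eval_get (f := TypeId.first J.t J.τ) (h.arr 4 (by omega)) (by simp [eval])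
    (Finset.mem_range.1 hu)) (by simp [eval])

theorem cost_kT_le (h : Env J inp cW cT a 8 5 ρ α) : kT.cost ρ α ≤ 16 + J.n * 412 :=
  (cost_sum_le (cN := 2) (B := 400) le_rfl (h.eval 0 (by omega)) fun _ _ =>
    cost_flat rfl (by decide)).trans (by simp only [V]; omega)

theorem eval_tidT (hr : Reads J inp) (h : Env J inp cW cT a 9 5 ρ α) {u : ℕ} (hu : u < J.n)
    (hρ : ρ 15 = u) : tidT.eval ρ α = J.tid u := by
  have h4 := h.arr 4 (by omega)
  rw [tidT, eval, eval_get (f := TypeId.first J.t J.τ) h4 (eval_var hρ) hu, hr.tid u hu,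
    TypeId.num]
  refine Finset.sum_congr rfl fun x hx => ?_
  have := (TypeId.first_spec (t := J.t) (τ := J.τ) u).1
  have := Finset.mem_range.1 hx
  exact eval_eq (eval_get (f := TypeId.first J.t J.τ) h4 (by simp [eval]) (by omega))
    (by simp [eval])

theorem cost_tidT_le (h : Env J inp cW cT a 9 5 ρ α) {u : ℕ} (hu : u < J.n)
    (hρ : ρ 15 = u) : tidT.cost ρ α ≤ 114 + J.n * 412 := by
  have := (TypeId.first_spec (t := J.t) (τ := J.τ) u).1
  refine (cost_sum_le (cN := 100) (B := 400) (cost_flat rfl (by decide)) (eval_get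
    (f := TypeId.first J.t J.τ) (h.arr 4 (by omega)) (eval_var hρ) hu) fun _ _ =>
    cost_flat rfl (by decide)).trans ?_
  omega

theorem eval_total (hr : Reads J inp) (h : Env J inp cW cT a 12 9 ρ α) {z : ℕ} (hz : z < J.t)
    (hρ : ρ 15 = z) : totalT.eval ρ α = J.total z := by
  rw [totalT, eval, show (var 0).eval ρ α = J.n from h.var 0 (by omega), total]
  refine Finset.sum_congr rfl fun u hu => ?_
  exact eval_tau hr (h.setVar (x := 16) (by omega) u) (by omega) (by simp [eval])
    (by simp [eval, hρ]) (Finset.mem_range.1 hu) hz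

theorem cost_total_le (h : Env J inp cW cT a 12 9 ρ α) : totalT.cost ρ α ≤ 16 + J.n * 312 :=
  (cost_sum_le (cN := 2) (B := 300) le_rfl (h.eval 0 (by omega)) fun _ _ =>
    cost_flat rfl (by decide)).trans (by simp only [V]; omega)

theorem eval_wtEntry (hr : Reads J inp) (h : Env J inp cW cT a 12 11 ρ α) {q : ℕ}
    (hq : q < J.n * (J.m + 1)) (hρ : ρ 15 = q) :
    wtEntryT.eval ρ α = J.wt (q / (J.m + 1)) (q % (J.m + 1)) := by
  have hu : q / (J.m + 1) < J.n := Nat.div_lt_of_lt_mul (by rwa [mul_comm])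
  have ho : q % (J.m + 1) < J.m + 1 := Nat.mod_lt _ (by omega)
  have h' := h.setVar (x := 16) (by omega) (q / (J.m + 1))
  rw [wtEntryT, eval, eval, eval_var hρ, eval_m_add_one h (by omega), eval, eval,
    eval_var (v := q) (by rw [Function.update_of_ne (by omega), hρ]),
    eval_m_add_one h' (by omega)]
  generalize q / (J.m + 1) = u at *
  generalize q % (J.m + 1) = o at *
  set ρ' := Function.update (Function.update ρ 16 u) 17 o with hρ'
  have h' : Env J inp cW cT a 12 11 ρ' α := h'.setVar (by omega) _
  have ho' : (var 17).eval ρ' α = o := by simp [eval, hρ']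
  rw [eval, ho', wt]
  by_cases h0 : o = 0
  · rw [if_neg (by simpa using h0), if_pos h0, eval]
  have hpow : ∀ (D : Term) (i : ℕ) (β : ℕ → ℕ), Env J inp cW cT a 12 11 β α → D.eval β α = i →
      i < J.m * J.k + J.numT + 1 → (get 7 D).eval β α = J.n ^ i := fun D i β hβ hD hi =>
    eval_get (f := fun i => J.n ^ i) (hβ.arr 7 (by omega)) hD hi
  rw [if_pos h0, if_neg h0, eval, hpow _ (o - 1) _ h' (by rw [eval, ho', eval])
    (by rw [numT]; omega), eval, show (var 2).eval ρ' α = J.t from h'.var 2 (by omega)]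
  congr 1
  refine Finset.sum_congr rfl fun z hz => ?_
  have hz := Finset.mem_range.1 hz
  set ρ₃ := Function.update ρ' 18 z with hρ₃
  have h₃ : Env J inp cW cT a 12 11 ρ₃ α := h'.setVar (by omega) _
  have hlt := mul_add_lt_mul (show o - 1 < J.m by omega) hz
  have e₁ := eval_tau hr h₃ (U := var 16) (Z := var 18) (u := u) (z := z) (by omega)
    (by simp [eval, hρ₃, hρ']) (by simp [eval, hρ₃]) hu hz
  have e₂ : (get 7 (add (var 1) (add (get 1 (sub (var 17) (num 1))) (var 18)))).eval ρ₃ α =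
      J.n ^ (J.m + ((o - 1) * J.t + z)) := by
    refine hpow _ _ _ h₃ ?_ (by rw [numT]; omega)
    rw [eval, eval, h₃.var 1 (by omega), V, eval, eval_get (f := fun i => i * J.t) (i := o - 1)
      (h₃.arr 1 (by omega)) (by simp [eval, hρ₃, hρ']) (by omega), eval, hρ₃,
      Function.update_self]
  rw [eval, e₁, e₂, eval]
  have := J.τ_le u z
  split_ifs with hτ
  · rw [show J.τ u z = 1 by omega, one_mul]
  · rw [show J.τ u z = 0 by omega, zero_mul]

theorem cost_wtEntry_le (h : Env J inp cW cT a 12 11 ρ α) {q : ℕ}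
    (hq : q < J.n * (J.m + 1)) (hρ : ρ 15 = q) :
    wtEntryT.cost ρ α ≤ 28 * J.n + 1000 * (J.t + 1) := by
  have hdiv : q / (J.m + 1) ≤ J.n := (Nat.div_lt_of_lt_mul (by rwa [mul_comm])).le
  refine (cost_bind_le (cost_quo_le (eval_var hρ) (eval_m_add_one h (by omega))
    (ca := 2) (cb := 8) le_rfl le_rfl hdiv) rfl (cost_bind_le (cost_rem_le (x := q) (eval_var ?_)
      (eval_m_add_one (h.setVar (x := 16) (by omega) _) (by omega)) (ca := 2) (cb := 8) le_rfl
      le_rfl hdiv) rfl (cost_ite_le (x := 2) (z := 2) le_rfl (cost_add_le (x := 100)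
        (cost_flat rfl (by decide)) (cost_sum_le (cN := 2) (B := 800) le_rfl
          (((h.setVar (x := 16) (by omega) _).setVar (x := 17) (by omega) _).eval 2 (by omega))
          fun _ _ => cost_flat rfl (by decide))) le_rfl))).trans ?_
  · rw [Function.update_of_ne (by omega), hρ]
  · simp only [V]
    omega

theorem eval_row (h : Env J inp cW cT a 12 12 ρ α) (p : ℕ) :
    rowT.eval (Function.update ρ 15 p) (Function.update α 12 (clip p fun p => p / J.n ^ J.numT)) =
      p / J.n ^ J.numT := by
  have hs : 0 < J.n ^ J.numT := pow_pos J.n_pos _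
  set ρ' := Function.update ρ 15 p with hρ'
  set α' := Function.update α 12 (clip p fun p => p / J.n ^ J.numT) with hα'
  have h' : Env J inp cW cT a 12 12 ρ' α' := (h.setVar (by omega) _).setArr (by omega) _
  have h₁ : (var 15).eval ρ' α' = p := by simp [eval, hρ']
  have h₂ : (var 11).eval ρ' α' = J.n ^ J.numT := h'.var 11 (by omega)
  have hlt := tr_lt h₁ h₂
  rw [Tr] at hlt
  rw [rowT, eval]
  simp only [hlt]
  split_ifs with hp
  · rw [eval, Nat.div_eq_of_lt hp]
  · rw [eval, eval_get (f := fun p => p / J.n ^ J.numT) (i := p - J.n ^ J.numT)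
      (Function.update_self ..) (by rw [eval, h₁, h₂]) (by omega), eval]
    exact (Nat.div_eq_sub_div hs (by omega)).symm

theorem eval_col (h : Env J inp cW cT a 12 13 ρ α) (p : ℕ) :
    colT.eval (Function.update ρ 15 p) (Function.update α 13 (clip p fun p => p % J.n ^ J.numT)) =
      p % J.n ^ J.numT := by
  have hs : 0 < J.n ^ J.numT := pow_pos J.n_pos _
  set ρ' := Function.update ρ 15 p with hρ'
  set α' := Function.update α 13 (clip p fun p => p % J.n ^ J.numT) with hα'
  have h' : Env J inp cW cT a 12 13 ρ' α' := (h.setVar (by omega) _).setArr (by omega) _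
  have h₁ : (var 15).eval ρ' α' = p := by simp [eval, hρ']
  have h₂ : (var 11).eval ρ' α' = J.n ^ J.numT := h'.var 11 (by omega)
  have hlt := tr_lt h₁ h₂
  rw [Tr] at hlt
  rw [colT, eval]
  simp only [hlt]
  split_ifs with hp
  · rw [h₁, Nat.mod_eq_of_lt hp]
  · rw [eval_get (f := fun p => p % J.n ^ J.numT) (i := p - J.n ^ J.numT)
      (Function.update_self ..) (by rw [eval, h₁, h₂]) (by omega), ← Nat.mod_eq_sub_mod (by omega)]

theorem spec_sums (hr : Reads J inp) (hm : 0 < J.m) (h : Env J inp 0 0 0 12 10 ρ α) :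
    Spec sumsT ρ α (∃ f, J.Stable f) (1100000 * J.fullBudget) := by
  have hs := hr.small hm
  have hN : ∀ β, (mul (var 0) (add (var 1) (num 1))).eval ρ β = J.n * (J.m + 1) := fun β => by
    refine eval_mul (eval_var (h.var 0 (by omega))) fun i => ?_
    rw [eval, eval, eval, Function.update_of_ne (by omega), h.var 1 (by omega), V]
  have hN' : ∀ β, (mul (add (var 0) (num 1)) (var 11)).eval ρ β = (J.n + 1) * J.n ^ J.numT :=
    fun β => eval_mul (by rw [eval, eval, eval, h.var 0 (by omega), V]) fun i =>
      eval_var (by rw [Function.update_of_ne (by omega)]; exact h.var 11 (by omega))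
  have hcN' : ∀ β, (mul (add (var 0) (num 1)) (var 11)).cost ρ β ≤ 8 + (J.n + 1) * (2 + 12) + 14 :=
    fun β => cost_mul_le (by rw [eval, eval, eval, h.var 0 (by omega), V]) le_rfl fun _ => le_rfl
  have h₁ : Env J inp 0 0 0 12 11 ρ (Function.update α 10 (clip J.n fun i => i * (J.m + 1))) :=
    h.nextArr rfl
  have h₂ := h₁.nextArr rfl
  have h₃ := h₂.nextArr rfl
  have h₄ := h₃.nextArr rfl
  have s₄ := Spec.arr (x := 15) (f := colT) (B := 300) (hN' _) (hcN' _)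
    (fun p _ => eval_col h₃ p) (fun _ _ => cost_flat rfl (by decide)) (spec_guess hr hm h₄)
  have s₃ := Spec.arr (x := 15) (f := rowT) (B := 300) (hN' _) (hcN' _)
    (fun p _ => eval_row h₂ p) (fun _ _ => cost_flat rfl (by decide)) s₄
  have s₂ := Spec.arr (x := 15) (f := wtEntryT) (hN _) (cost_mul_le (ca := 2) (cb := 8)
    (h₁.eval 0 (by omega)) le_rfl fun _ => le_rfl) (fun q hq => eval_wtEntry hr
      ((h₁.setVar (by omega) q).setArr (A := 11) (by omega) _) hq (Function.update_self ..))
    (fun q hq => cost_wtEntry_le ((h₁.setVar (by omega) q).setArr (A := 11) (by omega) _) hq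
      (Function.update_self ..)) s₃
  refine (Spec.multiples (cN := 2) (cv := 8) (h.eval 0 (by omega)) le_rfl (fun i g =>
    eval_m_add_one ((h.setVar (x := 31) (by omega) i).setArr (A := 10) (by omega) g) (by omega))
    (fun _ _ => le_rfl) s₂).mono ?_
  obtain ⟨g₁, -, g₂, g₃, -, g₄⟩ := hs.setup_le
  have hn := J.n_pos
  have c₁ : J.n ≤ J.n * J.n := Nat.le_mul_of_pos_right _ hn
  have c₂ : J.n * J.n ≤ J.n * J.n * J.n := Nat.le_mul_of_pos_right _ hn
  have c₃ : J.n * J.m ≤ J.n * J.m * J.n := Nat.le_mul_of_pos_right _ hn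
  have c₄ : J.n * J.t ≤ J.n * J.m * J.t := Nat.mul_le_mul_right _ (Nat.le_mul_of_pos_right _ hm)
  have c₅ : J.n ^ J.numT ≤ J.n * J.n ^ J.numT := Nat.le_mul_of_pos_left _ hn
  simp only [V]
  generalize J.n ^ J.numT = s at *
  linarith

theorem spec_powers (hr : Reads J inp) (hm : 0 < J.m) (h : Env J inp 0 0 0 9 7 ρ α) :
    Spec powersT ρ α (∃ f, J.Stable f) (1200000 * J.fullBudget) := by
  have hs := hr.small hm
  have h₁ := h.nextVar (y := J.m * J.k) rfl
  have h₂ := h₁.nextVar (y := J.m + J.m * J.t) rfl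
  have h₃ := h₂.nextArr (g := clip (J.m * J.k + J.numT + 1) fun i => J.n ^ i) rfl
  have h₄ := h₃.nextVar (y := J.n ^ J.numT) rfl
  have h₅ := h₄.nextArr (g := clip (J.t + 2) fun i => J.k ^ i) rfl
  have h₆ := h₅.nextArr (g := clip J.t J.total) rfl
  have s₆ := Spec.arr (x := 15) (f := totalT) (cN := 2) (h₅.eval 2 (by omega)) le_rfl (fun z hz =>
    eval_total hr ((h₅.setVar (by omega) z).setArr (A := 9) (by omega) _) hz
      (Function.update_self ..)) (fun z _ => cost_total_le ((h₅.setVar (by omega) z).setArr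
        (A := 9) (by omega) _)) (spec_sums hr hm h₆)
  have s₅ := Spec.powers (cN := 8) (cv := 2) (N := add (var 2) (num 2)) (v := var 8)
    (by rw [eval, eval, eval, h₄.var 2 (by omega), V]) le_rfl
    (fun i g => ((h₄.setVar (x := 30) (by omega) i).setArr (A := 8) (by omega) g).eval 8 (by omega))
    (fun _ _ => le_rfl) s₆
  have s₄ := Spec.bind (a := get 7 (var 10)) (ca := 100) (eval_get (f := fun i => J.n ^ i)
    (h₃.arr 7 (by omega)) (h₃.eval 10 (by omega)) (by simp only [V]; omega))
    (cost_flat rfl (by decide)) s₅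
  have s₃ := Spec.powers (cN := 14) (cv := 2) (N := add (add (var 9) (var 10)) (num 1)) (v := var 0)
    (by rw [eval, eval, eval, eval, eval, h₂.var 9 (by omega), h₂.var 10 (by omega), V, V]) le_rfl
    (fun i g => ((h₂.setVar (x := 30) (by omega) i).setArr (A := 7) (by omega) g).eval 0 (by omega))
    (fun _ _ => le_rfl) s₄
  have s₂ := Spec.bind (a := add (var 1) (mul (var 1) (var 2)))
    (by rw [eval, eval_mul (h₁.eval 1 (by omega)) fun i =>
      (h₁.setVar (x := 31) (by omega) i).eval 2 (by omega), eval, h₁.var 1 (by omega), V, V])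
    (cost_add_le (x := 2) le_rfl (cost_mul_le (ca := 2) (cb := 2) (h₁.eval 1 (by omega)) le_rfl
      fun _ => le_rfl)) s₃
  refine (Spec.bind (a := mul (var 1) (var 8)) (eval_mul (h.eval 1 (by omega)) fun i =>
      (h.setVar (x := 31) (by omega) i).eval 8 (by omega))
    (cost_mul_le (ca := 2) (cb := 2) (h.eval 1 (by omega)) le_rfl fun _ => le_rfl) s₂).mono ?_
  obtain ⟨g₁, -, g₂, g₃, g₄, -⟩ := hs.setup_le
  have hn := J.n_pos
  have c₁ : J.n ≤ J.n * J.n := Nat.le_mul_of_pos_right _ hn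
  have c₂ : J.n * J.n ≤ J.n * J.n * J.n := Nat.le_mul_of_pos_right _ hn
  have c₃ : J.m ≤ J.n * J.m := Nat.le_mul_of_pos_left _ hn
  have c₄ : J.n * J.m ≤ J.n * J.m * J.n := Nat.le_mul_of_pos_right _ hn
  have c₅ : J.m * J.t ≤ J.n * (J.m * J.t) := Nat.le_mul_of_pos_left _ hn
  have c₆ : J.n * J.t ≤ J.n * J.m * J.t := Nat.mul_le_mul_right _ (Nat.le_mul_of_pos_right _ hm)
  have c₇ : J.t ≤ J.n * J.t := Nat.le_mul_of_pos_left _ hn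
  have c₈ : J.t * J.k ≤ J.t * J.n := Nat.mul_le_mul_left _ hs.k_le
  have c₉ : J.m * J.k ≤ J.n * (J.m * J.k) := Nat.le_mul_of_pos_left _ hn
  have hk := hs.k_le
  rw [numT]
  simp only [V]
  linarith

theorem spec_types (hr : Reads J inp) (hm : 0 < J.m) (h : Env J inp 0 0 0 8 4 ρ α) :
    Spec typesT ρ α (∃ f, J.Stable f) (1300000 * J.fullBudget) := by
  have hs := hr.small hm
  have h₁ := h.nextArr (g := clip J.n (TypeId.first J.t J.τ)) rfl
  have h₂ := h₁.nextVar (y := J.k) rfl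
  have h₃ := h₂.nextArr (g := clip J.n J.tid) rfl
  have h₄ := h₃.nextArr (g := clip J.m fun i => i * J.k) rfl
  have s₄ := Spec.multiples (cN := 2) (cv := 2) (N := var 1) (v := var 8)
    (h₃.eval 1 (by omega)) le_rfl
    (fun i g => ((h₃.setVar (x := 31) (by omega) i).setArr (A := 6) (by omega) g).eval 8 (by omega))
    (fun _ _ => le_rfl) (spec_powers hr hm h₄)
  have s₃ := Spec.arr (x := 15) (f := tidT) (cN := 2) (h₂.eval 0 (by omega)) le_rfl (fun u hu =>
    eval_tidT hr ((h₂.setVar (by omega) u).setArr (A := 5) (by omega) _) hu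
      (Function.update_self ..)) (fun u hu => cost_tidT_le ((h₂.setVar (by omega) u).setArr
        (A := 5) (by omega) _) hu (Function.update_self ..)) s₄
  have s₂ := Spec.bind (eval_kT hr h₁) (cost_kT_le h₁) s₃
  refine (Spec.arr (x := 15) (f := firstT) (cN := 2) (h.eval 0 (by omega)) le_rfl (fun u hu =>
    eval_first hr ((h.setVar (by omega) u).setArr (A := 4) (by omega) _) hu
      (Function.update_self ..)) (fun u hu => cost_first_le ((h.setVar (by omega) u).setArr
        (A := 4) (by omega) _) hu (Function.update_self ..)) s₂).mono ?_
  obtain ⟨g₁, g₂, g₃, -⟩ := hs.setup_le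
  have hn := J.n_pos
  have c₁ : J.n ≤ J.n * J.n := Nat.le_mul_of_pos_right _ hn
  have c₂ : J.n * J.n ≤ J.n * J.n * J.n := Nat.le_mul_of_pos_right _ hn
  have c₃ : J.m ≤ J.n * J.m := Nat.le_mul_of_pos_left _ hn
  have c₄ : J.n * J.m ≤ J.n * J.m * J.n := Nat.le_mul_of_pos_right _ hn
  simp only [V]
  linarith

theorem spec_tables (hr : Reads J inp) (hm : 0 < J.m) (h : Env J inp 0 0 0 3 1 ρ α) :
    Spec tablesT ρ α (∃ f, J.Stable f) (1400000 * J.fullBudget) := by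
  have hs := hr.small hm
  -- The five offsets have the same form: the previous offset plus the size of one table.
  have offset : ∀ {v a b : ℕ} {x : Term} {o c : ℕ} {e : Term} {P : Prop} {ρ : ℕ → ℕ}
      (h : Env J inp 0 0 0 v 1 ρ α) (ha : a < v) (hb : b < v) (hv : v < 15)
      (hx : x.eval ρ α = o) (hx' : x.cost ρ α ≤ 2)
      (_ : Spec e (Function.update ρ v (o + V J 0 0 0 a * V J 0 0 0 b)) α P c),
      Spec (bind v (add x (mul (var a) (var b))) e) ρ α P (14 * V J 0 0 0 a + 40 + c) := by
    intro v a b x o c e P ρ h ha hb hv hx hx' hs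
    refine (Spec.bind (by rw [eval, hx, eval_mul (h.eval a ha) fun i =>
      (h.setVar (x := 31) (by omega) i).eval b hb]) (cost_add_le hx' (cost_mul_le (ca := 2)
        (cb := 2) (h.eval a ha) le_rfl fun _ => le_rfl)) hs).mono (by omega)
  have h₃ := h.nextVar (y := 3 + J.n * J.t) rfl
  have h₄ := h₃.nextVar (y := 3 + J.n * J.t + J.n * J.m) rfl
  have h₅ := h₄.nextVar (y := 3 + J.n * J.t + J.n * J.m + J.m * J.n) rfl
  have h₆ := h₅.nextVar (y := 3 + J.n * J.t + J.n * J.m + J.m * J.n + J.m * J.t) rfl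
  have h₇ := h₆.nextVar (y := 3 + J.n * J.t + J.n * J.m + J.m * J.n + J.m * J.t + J.m * J.t) rfl
  have k₁ := h₇.nextArr (g := clip (J.n + J.m) fun i => i * J.t) rfl
  have k₂ := k₁.nextArr (g := clip J.n fun i => i * J.m) rfl
  have k₃ := k₂.nextArr (g := clip J.m fun i => i * J.n) rfl
  have s₃ := Spec.multiples (cN := 2) (cv := 2) (N := var 1) (v := var 0)
    (k₂.eval 1 (by omega)) le_rfl
    (fun i g => ((k₂.setVar (x := 31) (by omega) i).setArr (A := 3) (by omega) g).eval 0 (by omega))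
    (fun _ _ => le_rfl) (spec_types hr hm k₃)
  have s₂ := Spec.multiples (cN := 2) (cv := 2) (N := var 0) (v := var 1)
    (k₁.eval 0 (by omega)) le_rfl
    (fun i g => ((k₁.setVar (x := 31) (by omega) i).setArr (A := 2) (by omega) g).eval 1 (by omega))
    (fun _ _ => le_rfl) s₃
  have s₁ := Spec.multiples (cN := 8) (cv := 2) (N := add (var 0) (var 1)) (v := var 2)
    (by rw [eval, eval, eval, h₇.var 0 (by omega), h₇.var 1 (by omega), V, V]) le_rfl
    (fun i g => ((h₇.setVar (x := 31) (by omega) i).setArr (A := 1) (by omega) g).eval 2 (by omega))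
    (fun _ _ => le_rfl) s₂
  refine (offset h (by omega) (by omega) (by omega) rfl le_rfl (offset h₃ (by omega) (by omega)
    (by omega) (h₃.eval 3 (by omega)) le_rfl (offset h₄ (by omega) (by omega) (by omega)
    (h₄.eval 4 (by omega)) le_rfl (offset h₅ (by omega) (by omega) (by omega)
    (h₅.eval 5 (by omega)) le_rfl (offset h₆ (by omega) (by omega) (by omega)
    (h₆.eval 6 (by omega)) le_rfl s₁))))).mono ?_
  obtain ⟨g₁, -, g₃, -⟩ := hs.setup_le
  have hn := J.n_pos
  have c₁ : J.n ≤ J.n * J.n := Nat.le_mul_of_pos_right _ hn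
  have c₂ : J.n * J.n ≤ J.n * J.n * J.n := Nat.le_mul_of_pos_right _ hn
  have c₃ : J.m ≤ J.n * J.m := Nat.le_mul_of_pos_left _ hn
  have c₄ : J.n * J.m ≤ J.n * J.m * J.n := Nat.le_mul_of_pos_right _ hn
  simp only [V]
  linarith

theorem eval_main (hr : Reads J inp) (hm : 0 < J.m) (h : Env J inp 0 0 0 3 1 ρ α) :
    mainT.eval ρ α = ind (∃ f, J.Stable f) := eval_bool (spec_tables hr hm h).tr

theorem cost_main_le (hr : Reads J inp) (hm : 0 < J.m) (h : Env J inp 0 0 0 3 1 ρ α) :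
    mainT.cost ρ α ≤ 1400000 * J.fullBudget + 6 := cost_bool_le (spec_tables hr hm h).cost

end Alg

end RAM

/-! ### The machine and its running time -/

namespace RAM

open Term NumInst

/-- The term for the length of the input. -/
def lengthT : Term :=
  add (add (add (add (add (add (num 3) (mul (var 0) (var 2))) (mul (var 0) (var 1)))
    (mul (var 1) (var 0))) (mul (var 1) (var 2))) (mul (var 1) (var 2))) (var 1)

theorem AnswersWithin.mono {p : Prog} {l : List ℕ} {P : Prop} {T T' : ℕ}
    (h : AnswersWithin p l P T) (hT : T ≤ T') : AnswersWithin p l P T' := by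
  obtain ⟨T₀, s, h₁, h₂, h₃⟩ := h
  exact ⟨T₀, s, h₁, h₂.trans hT, h₃⟩

theorem clip_getD (l : List ℕ) (i : ℕ) : clip l.length (fun i => l.getD i 0) i = l.getD i 0 := by
  rw [clip]
  split_ifs with h
  · rfl
  · rw [List.getD_eq_default _ _ (not_lt.1 h)]

variable {n m t : ℕ} (I : SMTIDiverse n m t)

theorem reads_encode (hn : 0 < n) :
    Reads (I.toNum hn) (clip I.encode.length fun i => I.encode.getD i 0) := by
  obtain ⟨-, -, -, h₁, h₂, h₃, h₄, h₅, h₆⟩ := I.getD_encode hn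
  exact ⟨fun u hu z hz => (clip_getD _ _).trans (h₁ u hu z hz),
    fun u hu w hw => (clip_getD _ _).trans (h₂ u hu w hw),
    fun w hw u hu => (clip_getD _ _).trans (h₃ w hw u hu),
    fun w hw z hz => (clip_getD _ _).trans (h₄ w hw z hz),
    fun w hw z hz => (clip_getD _ _).trans (h₅ w hw z hz),
    fun w hw => (clip_getD _ _).trans (h₆ w hw), rfl, fun _ _ => rfl⟩

theorem env_encode (hn : 0 < n) :
    Env (I.toNum hn) (clip I.encode.length fun i => I.encode.getD i 0) 0 0 0 3 1
      (startVars I.encode) (startArrays I.encode) := by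
  obtain ⟨h₀, h₁, h₂, -⟩ := I.getD_encode hn
  constructor
  · intro x hx
    interval_cases x
    · exact h₀
    · exact h₁
    · exact h₂
  · intro i hi
    obtain rfl : i = 0 := by omega
    rfl

theorem eval_lengthT (hn : 0 < n) :
    lengthT.eval (startVars I.encode) (fun _ _ => 0) = I.encode.length := by
  have h := env_encode I hn
  have e : ∀ a b, a < 3 → b < 3 → (mul (var a) (var b)).eval (startVars I.encode) (fun _ _ => 0) =
      V (I.toNum hn) 0 0 0 a * V (I.toNum hn) 0 0 0 b := fun a b ha hb =>
    eval_mul (eval_var (h.var a ha)) fun i =>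
      eval_var (by rw [Function.update_of_ne (by omega), h.var b hb])
  have e₁ := e 0 2 (by omega) (by omega)
  have e₂ := e 0 1 (by omega) (by omega)
  have e₃ := e 1 0 (by omega) (by omega)
  have e₄ := e 1 2 (by omega) (by omega)
  simp only [lengthT, eval, e₁, e₂, e₃, e₄, h.var 1 (by omega), I.length_encode]
  rfl

theorem cost_lengthT_le (hn : 0 < n) :
    lengthT.cost (startVars I.encode) (fun _ _ => 0) ≤ 28 * n + 42 * m + 200 := by
  have h := env_encode I hn
  have e : ∀ a b, a < 3 → (mul (var a) (var b)).cost (startVars I.encode) (fun _ _ => 0) ≤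
      2 + V (I.toNum hn) 0 0 0 a * (2 + 12) + 14 := fun a b ha =>
    cost_mul_le (eval_var (h.var a ha)) le_rfl fun i => le_rfl
  have h₀ : V (I.toNum hn) 0 0 0 0 = n := rfl
  have h₁ : V (I.toNum hn) 0 0 0 1 = m := rfl
  refine (cost_add_le (y := 2) (cost_add_le (cost_add_le (cost_add_le (cost_add_le (cost_add_le
    (x := 2) le_rfl (e 0 2 (by omega))) (e 0 1 (by omega))) (e 1 0 (by omega))) (e 1 2 (by omega)))
    (e 1 2 (by omega))) le_rfl).trans ?_
  rw [h₀, h₁]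
  omega

theorem scoped_lengthT : lengthT.Scoped 0 := by
  simp [lengthT, mul, Scoped]

theorem noStore_lengthT : (lengthT.comp 33).NoStore := by
  simp [lengthT, mul, comp, Prog.NoStore]

open Alg in
theorem scoped_mainT : mainT.Scoped 1 := by
  simp [mainT, tablesT, typesT, powersT, sumsT, guessT, checkT, testT, reachT, countT, wtT, feasT,
    optArrT, optT, optT₁, optT₂, optT₃, blkArrT, blkT, fitsT, fitsT₁, fitsT₂, memberT, needT,
    firstT, kT, tidT, totalT, wtEntryT, rowT, colT, sizeOfT, loadOfT, tauT, rsT, rcT, loT, upT, cpT,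
    worstT, sizeT, loadT, validT, withMultiples, withPowers, withDigits, mul, Term.all, Term.bool, Term.and,
    imp, Term.lt, Term.le, Term.eq, Scoped]

/-- The machine that decides the problem. -/
def machine : Prog := lengthT.prog Alg.mainT

theorem answersWithin_machine (hn : 0 < n) : AnswersWithin machine I.encode
    I.HasFeasibleStableMatching (2000000 * (n ^ (m * 2 ^ t + (2 * m + 1) * (t + 1)) * m ^ 2 *
      (n ^ t * t + m))) := by
  -- A student exists and accepts some college, so `m` is positive without being assumed.
  have hm : 0 < m := by
    obtain ⟨w, -⟩ := I.acc_student ⟨0, hn⟩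
    exact w.pos
  have hr := reads_encode I hn
  have h := env_encode I hn
  have hs : (I.toNum hn).Small := hr.small hm
  obtain ⟨T, s, h₁, h₂, h₃⟩ := run_prog scoped_lengthT noStore_lengthT scoped_mainT I.encode
    (eval_lengthT I hn)
  refine ⟨T, s, h₁, h₂.trans (le_trans ?_ (Nat.mul_le_mul_left 2000000 hs.fullBudget_le)), ?_⟩
  · have e₁ := cost_lengthT_le I hn
    have e₂ := Alg.cost_main_le hr hm h
    obtain ⟨g₁, -, g₂, g₃, -⟩ := hs.setup_le
    rw [I.length_encode]
    generalize (I.toNum hn).fullBudget = G at *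
    change n * n * n ≤ G at g₁
    change n * m * n ≤ G at g₂
    change n * m * t ≤ G at g₃
    have c₁ : n ≤ n * n := Nat.le_mul_of_pos_right _ hn
    have c₂ : n * n ≤ n * n * n := Nat.le_mul_of_pos_right _ hn
    have c₃ : m ≤ n * m := Nat.le_mul_of_pos_left _ hn
    have c₄ : n * m ≤ n * m * n := Nat.le_mul_of_pos_right _ hn
    have c₅ : m * t ≤ n * (m * t) := Nat.le_mul_of_pos_left _ hn
    have c₆ : n * t ≤ n * m * t := Nat.mul_le_mul_right _ (Nat.le_mul_of_pos_right _ hm)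
    linarith
  · rw [h₃, Alg.eval_main hr hm h, I.exists_stable_toNum_iff hn]
    exact ⟨fun h => if_pos h, fun h => if_neg h⟩

end RAM

/-- There is one random access machine that decides SMTI-Diverse within the stated number of steps,
with an absolute constant; in particular, for every `k`, its running time on instances with
`m + t ≤ k` is bounded by a polynomial in the input length. -/
theorem mainTheorem5 :
    ∃ P : RAM.Prog,
      (∃ C : ℕ, ∀ (n m t : ℕ) (I : SMTIDiverse n m t), 1 ≤ n →
        RAM.AnswersWithin P I.encode I.HasFeasibleStableMatching
          (C * (n ^ (m * 2 ^ t + (2 * m + 1) * (t + 1)) * m ^ 2 * (n ^ t * t + m)))) ∧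
      (∀ k : ℕ, ∃ p : Polynomial ℕ, ∀ (n m t : ℕ) (I : SMTIDiverse n m t), 1 ≤ n →
        m + t ≤ k →
        RAM.AnswersWithin P I.encode I.HasFeasibleStableMatching
          (p.eval I.encode.length)) := by
  refine ⟨RAM.machine, ⟨2000000, fun n m t I hn => RAM.answersWithin_machine I hn⟩, fun k => ?_⟩
  refine ⟨2000000 * (.X ^ (k * 2 ^ k + (2 * k + 1) * (k + 1)) * (k : Polynomial ℕ) ^ 2 *
    (.X ^ k * (k : Polynomial ℕ) + (k : Polynomial ℕ))), fun n m t I hn hk => ?_⟩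
  refine (RAM.answersWithin_machine I hn).mono ?_
  have hm : 0 < m := by
    obtain ⟨w, -⟩ := I.acc_student ⟨0, hn⟩
    exact w.pos
  -- The preference table of the students alone has `n * m` entries.
  have hlen : n ≤ I.encode.length := by
    have := Nat.le_mul_of_pos_right n hm
    rw [I.length_encode]
    omega
  have hmk : m ≤ k := by omega
  have htk : t ≤ k := by omega
  have hpow : ∀ {a b : ℕ}, a ≤ b → n ^ a ≤ I.encode.length ^ b := fun {a b} hab =>
    (Nat.pow_le_pow_left hlen a).trans (Nat.pow_le_pow_right (by omega) hab)
  simp only [Polynomial.eval_mul, Polynomial.eval_add, Polynomial.eval_pow, Polynomial.eval_X,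
    Polynomial.eval_natCast, Polynomial.eval_ofNat, Nat.cast_id]
  have hexp : m * 2 ^ t + (2 * m + 1) * (t + 1) ≤ k * 2 ^ k + (2 * k + 1) * (k + 1) :=
    Nat.add_le_add (Nat.mul_le_mul hmk (Nat.pow_le_pow_right (by omega) htk))
      (Nat.mul_le_mul (by omega) (by omega))
  exact Nat.mul_le_mul_left _ (Nat.mul_le_mul (Nat.mul_le_mul (hpow hexp)
    (Nat.pow_le_pow_left hmk 2)) (Nat.add_le_add (Nat.mul_le_mul (hpow htk) htk) hmk))
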